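/- **Setting.** Let $\tilde{\mathcal T}_h$ be a finite conforming triangulation, by nondegenerate closed triangles, of a connected polygonal domain $\tilde\Omega_h=\operatorname{int}\bigcup_{\tilde T\in\tilde{\mathcal T}_h}\tilde T\subset\mathbb R^2$, such that every triangle has at most two vertices on $\partial\tilde\Omega_h$. Let $\hat T$ be the triangle with vertices $(1,0),(0,1),(0,0)$, let $\hat T^{ct}$ be its Clough–Tocher split into three triangles (connecting the vertices with the barycenter), and let $\mathcal N_{\hat T}$ be the set of the four vertices and six edge midpoints of $\hat T^{ct}$. For $\tilde T\in\tilde{\mathcal T}_h$ let $F_{\tilde T}:\hat T\to\tilde T$ be an orientation-preserving affine bijection. Let $G$ be a map from $\overline{\tilde\Omega_h}$ to $\mathbb R^2$ that fixes all vertices of the triangulation and the midpoints of all interior edges, let $G_h$ be its continuous piecewise quadratic nodal interpolant (nodes: vertices and edge midpoints of $\tilde{\mathcal T}_h$), and set $F_T=G_h\circ F_{\tilde T}$, $T=G_h(\tilde T)$, $\mathcal T_h=\{G_h(\tilde T):\tilde T\in\tilde{\mathcal T}_h\}$, $\Omega_h=\operatorname{int}\bigcup_{T\in\mathcal T_h}T$.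 Assume that $G_h$ is injective and that $\det DF_T>0$ on $\hat T$ for every $T$. Put $A_T=DF_T/\det(DF_T)$. **Spaces.** Let $$\hat V=\{\hat v\in H^1(\hat T)^2:\ \hat v|_{\hat K}\in\mathcal P_2(\hat K)^2\ \forall\hat K\in\hat T^{ct}\},\qquad \hat Q=\{\hat q\in L^2(\hat T):\ \hat q|_{\hat K}\in\mathcal P_1(\hat K)\ \forall\hat K\in\hat T^{ct}\},$$ $$\tilde V^h=\{\tilde v\in H^1_0(\tilde\Omega_h)^2:\ \tilde v|_{\tilde T}\circ F_{\tilde T}\in\hat V\ \forall\tilde T\},\qquad \tilde Q^h=\{\tilde q\in L^2(\tilde\Omega_h):\ \textstyle\int_{\tilde\Omega_h}\tilde q=0,\ \tilde q|_{\tilde T}\circ F_{\tilde T}\in\hat Q\ \forall\tilde T\}.$$ For $T\in\mathcal T_h$ let $V(T)=\{v:\ v(F_T(\hat x))=A_T(\hat x)\hat v(\hat x)\text{ for some }\hat v\in\hat V\}$. For $\tilde v\in\tilde V^h$ let $\Psi\tilde v$ be the function on $\Omega_h$ whose restriction to each $T=G_h(\tilde T)$ is the element of $V(T)$ with $(\Psi\tilde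 v)|_T(F_T(\hat a))=\tilde v(F_{\tilde T}(\hat a))$ for all $\hat a\in\mathcal N_{\hat T}$, and for $\tilde q\in\tilde Q^h$ let $\Upsilon\tilde q$ be given by $(\Upsilon\tilde q)|_T(F_T(\hat x))=\tilde q(F_{\tilde T}(\hat x))$. Set $V^h=\Psi\tilde V^h$ and $Q^h=\Upsilon\tilde Q^h$. **Theorem.** Let $\nu>0$ and $f_h\in L^2(\Omega_h)^2$. Then there is exactly one pair $(u_h,p_h)\in V^h\times Q^h$ (as functions on $\Omega_h$ up to null sets) such that $$\int_{\Omega_h}\nu\,\nabla u_h:\nabla v-\int_{\Omega_h}(\nabla\cdot v)\,p_h=\int_{\Omega_h}f_h\cdot v\quad\forall v\in V^h,\qquad \int_{\Omega_h}(\nabla\cdot u_h)\,q=0\quad\forall q\in Q^h,$$ where gradient and divergence are taken piecewise with respect to $\mathcal T_h$. -/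

import Mathlib

open MeasureTheory Filter Topology Set
open scoped ContDiff

noncomputable section

namespace IsoStokes

/-- The Euclidean plane. -/
abbrev E : Type := EuclideanSpace ℝ (Fin 2)

/-! ### Sobolev spaces of vector fields on an open set `U` of the plane -/

/-- `v ∈ H¹(U)²`: `v` is square integrable and has a square integrable weak gradient `g`. -/
def MemH1 (U : Set E) (v : E → E) : Prop :=
  MemLp v 2 (volume.restrict U) ∧
  ∃ g : E → (E →L[ℝ] E), MemLp g 2 (volume.restrict U) ∧
    ∀ φ : E → ℝ, ContDiff ℝ ∞ φ → HasCompactSupport φ → tsupport φ ⊆ U → ∀ e : E,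
      ∫ x in U, (fderiv ℝ φ x e) • v x = - ∫ x in U, φ x • g x e

/-- `v ∈ H¹₀(U)²`, the closure of `C_c^∞(U)²` in the `H¹` norm: there are test fields `φ n` with
`φ n → v` and `∇ (φ n) → g` in `L²(U)` (the limit `g` is then the weak gradient of `v`). -/
def MemH10 (U : Set E) (v : E → E) : Prop :=
  MemLp v 2 (volume.restrict U) ∧
  ∃ g : E → (E →L[ℝ] E), MemLp g 2 (volume.restrict U) ∧
    ∃ φ : ℕ → E → E,
      (∀ n, ContDiff ℝ ∞ (φ n) ∧ HasCompactSupport (φ n) ∧ tsupport (φ n) ⊆ U) ∧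
      Tendsto (fun n => eLpNorm (fun x => φ n x - v x) 2 (volume.restrict U)) atTop (𝓝 0) ∧
      Tendsto (fun n => eLpNorm (fun x => fderiv ℝ (φ n) x - g x) 2 (volume.restrict U))
        atTop (𝓝 0)

/-- `q ∈ L²₀(U)`: square integrable with mean value zero. -/
def MemL20 (U : Set E) (q : E → ℝ) : Prop :=
  MemLp q 2 (volume.restrict U) ∧ ∫ x in U, q x = 0

/-! ### The reference triangle, its Clough–Tocher split and the reference spaces -/

/-- The vertices `(1,0), (0,1), (0,0)` of the reference triangle, and its barycenter. -/
def ctVert : Fin 4 → E := ![!₂[1, 0], !₂[0, 1], !₂[0, 0], !₂[1 / 3, 1 / 3]]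

/-- The closed reference triangle. -/
def refTri : Set E := convexHull ℝ (range fun k : Fin 3 => ctVert k.castSucc)

/-- The three closed triangles of the Clough–Tocher split; the `i`-th one does not contain the
`i`-th vertex of the reference triangle. -/
def ctTri (i : Fin 3) : Set E := convexHull ℝ (ctVert '' {k | k ≠ i.castSucc})

/-- The four vertices and the six edge midpoints of the Clough–Tocher split. -/
def refNodes : Set E := {a | ∃ k l : Fin 4, a = midpoint ℝ (ctVert k) (ctVert l)}

/-- Barycentric coordinates on the reference triangle. -/
def bary (k : Fin 3) (x : E) : ℝ := ![x 0, x 1, 1 - x 0 - x 1] k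

/-- `q` agrees on `S` with a polynomial of degree at most `d`. -/
def IsPolyOn (d : ℕ) (S : Set E) (q : E → ℝ) : Prop :=
  ∃ P : MvPolynomial (Fin 2) ℝ, P.totalDegree ≤ d ∧
    ∀ x ∈ S, q x = MvPolynomial.eval (fun j => x j) P

/-- The reference velocity space: `H¹` fields that are quadratic on every triangle of the split.
The triangles are closed, so that an element is its own continuous representative, which is the
one that is evaluated at the nodes. -/
def refVel : Set (E → E) :=
  {v | MemH1 (interior refTri) v ∧ ∀ i : Fin 3, ∀ j : Fin 2, IsPolyOn 2 (ctTri i) fun x => v x j}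

/-- The reference pressure space: functions that are affine on every (open) triangle of the split,
without continuity. Such functions are in `L²`. -/
def refPres : Set (E → ℝ) :=
  {q | ∀ i : Fin 3, IsPolyOn 1 (interior (ctTri i)) q}

/-! ### The affine triangulation -/

/-- A triangulation of a connected polygonal domain into triangles indexed by `ι`,
given by the vertices of the triangles. -/
structure AffineMesh (ι : Type*) where
  /-- the three vertices of a triangle -/
  vert : ι → Fin 3 → E
  /-- the vertices are listed counterclockwise; in particular triangles are nondegenerate -/
  orient : ∀ i, 0 < (vert i 0 - vert i 2) 0 * (vert i 1 - vert i 2) 1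
      - (vert i 0 - vert i 2) 1 * (vert i 1 - vert i 2) 0
  /-- a triangle occurs only once -/
  inj : Function.Injective fun i => range (vert i)
  /-- two triangles meet in nothing, a common vertex or a common edge -/
  conforming : ∀ i j, i ≠ j →
    convexHull ℝ (range (vert i)) ∩ convexHull ℝ (range (vert j))
      = convexHull ℝ (range (vert i) ∩ range (vert j))
  /-- the polygonal domain is connected (and not empty) -/
  connected : IsConnected (interior (⋃ i, convexHull ℝ (range (vert i))))
  /-- every triangle has at most two boundary vertices -/
  interior_vert : ∀ i, ∃ k,
    vert i k ∉ frontier (interior (⋃ i, convexHull ℝ (range (vert i))))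

namespace AffineMesh

variable {ι : Type*} (M : AffineMesh ι)

/-- The polygonal domain. -/
def domain : Set E := interior (⋃ i, convexHull ℝ (range (M.vert i)))

/-- The affine map of the reference triangle onto the triangle `i`. -/
def affMap (i : ι) (x : E) : E := ∑ k, bary k x • M.vert i k

/-- The midpoint of the edge of triangle `i` opposite to its `k`-th vertex. -/
def edgeMid (i : ι) (k : Fin 3) : E := midpoint ℝ (M.vert i (k + 1)) (M.vert i (k + 2))

/-- The edge of triangle `i` opposite to its `k`-th vertex is an interior edge:
it belongs to another triangle, too. -/
def IsInteriorEdge (i : ι) (k : Fin 3) : Prop :=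
  ∃ j, j ≠ i ∧ M.vert i (k + 1) ∈ range (M.vert j) ∧ M.vert i (k + 2) ∈ range (M.vert j)

/-- The continuous velocity space on the affine mesh. -/
def vel : Set (E → E) :=
  {v | MemH10 M.domain v ∧
    ∀ i, ∃ vhat ∈ refVel, ∀ x ∈ refTri, v (M.affMap i x) = vhat x}

/-- The discontinuous pressure space on the affine mesh. -/
def pres : Set (E → ℝ) :=
  {q | MemL20 M.domain q ∧
    ∀ i, ∃ qhat ∈ refPres, ∀ x ∈ interior refTri, q (M.affMap i x) = qhat x}

/-- `F_T = G_h ∘ F_T̃`, where `G_h` is the piecewise quadratic nodal interpolant of `G`: the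
quadratic polynomial map that agrees with `G ∘ F_T̃` at the vertices and edge midpoints of the
reference triangle. -/
def quadMap (G : E → E) (i : ι) (x : E) : E :=
  (∑ k, (bary k x * (2 * bary k x - 1)) • G (M.vert i k))
    + ∑ k : Fin 3, (4 * bary (k + 1) x * bary (k + 2) x) • G (M.edgeMid i k)

end AffineMesh

/-! ### The isoparametric triangulation -/

/-- An isoparametric triangulation: an affine one with a map `G` of the polygonal domain whose
piecewise quadratic nodal interpolant `G_h` maps the affine to the curved elements. -/
structure IsoMesh (ι : Type*) extends AffineMesh ι where
  /-- the map of the polygonal domain to the physical one -/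
  G : E → E
  /-- `G` fixes the vertices -/
  G_vert : ∀ i k, G (vert i k) = vert i k
  /-- interior edges stay straight: `G_h` is affine, hence the identity, on them -/
  G_mid : ∀ i k, toAffineMesh.IsInteriorEdge i k →
    G (toAffineMesh.edgeMid i k) = toAffineMesh.edgeMid i k
  /-- `G_h` is injective on the closed polygonal domain -/
  G_inj : ∀ i j, ∀ x ∈ refTri, ∀ y ∈ refTri,
    toAffineMesh.quadMap G i x = toAffineMesh.quadMap G j y →
      toAffineMesh.affMap i x = toAffineMesh.affMap j y
  /-- the Jacobians of the element maps are positive up to the boundary -/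
  det_pos : ∀ i, ∀ x ∈ refTri, 0 < (fderiv ℝ (toAffineMesh.quadMap G i) x).det

namespace IsoMesh

variable {ι : Type*} (M : IsoMesh ι)

/-- The element map `F_T` of the reference triangle onto the curved element `i`. -/
def F (i : ι) : E → E := M.toAffineMesh.quadMap M.G i

/-- The closed curved element `i`. -/
def elt (i : ι) : Set E := M.F i '' refTri

/-- The computational domain `Ω_h`. -/
def Omega : Set E := interior (⋃ i, M.elt i)

/-- The matrix `A_T = DF_T / det DF_T` of the Piola transform. -/
def piola (i : ι) (x : E) : E →L[ℝ] E := (fderiv ℝ (M.F i) x).det⁻¹ • fderiv ℝ (M.F i) x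

/-- The local velocity space `V(T)`: Piola transforms of reference fields. They are in `H¹(T)²`,
as `F_T` is a smooth diffeomorphism up to the boundary. -/
def localVel (i : ι) : Set (E → E) :=
  {w | ∃ vhat ∈ refVel, ∀ x ∈ refTri, w (M.F i x) = M.piola i x (vhat x)}

/-- `w = Ψ_T ṽ` on the element `i`: `w ∈ V(T)` has the values of `ṽ` at corresponding nodes. -/
def IsPsi (i : ι) (vt w : E → E) : Prop :=
  w ∈ M.localVel i ∧ ∀ a ∈ refNodes, w (M.F i a) = vt (M.toAffineMesh.affMap i a)

/-- The velocity space `V^h = Ψ Ṽ^h`. Its members are functions on `Ω_h` up to null sets: they may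
be discontinuous across interior edges, so they are prescribed in the open elements only. -/
def vel : Set (E → E) :=
  {v | ∃ vt ∈ M.toAffineMesh.vel, ∀ i, ∃ w, M.IsPsi i vt w ∧ EqOn v w (M.F i '' interior refTri)}

/-- The pressure space `Q^h = Υ Q̃^h`. -/
def pres : Set (E → ℝ) :=
  {q | ∃ qt ∈ M.toAffineMesh.pres, ∀ i, ∀ x ∈ interior refTri,
    q (M.F i x) = qt (M.toAffineMesh.affMap i x)}

end IsoMesh

/-! ### The finite element method -/

/-- The Frobenius product `∇u : ∇v` at `x`. For the fields used here the derivative exists in the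
interior of every element up to a null set, and it depends on the values in that element only, so
this is the piecewise gradient. -/
def gradDot (u v : E → E) (x : E) : ℝ :=
  ∑ i : Fin 2, ∑ j : Fin 2,
    fderiv ℝ u x (EuclideanSpace.single j 1) i * fderiv ℝ v x (EuclideanSpace.single j 1) i

/-- The (piecewise) divergence of `v` at `x`. -/
def divergence (v : E → E) (x : E) : ℝ :=
  ∑ i : Fin 2, fderiv ℝ v x (EuclideanSpace.single i 1) i

/-- `(u, p) ∈ V^h × Q^h` solves the discrete Stokes problem with viscosity `ν` and source `f`. -/
def IsDiscreteStokesSolution {ι : Type*} (M : IsoMesh ι) (ν : ℝ) (f : E → E)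
    (u : E → E) (p : E → ℝ) : Prop :=
  u ∈ M.vel ∧ p ∈ M.pres ∧
  (∀ v ∈ M.vel,
    (∫ x in M.Omega, ν * gradDot u v x) - (∫ x in M.Omega, divergence v x * p x)
      = ∫ x in M.Omega, inner ℝ (f x) (v x)) ∧
  (∀ q ∈ M.pres, ∫ x in M.Omega, divergence u x * q x = 0)

end IsoStokes

end

noncomputable section

namespace IsoStokes

/-! ### Quadratic polynomials on the plane -/

/-! Velocities are encoded by the nodal values of their counterparts on the affine mesh, pressures
by the coefficients of their affine pieces. In these unknowns the method is a finite-dimensional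
saddle point problem, and `existsUnique_saddle` reduces it to two facts: the viscous form is
definite, and only the zero pressure is orthogonal to all discrete divergences. Nothing
quantitative, such as a uniform inf-sup constant, is needed.

Definiteness (`eq_zero_of_gradForm_self`). A velocity without viscous energy is constant on every
curved triangle of the split. All triangles of a split contain the barycenter, so there is one
constant per element. The members of `V^h` may jump across edges, but their nodal values are those
of a continuous field on the affine mesh, so elements with a common edge have the same constant. The
elements of a connected domain are linked through edges, because removing the finitely many vertices
does not disconnect it (`eq_of_sharesEdge`). Hence the affine field is one constant, and a constant
in `H¹₀` vanishes (`MemH10.const_eq_zero`).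

Pressures (`eq_zero_of_divForm_eq_zero`). The Piola transform preserves the divergence
(`jacDet_mul_divergence`), so on each element the divergence form is the one of polynomials on the
reference triangle. Testing with fields that vanish on the boundary of one element makes the
pressure constant there, by an explicit computation with the nodes inside the split
(`const_of_divInt_eq_zero`). Testing with a field concentrated at the midpoint of an interior edge
compares the constants of its two elements. The flux of that field involves the element map only
through its tangential derivative at the midpoint, which for a quadratic map is the chord of the
edge (`fderiv_F_edgeVec`). So the fluxes seen from both sides are opposite, and the two constants
agree (`const_eq_of_sharesEdge`). Again by connectedness the pressure is globally constant, and its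
mean value zero makes it vanish.

Two constructions support this. The test fields must be shown to lie in `H¹₀`; they are given by
truncated barycentric coordinates as bounded Lipschitz functions vanishing outside the domain, and
such functions are `H¹₀` by truncation and mollification (`BddLip.memH10`). Integrals over `Ω_h` are
pulled back to the open triangles of the split, whose images exhaust `Ω_h` up to a null set
(`Omega_ae_eq`). -/

lemma isPolyOn_two_iff {S : Set E} {q : E → ℝ} :
    IsPolyOn 2 S q ↔ ∃ c : Fin 6 → ℝ, ∀ x ∈ S, q x =
      c 0 + c 1 * x 0 + c 2 * x 1 + c 3 * x 0 ^ 2 + c 4 * (x 0 * x 1) + c 5 * x 1 ^ 2 := by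
  constructor
  · rintro ⟨P, hP, h⟩
    have key : ∃ c : Fin 6 → ℝ, ∀ x : E, MvPolynomial.eval (fun j => x j) P =
        c 0 + c 1 * x 0 + c 2 * x 1 + c 3 * x 0 ^ 2 + c 4 * (x 0 * x 1) + c 5 * x 1 ^ 2 := by
      have hs : ∀ x : E, MvPolynomial.eval (fun j => x j) P
          = ∑ d ∈ P.support, P.coeff d * (x 0 ^ d 0 * x 1 ^ d 1) := by
        intro x; rw [MvPolynomial.eval_eq']; simp [Fin.prod_univ_two]
      have hd : ∀ d ∈ P.support, d 0 + d 1 ≤ 2 := by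
        intro d hd
        have := (MvPolynomial.le_totalDegree hd).trans hP
        rwa [Finsupp.sum_fintype _ _ (by simp), Fin.sum_univ_two] at this
      simp only [hs]
      -- The support becomes an arbitrary finite set of exponents while the coefficients of `P` are
      -- kept, so that the induction does not alter `P`.
      generalize P.support = s at hd
      induction s using Finset.induction_on with
      | empty => exact ⟨0, by simp⟩
      | insert a s ha ih =>
        obtain ⟨c, hc⟩ := ih fun d h => hd d (Finset.mem_insert_of_mem h)
        have h2 := hd a (Finset.mem_insert_self _ _)
        have : ∃ e : Fin 6 → ℝ, ∀ x : E, P.coeff a * (x 0 ^ a 0 * x 1 ^ a 1) =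
            e 0 + e 1 * x 0 + e 2 * x 1 + e 3 * x 0 ^ 2 + e 4 * (x 0 * x 1) + e 5 * x 1 ^ 2 := by
          generalize P.coeff a = r
          generalize a 0 = m at *
          generalize a 1 = n at *
          have hm : m ≤ 2 := by omega
          have hn : n ≤ 2 := by omega
          interval_cases m <;> interval_cases n <;> first | omega | skip
          · exact ⟨![r, 0, 0, 0, 0, 0], by simp⟩
          · exact ⟨![0, 0, r, 0, 0, 0], by simp⟩
          · exact ⟨![0, 0, 0, 0, 0, r], by simp⟩
          · exact ⟨![0, r, 0, 0, 0, 0], by simp⟩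
          · exact ⟨![0, 0, 0, 0, r, 0], by simp⟩
          · exact ⟨![0, 0, 0, r, 0, 0], by simp⟩
        obtain ⟨e, he⟩ := this
        refine ⟨e + c, fun x => ?_⟩
        rw [Finset.sum_insert ha, hc, he]
        simp only [Pi.add_apply]; ring
    obtain ⟨c, hc⟩ := key
    exact ⟨c, fun x hx => (h x hx).trans (hc x)⟩
  · rintro ⟨c, hc⟩
    refine ⟨.C (c 0) + .C (c 1) * .X 0 + .C (c 2) * .X 1 + .C (c 3) * (.X 0 * .X 0)
      + .C (c 4) * (.X 0 * .X 1) + .C (c 5) * (.X 1 * .X 1), ?_, fun x hx => ?_⟩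
    · have h0 : ∀ r : ℝ, (MvPolynomial.C r : MvPolynomial (Fin 2) ℝ).totalDegree = 0 := by simp
      have h1 : ∀ i, (MvPolynomial.X i : MvPolynomial (Fin 2) ℝ).totalDegree ≤ 1 := by simp
      have h2 : ∀ i j, (MvPolynomial.X i * MvPolynomial.X j :
          MvPolynomial (Fin 2) ℝ).totalDegree ≤ 2 := fun i j =>
        (MvPolynomial.totalDegree_mul _ _).trans (Nat.add_le_add (h1 i) (h1 j))
      have h3 : ∀ (r : ℝ) (p : MvPolynomial (Fin 2) ℝ), p.totalDegree ≤ 2 →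
          (MvPolynomial.C r * p).totalDegree ≤ 2 := fun r p hp =>
        (MvPolynomial.totalDegree_mul _ _).trans (by rw [h0]; omega)
      have ha : ∀ p q : MvPolynomial (Fin 2) ℝ, p.totalDegree ≤ 2 → q.totalDegree ≤ 2 →
          (p + q).totalDegree ≤ 2 := fun p q hp hq =>
        (MvPolynomial.totalDegree_add _ _).trans (max_le hp hq)
      refine ha _ _ (ha _ _ (ha _ _ (ha _ _ (ha _ _ ?_ ?_) ?_) ?_) ?_) ?_
      · rw [h0]; omega
      all_goals apply h3
      exacts [(h1 0).trans (by omega), (h1 1).trans (by omega), h2 _ _, h2 _ _, h2 _ _]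
    · rw [hc x hx]; simp; ring

lemma IsPolyOn.exists_affine {S : Set E} {q : E → ℝ} (h : IsPolyOn 1 S q) :
    ∃ c : Fin 3 → ℝ, ∀ x ∈ S, q x = c 0 + c 1 * x 0 + c 2 * x 1 := by
  obtain ⟨P, hP, h⟩ := h
  have key : ∃ c : Fin 3 → ℝ, ∀ x : E, MvPolynomial.eval (fun j => x j) P =
      c 0 + c 1 * x 0 + c 2 * x 1 := by
    have hs : ∀ x : E, MvPolynomial.eval (fun j => x j) P
        = ∑ d ∈ P.support, P.coeff d * (x 0 ^ d 0 * x 1 ^ d 1) := by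
      intro x; rw [MvPolynomial.eval_eq']; simp [Fin.prod_univ_two]
    have hd : ∀ d ∈ P.support, d 0 + d 1 ≤ 1 := by
      intro d hd
      have := (MvPolynomial.le_totalDegree hd).trans hP
      rwa [Finsupp.sum_fintype _ _ (by simp), Fin.sum_univ_two] at this
    simp only [hs]
    generalize P.support = s at hd
    induction s using Finset.induction_on with
    | empty => exact ⟨0, by simp⟩
    | insert a s ha ih =>
      obtain ⟨c, hc⟩ := ih fun d h => hd d (Finset.mem_insert_of_mem h)
      have h2 := hd a (Finset.mem_insert_self _ _)
      have : ∃ e : Fin 3 → ℝ, ∀ x : E, P.coeff a * (x 0 ^ a 0 * x 1 ^ a 1) =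
          e 0 + e 1 * x 0 + e 2 * x 1 := by
        generalize P.coeff a = r
        generalize a 0 = m at *
        generalize a 1 = n at *
        have hm : m ≤ 1 := by omega
        have hn : n ≤ 1 := by omega
        interval_cases m <;> interval_cases n <;> first | omega | skip
        · exact ⟨![r, 0, 0], by simp⟩
        · exact ⟨![0, 0, r], by simp⟩
        · exact ⟨![0, r, 0], by simp⟩
      obtain ⟨e, he⟩ := this
      refine ⟨e + c, fun x => ?_⟩
      rw [Finset.sum_insert ha, hc, he]
      simp only [Pi.add_apply]; ring
  obtain ⟨c, hc⟩ := key
  exact ⟨c, fun x hx => (h x hx).trans (hc x)⟩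

lemma IsPolyOn.add {d : ℕ} {S : Set E} {p q : E → ℝ} (hp : IsPolyOn d S p) (hq : IsPolyOn d S q) :
    IsPolyOn d S fun x => p x + q x := by
  obtain ⟨P, hP, h⟩ := hp
  obtain ⟨Q, hQ, h'⟩ := hq
  exact ⟨P + Q, (MvPolynomial.totalDegree_add _ _).trans (max_le hP hQ), fun x hx => by
    simp only [map_add, h x hx, h' x hx]⟩

lemma IsPolyOn.const_mul {d : ℕ} {S : Set E} {p : E → ℝ} (hp : IsPolyOn d S p) (r : ℝ) :
    IsPolyOn d S fun x => r * p x := by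
  obtain ⟨P, hP, h⟩ := hp
  exact ⟨r • P, (MvPolynomial.totalDegree_smul_le _ _).trans hP, fun x hx => by
    simp only [MvPolynomial.smul_eval, h x hx]⟩

/-! ### The reference triangle and its split -/

@[simp] lemma bary_zero (x : E) : bary 0 x = x 0 := rfl
@[simp] lemma bary_one (x : E) : bary 1 x = x 1 := rfl
@[simp] lemma bary_two (x : E) : bary 2 x = 1 - x 0 - x 1 := rfl

@[fun_prop]
lemma contDiff_bary (k : Fin 3) {n : WithTop ℕ∞} : ContDiff ℝ n (bary k) := by
  fin_cases k
  · show ContDiff ℝ n fun x : E => x 0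
    fun_prop
  · show ContDiff ℝ n fun x : E => x 1
    fun_prop
  · show ContDiff ℝ n fun x : E => 1 - x 0 - x 1
    fun_prop

@[fun_prop]
lemma continuous_bary (k : Fin 3) : Continuous (bary k) := (contDiff_bary k (n := 0)).continuous

lemma bary_combo (k : Fin 3) (x y : E) {a b : ℝ} (hab : a + b = 1) :
    bary k (a • x + b • y) = a * bary k x + b * bary k y := by
  obtain rfl : b = 1 - a := by linarith
  fin_cases k <;> simp; ring

lemma bary_ctVert (k m : Fin 3) : bary k (ctVert m.castSucc) = if k = m then 1 else 0 := by
  fin_cases k <;> fin_cases m <;> simp [ctVert]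

lemma sum_bary (x : E) : ∑ k, bary k x = 1 := by
  simp [Fin.sum_univ_three]

lemma sum_bary_smul_ctVert (x : E) : ∑ k : Fin 3, bary k x • ctVert k.castSucc = x := by
  ext m; fin_cases m <;> simp [Fin.sum_univ_three, ctVert]

lemma convex_bary_nonneg : Convex ℝ {x : E | ∀ k, 0 ≤ bary k x} := by
  intro x hx y hy a b ha hb hab k
  rw [bary_combo k x y hab]
  exact add_nonneg (mul_nonneg ha (hx k)) (mul_nonneg hb (hy k))

lemma mem_refTri {x : E} : x ∈ refTri ↔ ∀ k, 0 ≤ bary k x := by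
  constructor
  · intro h
    refine convexHull_min ?_ convex_bary_nonneg h
    rintro _ ⟨m, rfl⟩ k
    simp only [bary_ctVert]; split_ifs <;> norm_num
  · intro h
    rw [← sum_bary_smul_ctVert x]
    exact (convex_convexHull ℝ _).sum_mem (fun k _ => h k) (sum_bary x)
      fun k _ => subset_convexHull ℝ _ ⟨k, rfl⟩

/-- The `k`-th barycentric coordinate with respect to the `j`-th triangle of the split
(zero for the vertex outside of that triangle). -/
def ctHat (j : Fin 3) (k : Fin 4) (x : E) : ℝ :=
  ![bary 0 x - bary j x, bary 1 x - bary j x, bary 2 x - bary j x, 3 * bary j x] k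

lemma ctHat_castSucc (j k : Fin 3) (x : E) : ctHat j k.castSucc x = bary k x - bary j x := by
  fin_cases k <;> simp [ctHat]

lemma ctHat_three (j : Fin 3) (x : E) : ctHat j 3 x = 3 * bary j x := rfl

@[fun_prop]
lemma contDiff_ctHat (j : Fin 3) (k : Fin 4) {n : WithTop ℕ∞} : ContDiff ℝ n (ctHat j k) := by
  induction k using Fin.lastCases with
  | last => exact contDiff_const.mul (contDiff_bary j)
  | cast k =>
    have : ctHat j k.castSucc = fun x => bary k x - bary j x := funext (ctHat_castSucc j k)
    rw [this]; fun_prop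

lemma sum_ctHat (j : Fin 3) (x : E) : ∑ k, ctHat j k x = 1 := by
  rw [Fin.sum_univ_castSucc]
  simp only [ctHat_castSucc, Finset.sum_sub_distrib, sum_bary]
  simp [Fin.last, ctHat]

/-- Vertex `j` is three times the barycenter minus the other two vertices. Eliminating it from `∑
bary k • vertex k` produces the coordinates `bary k - bary j` and `3 * bary j`. -/
lemma sum_ctHat_smul (j : Fin 3) (x : E) : ∑ k, ctHat j k x • ctVert k = x := by
  ext m; fin_cases j <;> fin_cases m <;> simp [Fin.sum_univ_four, ctVert, ctHat] <;> ring

lemma ctHat_self (j : Fin 3) (x : E) : ctHat j j.castSucc x = 0 := by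
  rw [ctHat_castSucc, sub_self]

lemma ctHat_combo (j : Fin 3) (k : Fin 4) (x y : E) {a b : ℝ} (hab : a + b = 1) :
    ctHat j k (a • x + b • y) = a * ctHat j k x + b * ctHat j k y := by
  induction k using Fin.lastCases with
  | last => change 3 * _ = a * (3 * _) + b * (3 * _); rw [bary_combo _ _ _ hab]; ring
  | cast k => simp only [ctHat_castSucc, bary_combo _ _ _ hab]; ring

lemma ctHat_ctVert (j : Fin 3) {m : Fin 4} (hm : m ≠ j.castSucc) (k : Fin 4) :
    ctHat j k (ctVert m) = if k = m then 1 else 0 := by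
  fin_cases j <;> fin_cases m <;> first | exact absurd rfl hm | skip
  all_goals fin_cases k <;> simp [ctHat, ctVert] <;> norm_num

lemma mem_ctTri {j : Fin 3} {x : E} : x ∈ ctTri j ↔ ∀ k, 0 ≤ ctHat j k x := by
  constructor
  · intro h
    have hc : Convex ℝ {x : E | ∀ k, 0 ≤ ctHat j k x} := by
      intro x hx y hy a b ha hb hab k
      rw [ctHat_combo j k x y hab]
      exact add_nonneg (mul_nonneg ha (hx k)) (mul_nonneg hb (hy k))
    refine convexHull_min ?_ hc h
    rintro _ ⟨m, hm, rfl⟩ k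
    rw [ctHat_ctVert j hm]; split_ifs <;> norm_num
  · intro h
    rw [← sum_ctHat_smul j x]
    have hs : ∀ f : Fin 4 → E, ∑ k, ctHat j k x • f k
        = ∑ k ∈ Finset.univ.erase j.castSucc, ctHat j k x • f k := by
      intro f
      rw [← Finset.add_sum_erase _ _ (Finset.mem_univ j.castSucc), ctHat_self, zero_smul, zero_add]
    rw [hs]
    refine (convex_convexHull ℝ _).sum_mem (fun k _ => h k) ?_
      fun k hk => subset_convexHull ℝ _ ⟨k, Finset.ne_of_mem_erase hk, rfl⟩
    have := sum_ctHat j x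
    rwa [← Finset.add_sum_erase _ _ (Finset.mem_univ j.castSucc), ctHat_self, zero_add] at this

/-- The open triangles of the split. -/
def ctPiece (j : Fin 3) : Set E := {x | 0 < bary j x ∧ ∀ k, k ≠ j → bary j x < bary k x}

lemma isOpen_ctPiece (j : Fin 3) : IsOpen (ctPiece j) := by
  have : ctPiece j = {x | 0 < bary j x} ∩ ⋂ k : {k // k ≠ j}, {x | bary j x < bary k x} := by
    ext x; simp [ctPiece]
  rw [this]
  exact (isOpen_lt continuous_const (continuous_bary j)).inter
    (isOpen_iInter_of_finite fun k => isOpen_lt (continuous_bary j) (continuous_bary k))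

lemma ctPiece_subset_ctTri (j : Fin 3) : ctPiece j ⊆ ctTri j := by
  rintro x ⟨h0, h⟩
  rw [mem_ctTri]
  intro k
  induction k using Fin.lastCases with
  | last => change 0 ≤ 3 * bary j x; linarith
  | cast k =>
    rw [ctHat_castSucc, sub_nonneg]
    by_cases hk : k = j
    · rw [hk]
    · exact (h k hk).le

lemma ctPiece_subset_interior (j : Fin 3) : ctPiece j ⊆ interior (ctTri j) :=
  (isOpen_ctPiece j).subset_interior_iff.2 (ctPiece_subset_ctTri j)

lemma ctPiece_pos {j : Fin 3} {x : E} (h : x ∈ ctPiece j) (k : Fin 3) : 0 < bary k x := by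
  by_cases hk : k = j
  · rw [hk]; exact h.1
  · exact h.1.trans (h.2 k hk)

lemma ctPiece_subset_refTri (j : Fin 3) : ctPiece j ⊆ refTri :=
  fun _ hx => mem_refTri.2 fun k => (ctPiece_pos hx k).le

lemma ctPiece_subset_interior_refTri (j : Fin 3) : ctPiece j ⊆ interior refTri :=
  (isOpen_ctPiece j).subset_interior_iff.2 (ctPiece_subset_refTri j)

lemma disjoint_ctPiece {j l : Fin 3} (h : j ≠ l) : Disjoint (ctPiece j) (ctPiece l) :=
  Set.disjoint_left.2 fun _ hx hy => lt_asymm (hx.2 l h.symm) (hy.2 j h)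

lemma ctTri_subset_refTri (j : Fin 3) : ctTri j ⊆ refTri := by
  intro x hx
  rw [mem_ctTri] at hx
  have h3 : 0 ≤ bary j x := by have := hx 3; rw [ctHat_three] at this; linarith
  refine mem_refTri.2 fun k => h3.trans ?_
  have := hx k.castSucc
  rwa [ctHat_castSucc, sub_nonneg] at this

/-- The right triangle is the one opposite to the vertex with the smallest barycentric coordinate.
-/
lemma exists_mem_ctTri {x : E} (hx : x ∈ refTri) : ∃ j, x ∈ ctTri j := by
  obtain ⟨j, hj⟩ := Finite.exists_min fun k => bary k x
  refine ⟨j, mem_ctTri.2 fun k => ?_⟩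
  induction k using Fin.lastCases with
  | last => have := mem_refTri.1 hx j; change 0 ≤ 3 * bary j x; linarith
  | cast k => rw [ctHat_castSucc, sub_nonneg]; exact hj k

lemma refTri_isCompact : IsCompact refTri := (finite_range _).isCompact_convexHull (𝕜 := ℝ)
lemma ctPiece_nonempty (j : Fin 3) : (ctPiece j).Nonempty := by
  refine ⟨∑ k, (if k = j then (1 / 5 : ℝ) else 2 / 5) • ctVert k.castSucc, ?_⟩
  fin_cases j <;> simp [ctPiece, Fin.sum_univ_three, ctVert, Fin.forall_fin_succ] <;> norm_num

lemma ctPiece_convex (j : Fin 3) : Convex ℝ (ctPiece j) := by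
  intro x hx y hy a b ha hb hab
  have : ∀ c d e f : ℝ, c < d → e < f → a * c + b * e < a * d + b * f := by
    intro c d e f h1 h2
    rcases ha.eq_or_lt with rfl | ha'
    · obtain rfl : b = 1 := by linarith
      linarith
    · have := mul_lt_mul_of_pos_left h1 ha'
      have := mul_le_mul_of_nonneg_left h2.le hb
      linarith
  refine ⟨?_, fun k hk => ?_⟩
  · rw [bary_combo _ _ _ hab]; have := this 0 _ 0 _ hx.1 hy.1; linarith
  · rw [bary_combo _ _ _ hab, bary_combo _ _ _ hab]; exact this _ _ _ _ (hx.2 k hk) (hy.2 k hk)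

/-- Moving from `x` slightly towards a point of the open triangle turns the weak inequalities into
strict ones. -/
lemma ctTri_subset_closure (j : Fin 3) : ctTri j ⊆ closure (ctPiece j) := by
  intro x hx
  obtain ⟨y, hy⟩ := ctPiece_nonempty j
  rw [mem_ctTri] at hx
  have hlim : Tendsto (fun n : ℕ => (1 - 1 / ((n : ℝ) + 1)) • x + (1 / ((n : ℝ) + 1)) • y) atTop
      (𝓝 ((1 - 0 : ℝ) • x + (0 : ℝ) • y)) := by
    have := (tendsto_one_div_add_atTop_nhds_zero_nat : Tendsto (fun n : ℕ => 1 / ((n : ℝ) + 1)) _ _)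
    exact ((tendsto_const_nhds.sub this).smul_const x).add (this.smul_const y)
  simp only [sub_zero, one_smul, zero_smul, add_zero] at hlim
  refine mem_closure_of_tendsto hlim (Eventually.of_forall fun n => ?_)
  have h1 : (0 : ℝ) < 1 / ((n : ℝ) + 1) := by positivity
  have h2 : 1 / ((n : ℝ) + 1) ≤ 1 := by
    rw [div_le_one (by positivity)]; linarith [(Nat.cast_nonneg n : (0 : ℝ) ≤ n)]
  generalize 1 / ((n : ℝ) + 1) = t at h1 h2
  have hb : 0 ≤ bary j x := by have := hx 3; rw [ctHat_three] at this; linarith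
  refine ⟨?_, fun k hk => ?_⟩
  · rw [bary_combo _ _ _ (by ring)]
    have := mul_pos h1 hy.1
    have := mul_nonneg (sub_nonneg.2 h2) hb
    linarith
  · rw [bary_combo _ _ _ (by ring), bary_combo _ _ _ (by ring)]
    have := hx k.castSucc
    rw [ctHat_castSucc, sub_nonneg] at this
    have := mul_lt_mul_of_pos_left (hy.2 k hk) h1
    have := mul_le_mul_of_nonneg_left ‹bary j x ≤ bary k x› (sub_nonneg.2 h2)
    linarith

/-- A level set of a nonzero linear functional is a null set. -/
lemma volume_level_set (φ : E →L[ℝ] ℝ) (hφ : φ ≠ 0) (c : ℝ) : volume {x | φ x = c} = 0 := by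
  have hs : Function.Surjective φ := by
    apply LinearMap.surjective (f := φ.toLinearMap)
    intro h; apply hφ; ext x; exact DFunLike.congr_fun h x
  have ho : IsOpenMap φ := φ.isOpenMap hs
  -- The level set is the frontier of a half-plane, and frontiers of convex sets are null sets.
  have hf : {x | φ x = c} = frontier (φ ⁻¹' Iic c) := by
    rw [← ho.preimage_frontier_eq_frontier_preimage φ.continuous, frontier_Iic]; rfl
  rw [hf]
  exact Convex.addHaar_frontier _ ((convex_Iic c).is_linear_preimage φ.toLinearMap.isLinear)

/-- A point outside of the open triangles has a vanishing coordinate or two equal ones. It lies on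
one of six lines: three edges and three medians. -/
lemma volume_refTri_diff : volume (refTri \ ⋃ j, ctPiece j) = 0 := by
  let p0 : E →L[ℝ] ℝ := EuclideanSpace.proj 0
  let p1 : E →L[ℝ] ℝ := EuclideanSpace.proj 1
  have hp0 : ∀ x, p0 x = x 0 := fun _ => rfl
  have hp1 : ∀ x, p1 x = x 1 := fun _ => rfl
  have hne : ∀ a b : ℝ, a ≠ 0 ∨ b ≠ 0 → a • p0 + b • p1 ≠ 0 := by
    intro a b h h0
    have e0 := DFunLike.congr_fun h0 (!₂[1, 0] : E)
    have e1 := DFunLike.congr_fun h0 (!₂[0, 1] : E)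
    simp [hp0, hp1] at e0 e1
    tauto
  have hsub : refTri \ ⋃ j, ctPiece j ⊆
      {x | ((1 : ℝ) • p0 + (0 : ℝ) • p1) x = 0} ∪ {x | ((0 : ℝ) • p0 + (1 : ℝ) • p1) x = 0} ∪
      {x | ((1 : ℝ) • p0 + (1 : ℝ) • p1) x = 1} ∪ {x | ((1 : ℝ) • p0 + (-1 : ℝ) • p1) x = 0} ∪
      {x | ((2 : ℝ) • p0 + (1 : ℝ) • p1) x = 1} ∪ {x | ((1 : ℝ) • p0 + (2 : ℝ) • p1) x = 1} := by
    rintro x ⟨hx, hn⟩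
    rw [mem_refTri] at hx
    by_contra hc
    simp only [mem_union, mem_ofPred_eq, not_or, _root_.add_apply,
      _root_.smul_apply, hp0, hp1, smul_eq_mul] at hc
    obtain ⟨⟨⟨⟨⟨h1, h2⟩, h3⟩, h4⟩, h5⟩, h6⟩ := hc
    apply hn
    obtain ⟨j, hj⟩ := Finite.exists_min fun k => bary k x
    refine mem_iUnion.2 ⟨j, ?_, fun k hk => ?_⟩
    · refine lt_of_le_of_ne (hx j) ?_
      fin_cases j <;> simp <;> intro h <;> first | apply h1; linarith | apply h2; linarith | apply h3; linarith
    · refine lt_of_le_of_ne (hj k) ?_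
      fin_cases j <;> fin_cases k <;> first | exact absurd rfl hk | skip
      all_goals
        simp
        intro h
        first | apply h4; linarith | apply h5; linarith | apply h6; linarith
  refine measure_mono_null hsub ?_
  refine measure_union_null (measure_union_null (measure_union_null (measure_union_null
    (measure_union_null ?_ ?_) ?_) ?_) ?_) ?_ <;>
    exact volume_level_set _ (hne _ _ (by norm_num)) _

lemma interior_refTri_pos {x : E} (hx : x ∈ interior refTri) (k : Fin 3) : 0 < bary k x := by
  have h0 := mem_refTri.1 (interior_subset hx)
  refine lt_of_le_of_ne (h0 k) fun h => ?_
  -- The reflection of vertex `k` in the barycenter has `k`-th coordinate `2 / 3 - 1 < 0`. From a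
  -- point with vanishing `k`-th coordinate, any move towards it leaves the triangle.
  obtain ⟨y, hy, hky⟩ : ∃ y : E, y = ctVert 3 + ctVert 3 - ctVert k.castSucc ∧ bary k y < 0 := by
    refine ⟨_, rfl, ?_⟩
    fin_cases k <;> simp [ctVert] <;> norm_num
  have hlim : Tendsto (fun n : ℕ => (1 - 1 / ((n : ℝ) + 1)) • x + (1 / ((n : ℝ) + 1)) • y) atTop
      (𝓝 ((1 - 0 : ℝ) • x + (0 : ℝ) • y)) := by
    have := (tendsto_one_div_add_atTop_nhds_zero_nat : Tendsto (fun n : ℕ => 1 / ((n : ℝ) + 1)) _ _)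
    exact ((tendsto_const_nhds.sub this).smul_const x).add (this.smul_const y)
  simp only [sub_zero, one_smul, zero_smul, add_zero] at hlim
  obtain ⟨n, hn⟩ := (hlim.eventually (mem_interior_iff_mem_nhds.1 hx)).exists
  have := mem_refTri.1 hn k
  rw [bary_combo _ _ _ (by ring), ← h] at this
  have hp : (0 : ℝ) < 1 / ((n : ℝ) + 1) := by positivity
  have := mul_neg_of_pos_of_neg hp hky
  linarith

/-! ### Quadratic interpolation on the split -/

/-- The nodes of the split: vertices and edge midpoints. -/
def node (k l : Fin 4) : E := midpoint ℝ (ctVert k) (ctVert l)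

lemma node_apply (k l : Fin 4) (m : Fin 2) : node k l m = (ctVert k m + ctVert l m) / 2 := by
  rw [node, midpoint_eq_smul_add]; simp; ring

lemma node_comm (k l : Fin 4) : node k l = node l k := midpoint_comm _ _

lemma node_self (k : Fin 4) : node k k = ctVert k := midpoint_self _ _

lemma node_mem_refNodes (k l : Fin 4) : node k l ∈ refNodes := ⟨k, l, rfl⟩

lemma node_eq_combo (k l : Fin 4) : node k l = (1 / 2 : ℝ) • ctVert k + (1 / 2 : ℝ) • ctVert l := by
  rw [node, midpoint_eq_smul_add, smul_add]; norm_num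

lemma ctVert_mem_ctTri {j : Fin 3} {k : Fin 4} (h : k ≠ j.castSucc) : ctVert k ∈ ctTri j :=
  subset_convexHull ℝ _ ⟨k, h, rfl⟩

lemma node_mem_ctTri {j : Fin 3} {k l : Fin 4} (hk : k ≠ j.castSucc) (hl : l ≠ j.castSucc) :
    node k l ∈ ctTri j := by
  rw [node_eq_combo]
  exact convex_convexHull ℝ _ (ctVert_mem_ctTri hk) (ctVert_mem_ctTri hl)
    (by norm_num) (by norm_num) (by norm_num)

lemma exists_ne_castSucc (k l : Fin 4) : ∃ j : Fin 3, k ≠ j.castSucc ∧ l ≠ j.castSucc := by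
  revert k l; decide

lemma node_mem_refTri (k l : Fin 4) : node k l ∈ refTri := by
  obtain ⟨j, hk, hl⟩ := exists_ne_castSucc k l
  exact ctTri_subset_refTri j (node_mem_ctTri hk hl)

/-- Quadratic interpolation in terms of barycentric coordinates `h`. -/
def quadInterp (h : Fin 4 → ℝ) (ξ : Fin 4 → Fin 4 → E) : E :=
  (2 : ℝ) • (∑ k, ∑ l, (h k * h l) • ξ k l) - ∑ k, h k • ξ k k

/-- The quadratic polynomial that interpolates nodal values on the `j`-th triangle of the split. -/
def interp (j : Fin 3) (ξ : Fin 4 → Fin 4 → E) (x : E) : E := quadInterp (fun k => ctHat j k x) ξ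

lemma quadInterp_add (h : Fin 4 → ℝ) (ξ η : Fin 4 → Fin 4 → E) :
    quadInterp h (ξ + η) = quadInterp h ξ + quadInterp h η := by
  simp only [quadInterp, Pi.add_apply, smul_add, Finset.sum_add_distrib]; abel

lemma quadInterp_smul (h : Fin 4 → ℝ) (r : ℝ) (ξ : Fin 4 → Fin 4 → E) :
    quadInterp h (r • ξ) = r • quadInterp h ξ := by
  simp only [quadInterp, Pi.smul_apply, smul_sub, Finset.smul_sum, smul_smul]
  congr 1
  · refine Finset.sum_congr rfl fun k _ => Finset.sum_congr rfl fun l _ => ?_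
    congr 1; ring
  · refine Finset.sum_congr rfl fun k _ => ?_
    rw [mul_comm]

lemma quadInterp_const {h : Fin 4 → ℝ} (hh : ∑ k, h k = 1) (c : E) :
    quadInterp h (fun _ _ => c) = c := by
  simp only [quadInterp, ← Finset.sum_smul, ← Finset.mul_sum, hh, mul_one]
  rw [two_smul, one_smul, add_sub_cancel_right]

lemma interp_add (j : Fin 3) (ξ η : Fin 4 → Fin 4 → E) (x : E) :
    interp j (ξ + η) x = interp j ξ x + interp j η x := quadInterp_add _ _ _

lemma interp_smul (j : Fin 3) (r : ℝ) (ξ : Fin 4 → Fin 4 → E) (x : E) :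
    interp j (r • ξ) x = r • interp j ξ x := quadInterp_smul _ _ _

@[fun_prop]
lemma contDiff_interp (j : Fin 3) (ξ : Fin 4 → Fin 4 → E) {n : WithTop ℕ∞} :
    ContDiff ℝ n (interp j ξ) := by
  unfold interp quadInterp; fun_prop

/-- An interpolant on a triangle of the split depends on the nodal values in this triangle only. -/
lemma interp_congr {j : Fin 3} {ξ η : Fin 4 → Fin 4 → E} (x : E)
    (h : ∀ k l, k ≠ j.castSucc → l ≠ j.castSucc → ξ k l = η k l) :
    interp j ξ x = interp j η x := by
  unfold interp quadInterp
  have hz : ∀ k l, (ctHat j k x * ctHat j l x) • ξ k l = (ctHat j k x * ctHat j l x) • η k l := by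
    intro k l
    by_cases hk : k = j.castSucc
    · rw [hk, ctHat_self, zero_mul, zero_smul, zero_smul]
    by_cases hl : l = j.castSucc
    · rw [hl, ctHat_self, mul_zero, zero_smul, zero_smul]
    rw [h k l hk hl]
  have hz' : ∀ k, ctHat j k x • ξ k k = ctHat j k x • η k k := by
    intro k
    by_cases hk : k = j.castSucc
    · rw [hk, ctHat_self, zero_smul, zero_smul]
    rw [h k k hk hk]
  simp only [hz, hz']

/-- For symmetric data the terms of `quadInterp` combine to the Lagrange basis: `h k * (2 * h k -
1)` at vertices and, as the double sum counts each edge twice, `4 * h k * h l` at midpoints. -/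
lemma interp_node {j : Fin 3} {ξ : Fin 4 → Fin 4 → E} (hs : ∀ k l, ξ k l = ξ l k) {k l : Fin 4}
    (hk : k ≠ j.castSucc) (hl : l ≠ j.castSucc) : interp j ξ (node k l) = ξ k l := by
  have h : ∀ m, ctHat j m (node k l)
      = 1 / 2 * (if m = k then 1 else 0) + 1 / 2 * (if m = l then 1 else 0) := by
    intro m
    rw [node_eq_combo, ctHat_combo _ _ _ _ (by norm_num), ctHat_ctVert j hk, ctHat_ctVert j hl]
  unfold interp quadInterp
  simp only [h]
  ext m
  simp only [PiLp.sub_apply, PiLp.smul_apply, smul_eq_mul, WithLp.ofLp_sum, Finset.sum_apply,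
    add_mul, mul_add, Finset.sum_add_distrib]
  simp [mul_ite, ite_mul, Finset.sum_ite_eq', hs l k]
  ring

/-- A quadratic field on a triangle of the split is its interpolant. -/
lemma interp_eq_of_isPolyOn {j : Fin 3} {v : E → E}
    (h : ∀ m : Fin 2, IsPolyOn 2 (ctTri j) fun x => v x m) {x : E} (hx : x ∈ ctTri j) :
    interp j (fun k l => v (node k l)) x = v x := by
  have hv : ∃ c : Fin 2 → Fin 6 → ℝ, ∀ m, ∀ y ∈ ctTri j, v y m = c m 0 + c m 1 * y 0 + c m 2 * y 1
      + c m 3 * y 0 ^ 2 + c m 4 * (y 0 * y 1) + c m 5 * y 1 ^ 2 := by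
    simp only [isPolyOn_two_iff] at h
    choose c hc using h
    exact ⟨c, hc⟩
  obtain ⟨c, hc⟩ := hv
  -- The polynomial lives on the whole plane and gives values also at nodes outside of the triangle.
  -- These values do not matter, by `interp_congr`, but they turn the claim into a polynomial
  -- identity.
  let p : E → E := fun y => WithLp.toLp 2 fun m => c m 0 + c m 1 * y 0 + c m 2 * y 1
      + c m 3 * y 0 ^ 2 + c m 4 * (y 0 * y 1) + c m 5 * y 1 ^ 2
  have hp : ∀ y ∈ ctTri j, v y = p y := fun y hy => by ext m; exact hc m y hy
  rw [hp x hx, interp_congr (η := fun k l => p (node k l)) x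
    fun k l hk hl => hp _ (node_mem_ctTri hk hl)]
  ext m
  have hn : ∀ k l, p (node k l) m = c m 0 + c m 1 * ((ctVert k 0 + ctVert l 0) / 2)
      + c m 2 * ((ctVert k 1 + ctVert l 1) / 2)
      + c m 3 * ((ctVert k 0 + ctVert l 0) / 2) ^ 2
      + c m 4 * (((ctVert k 0 + ctVert l 0) / 2) * ((ctVert k 1 + ctVert l 1) / 2))
      + c m 5 * ((ctVert k 1 + ctVert l 1) / 2) ^ 2 := by
    intro k l
    simp only [p, node_apply]
  simp only [interp, quadInterp, PiLp.sub_apply, PiLp.smul_apply, smul_eq_mul, WithLp.ofLp_sum,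
    Finset.sum_apply, hn]
  simp only [p, Fin.sum_univ_four]
  clear hp hc hn h p
  generalize c m = d
  fin_cases j <;> simp [ctHat, ctVert] <;> ring

/-! ### A Lipschitz extension of the interpolants -/

/-- The smallest barycentric coordinate. -/
def baryMin (x : E) : ℝ := min (bary 0 x) (min (bary 1 x) (bary 2 x))

/-- Truncation to the unit interval. -/
def clamp (t : ℝ) : ℝ := max 0 (min 1 t)

lemma clamp_nonneg (t : ℝ) : 0 ≤ clamp t := le_max_left _ _
lemma clamp_le_one (t : ℝ) : clamp t ≤ 1 := max_le zero_le_one (min_le_left _ _)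
lemma clamp_of_mem {t : ℝ} (h0 : 0 ≤ t) (h1 : t ≤ 1) : clamp t = t := by
  rw [clamp, min_eq_right h1, max_eq_right h0]
lemma clamp_of_nonpos {t : ℝ} (h0 : t ≤ 0) : clamp t = 0 := by
  rw [clamp, max_eq_left ((min_le_right _ _).trans h0)]
lemma lipschitz_clamp : LipschitzWith 1 clamp := (LipschitzWith.id.const_min 1).const_max 0

/-- Globally defined, truncated barycentric coordinates of the split. -/
def gHat (k : Fin 4) (x : E) : ℝ :=
  clamp (![bary 0 x - baryMin x, bary 1 x - baryMin x, bary 2 x - baryMin x, 3 * baryMin x] k)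

lemma baryMin_of_mem {j : Fin 3} {x : E} (hx : x ∈ ctTri j) : baryMin x = bary j x := by
  rw [mem_ctTri] at hx
  have h : ∀ k, bary j x ≤ bary k x := fun k => by
    have := hx k.castSucc; rwa [ctHat_castSucc, sub_nonneg] at this
  apply le_antisymm
  · fin_cases j
    · exact min_le_left _ _
    · exact (min_le_right _ _).trans (min_le_left _ _)
    · exact (min_le_right _ _).trans (min_le_right _ _)
  · exact le_min (h 0) (le_min (h 1) (h 2))

/-- On the `j`-th triangle the smallest coordinate is the `j`-th one and the truncation is inactive.
So one globally Lipschitz formula describes the interpolant on all three triangles. -/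
lemma gHat_eq_ctHat {j : Fin 3} {x : E} (hx : x ∈ ctTri j) (k : Fin 4) :
    gHat k x = ctHat j k x := by
  have h := mem_ctTri.1 hx
  have h1 : ctHat j k x ≤ 1 := by
    rw [← sum_ctHat j x]
    exact Finset.single_le_sum (f := fun k => ctHat j k x) (fun k _ => h k) (Finset.mem_univ k)
  rw [gHat, baryMin_of_mem hx]
  exact clamp_of_mem (h k) h1

/-- Interpolation of nodal values on the whole reference triangle. -/
def ginterp (ξ : Fin 4 → Fin 4 → E) (x : E) : E := quadInterp (fun k => gHat k x) ξ

lemma ginterp_eq_interp {j : Fin 3} {x : E} (hx : x ∈ ctTri j) (ξ : Fin 4 → Fin 4 → E) :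
    ginterp ξ x = interp j ξ x := by
  simp only [ginterp, interp, gHat_eq_ctHat hx]

lemma ginterp_node {ξ : Fin 4 → Fin 4 → E} (hs : ∀ k l, ξ k l = ξ l k) (k l : Fin 4) :
    ginterp ξ (node k l) = ξ k l := by
  obtain ⟨j, hk, hl⟩ := exists_ne_castSucc k l
  rw [ginterp_eq_interp (node_mem_ctTri hk hl), interp_node hs hk hl]

lemma ginterp_eq_of_isPolyOn {v : E → E}
    (h : ∀ j : Fin 3, ∀ m : Fin 2, IsPolyOn 2 (ctTri j) fun x => v x m) {x : E} (hx : x ∈ refTri) :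
    ginterp (fun k l => v (node k l)) x = v x := by
  obtain ⟨j, hj⟩ := exists_mem_ctTri hx
  rw [ginterp_eq_interp hj, interp_eq_of_isPolyOn (h j) hj]

/-- Bounded Lipschitz functions. -/
def BddLip {V : Type*} [NormedAddCommGroup V] (f : E → V) : Prop :=
  (∃ C, LipschitzWith C f) ∧ ∃ B, ∀ x, ‖f x‖ ≤ B

section BddLip
variable {V : Type*} [NormedAddCommGroup V]

lemma BddLip.add {f g : E → V} (hf : BddLip f) (hg : BddLip g) : BddLip fun x => f x + g x := by
  obtain ⟨⟨C, hC⟩, B, hB⟩ := hf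
  obtain ⟨⟨D, hD⟩, A, hA⟩ := hg
  exact ⟨⟨_, hC.add hD⟩, B + A, fun x => (norm_add_le _ _).trans (add_le_add (hB x) (hA x))⟩

/-- Boundedness accompanies the Lipschitz condition for the sake of products: with bounds `B`, `A`
and constants `C`, `D`, the product has constant `B * D + C * A`. -/
lemma BddLip.smul [NormedSpace ℝ V] {f : E → ℝ} {g : E → V} (hf : BddLip f) (hg : BddLip g) :
    BddLip fun x => f x • g x := by
  obtain ⟨⟨C, hC⟩, B, hB⟩ := hf
  obtain ⟨⟨D, hD⟩, A, hA⟩ := hg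
  have hB0 : 0 ≤ B := (norm_nonneg _).trans (hB 0)
  have hA0 : 0 ≤ A := (norm_nonneg _).trans (hA 0)
  refine ⟨⟨(B * D + C * A).toNNReal, LipschitzWith.of_dist_le_mul fun x y => ?_⟩, B * A, fun x => ?_⟩
  · rw [Real.coe_toNNReal _ (by positivity), dist_eq_norm]
    have : f x • g x - f y • g y = f x • (g x - g y) + (f x - f y) • g y := by
      rw [smul_sub, sub_smul]; abel
    rw [this]
    refine (norm_add_le _ _).trans ?_
    rw [norm_smul, norm_smul, add_mul]
    have h1 : ‖g x - g y‖ ≤ D * dist x y := by rw [← dist_eq_norm]; exact hD.dist_le_mul x y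
    have h2 : ‖f x - f y‖ ≤ C * dist x y := by rw [← dist_eq_norm]; exact hC.dist_le_mul x y
    refine add_le_add ?_ ?_
    · rw [mul_assoc]; exact mul_le_mul (hB x) h1 (norm_nonneg _) hB0
    · rw [mul_right_comm]; exact mul_le_mul h2 (hA y) (norm_nonneg _) (by positivity)
  · rw [norm_smul]; exact mul_le_mul (hB x) (hA x) (norm_nonneg _) hB0

lemma BddLip.const (c : V) : BddLip fun _ => c :=
  ⟨⟨0, LipschitzWith.const c⟩, ‖c‖, fun _ => le_rfl⟩

lemma BddLip.sum {α : Type*} (s : Finset α) {f : α → E → V} (hf : ∀ a ∈ s, BddLip (f a)) :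
    BddLip fun x => ∑ a ∈ s, f a x := by
  classical
  induction s using Finset.induction_on with
  | empty => simpa using BddLip.const (0 : V)
  | insert a s ha ih =>
    simp only [Finset.sum_insert ha]
    exact (hf a (Finset.mem_insert_self _ _)).add
      (ih fun b hb => hf b (Finset.mem_insert_of_mem hb))

lemma BddLip.neg [NormedSpace ℝ V] {f : E → V} (hf : BddLip f) : BddLip fun x => - f x := by
  have := (BddLip.const (-1 : ℝ)).smul hf
  simpa using this

lemma BddLip.comp_lipschitz {f : E → V} (hf : BddLip f) {g : E → E} {C : NNReal}
    (hg : LipschitzWith C g) : BddLip fun x => f (g x) := by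
  obtain ⟨⟨D, hD⟩, B, hB⟩ := hf
  exact ⟨⟨_, hD.comp hg⟩, B, fun x => hB _⟩

end BddLip

lemma lipschitz_bary (k : Fin 3) : ∃ C, LipschitzWith C (bary k) := by
  have hp : ∀ m : Fin 2, LipschitzWith 1 fun x : E => x m := fun m =>
    LipschitzWith.of_dist_le_mul fun x y => by
      simpa [dist_eq_norm] using PiLp.norm_apply_le (x - y) m
  fin_cases k
  · exact ⟨1, hp 0⟩
  · exact ⟨1, hp 1⟩
  · exact ⟨_, ((LipschitzWith.const (1 : ℝ)).sub (hp 0)).sub (hp 1)⟩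

lemma bddLip_clamp {f : E → ℝ} (hf : ∃ C, LipschitzWith C f) : BddLip fun x => clamp (f x) := by
  obtain ⟨C, hC⟩ := hf
  exact ⟨⟨_, lipschitz_clamp.comp hC⟩, 1, fun x => by
    rw [Real.norm_of_nonneg (clamp_nonneg _)]; exact clamp_le_one _⟩

lemma bddLip_gHat (k : Fin 4) : BddLip (gHat k) := by
  obtain ⟨C0, h0⟩ := lipschitz_bary 0
  obtain ⟨C1, h1⟩ := lipschitz_bary 1
  obtain ⟨C2, h2⟩ := lipschitz_bary 2
  have hm : LipschitzWith (max C0 (max C1 C2)) baryMin := h0.min (h1.min h2)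
  apply bddLip_clamp
  fin_cases k
  · exact ⟨_, h0.sub hm⟩
  · exact ⟨_, h1.sub hm⟩
  · exact ⟨_, h2.sub hm⟩
  · exact ⟨_, (lipschitzWith_smul (3 : ℝ)).comp hm⟩

lemma bddLip_ginterp (ξ : Fin 4 → Fin 4 → E) : BddLip (ginterp ξ) := by
  have h : BddLip fun x => (2 : ℝ) • (∑ k, ∑ l, (gHat k x * gHat l x) • ξ k l)
      + - ∑ k, gHat k x • ξ k k := by
    refine ((BddLip.const (2 : ℝ)).smul (BddLip.sum _ fun k _ => BddLip.sum _ fun l _ => ?_)).add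
      (BddLip.sum _ fun k _ => ?_).neg
    · exact ((bddLip_gHat k).smul (bddLip_gHat l)).smul (BddLip.const _)
    · exact (bddLip_gHat k).smul (BddLip.const _)
  convert h using 1
  ext x : 1
  rw [ginterp, quadInterp, sub_eq_add_neg]

lemma isPolyOn_ginterp (ξ : Fin 4 → Fin 4 → E) (j : Fin 3) (m : Fin 2) :
    IsPolyOn 2 (ctTri j) fun x => ginterp ξ x m := by
  have hb : ∀ k, ∃ a : Fin 3 → ℝ, ∀ x, ctHat j k x = a 0 + a 1 * x 0 + a 2 * x 1 := by
    intro k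
    fin_cases j <;> fin_cases k
    · exact ⟨![0, 0, 0], fun x => by simp [ctHat]⟩
    · exact ⟨![0, -1, 1], fun x => by simp [ctHat]; ring⟩
    · exact ⟨![1, -2, -1], fun x => by simp [ctHat]; ring⟩
    · exact ⟨![0, 3, 0], fun x => by simp [ctHat]⟩
    · exact ⟨![0, 1, -1], fun x => by simp [ctHat]; ring⟩
    · exact ⟨![0, 0, 0], fun x => by simp [ctHat]⟩
    · exact ⟨![1, -1, -2], fun x => by simp [ctHat]; ring⟩
    · exact ⟨![0, 0, 3], fun x => by simp [ctHat]⟩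
    · exact ⟨![-1, 2, 1], fun x => by simp [ctHat]; ring⟩
    · exact ⟨![-1, 1, 2], fun x => by simp [ctHat]; ring⟩
    · exact ⟨![0, 0, 0], fun x => by simp [ctHat]⟩
    · exact ⟨![3, -3, -3], fun x => by simp [ctHat]; ring⟩
  choose a ha using hb
  -- The six monomial coefficients of the product of the affine functions `k` and `l`; below, `d`
  -- holds those of a single affine function.
  let e : Fin 6 → Fin 4 → Fin 4 → ℝ := ![fun k l => a k 0 * a l 0,
    fun k l => a k 0 * a l 1 + a k 1 * a l 0, fun k l => a k 0 * a l 2 + a k 2 * a l 0,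
    fun k l => a k 1 * a l 1, fun k l => a k 1 * a l 2 + a k 2 * a l 1, fun k l => a k 2 * a l 2]
  let d : Fin 6 → Fin 4 → ℝ := ![fun k => a k 0, fun k => a k 1, fun k => a k 2, 0, 0, 0]
  rw [isPolyOn_two_iff]
  refine ⟨fun n => 2 * ∑ k, ∑ l, e n k l * ξ k l m - ∑ k, d n k * ξ k k m, fun x hx => ?_⟩
  rw [ginterp_eq_interp hx]
  simp only [interp, quadInterp, PiLp.sub_apply, PiLp.smul_apply, smul_eq_mul, WithLp.ofLp_sum,
    Finset.sum_apply, ha]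
  simp only [Finset.mul_sum, sub_mul, Finset.sum_mul]
  have : ∀ p q : ℝ, ∀ p0 p1 p2 p3 p4 p5 q0 q1 q2 q3 q4 q5 : ℝ,
      p = p0 + p1 + p2 + p3 + p4 + p5 → q = q0 + q1 + q2 + q3 + q4 + q5 →
      p - q = p0 - q0 + (p1 - q1) + (p2 - q2) + (p3 - q3) + (p4 - q4) + (p5 - q5) := by
    intros; linarith
  apply this
  · simp only [← Finset.sum_add_distrib]
    refine Finset.sum_congr rfl fun k _ => Finset.sum_congr rfl fun l _ => ?_
    simp [e]; ring
  · simp only [← Finset.sum_add_distrib]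
    refine Finset.sum_congr rfl fun k _ => ?_
    simp [d]; ring

/-! ### Sobolev functions -/

/-- The coordinates of the plane as continuous linear functionals. -/
def coordL (m : Fin 2) : E →L[ℝ] ℝ := EuclideanSpace.proj m

@[simp] lemma coordL_apply (m : Fin 2) (x : E) : coordL m x = x m := rfl

lemma memLp_of_bound {U : Set E} (hU : volume U ≠ ⊤) {V : Type*} [NormedAddCommGroup V]
    {f : E → V} (hf : AEStronglyMeasurable f (volume.restrict U)) {C : ℝ} (hC : ∀ x, ‖f x‖ ≤ C) :
    MemLp f 2 (volume.restrict U) :=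
  have : IsFiniteMeasure (volume.restrict U) :=
    ⟨by rw [Measure.restrict_apply_univ]; exact hU.lt_top⟩
  MemLp.of_bound hf C (Eventually.of_forall hC)

/-- Dominated convergence, with a constant as the dominating function on a set of finite measure. -/
lemma tendsto_eLpNorm_of_bound {U : Set E} (hU : volume U ≠ ⊤) {V : Type*} [NormedAddCommGroup V]
    {f : ℕ → E → V} (hf : ∀ n, AEStronglyMeasurable (f n) (volume.restrict U)) {C : ℝ}
    (hC : ∀ n x, ‖f n x‖ ≤ C)
    (hlim : ∀ᵐ x ∂(volume.restrict U), Tendsto (fun n => f n x) atTop (𝓝 0)) :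
    Tendsto (fun n => eLpNorm (f n) 2 (volume.restrict U)) atTop (𝓝 0) := by
  have : IsFiniteMeasure (volume.restrict U) :=
    ⟨by rw [Measure.restrict_apply_univ]; exact hU.lt_top⟩
  have hC0 : 0 ≤ C := (norm_nonneg _).trans (hC 0 0)
  simp only [eLpNorm_eq_lintegral_rpow_enorm_toReal (two_ne_zero) (ENNReal.ofNat_ne_top)]
  have h1 : Tendsto (fun n => ∫⁻ x in U, ‖f n x‖ₑ ^ (2 : ENNReal).toReal) atTop
      (𝓝 (∫⁻ x in U, 0)) := by
    refine tendsto_lintegral_of_dominated_convergence' (fun _ => ENNReal.ofReal C ^ 2)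
      (fun n => ((hf n).enorm).pow_const _) (fun n => Eventually.of_forall fun x => ?_) ?_ ?_
    · simp only [ENNReal.toReal_ofNat, ENNReal.rpow_ofNat]
      gcongr
      rw [← ofReal_norm]
      exact ENNReal.ofReal_le_ofReal (hC n x)
    · rw [lintegral_const]
      exact ENNReal.mul_ne_top (ENNReal.pow_ne_top ENNReal.ofReal_ne_top) (measure_ne_top _ _)
    · filter_upwards [hlim] with x hx
      have h2 := (hx.enorm)
      simp only [enorm_zero] at h2
      have := h2.ennrpow_const (2 : ENNReal).toReal
      simpa using this
  rw [lintegral_zero] at h1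
  have := h1.ennrpow_const (1 / (2 : ENNReal).toReal)
  simpa using this

lemma setIntegral_eq_of_tsupport {V : Type*} [NormedAddCommGroup V] [NormedSpace ℝ V] {U : Set E}
    {f : E → V} {φ : E → ℝ} (hφ : tsupport φ ⊆ U) (h : ∀ x, x ∉ tsupport φ → f x = 0) :
    ∫ x in U, f x = ∫ x, f x :=
  setIntegral_eq_integral_of_forall_compl_eq_zero fun x hx => h x fun h' => hx (hφ h')

/-- Integration by parts for a Lipschitz field and a test function. -/
lemma integral_fderiv_smul_of_bddLip {v : E → E} (hv : BddLip v) {φ : E → ℝ} (h1 : ContDiff ℝ ∞ φ)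
    (h2 : HasCompactSupport φ) (e : E) :
    ∫ x, (fderiv ℝ φ x e) • v x = - ∫ x, φ x • fderiv ℝ v x e := by
  obtain ⟨⟨C, hC⟩, B, hB⟩ := hv
  obtain ⟨D, hD⟩ := h1.lipschitzWith_of_hasCompactSupport h2 (by simp)
  have hφd : Differentiable ℝ φ := h1.differentiable (by simp)
  have hφ' : Continuous fun x => fderiv ℝ φ x e :=
    (h1.continuous_fderiv (by simp)).clm_apply continuous_const
  have hs' : HasCompactSupport fun x => fderiv ℝ φ x e := h2.fderiv_apply ℝ e
  have hi1 : Integrable fun x => (fderiv ℝ φ x e) • v x :=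
    (hφ'.smul hC.continuous).integrable_of_hasCompactSupport hs'.smul_right
  have hi2 : Integrable fun x => φ x • fderiv ℝ v x e := by
    have := (h1.continuous.integrable_of_hasCompactSupport (μ := volume) h2).smul_bdd (C * ‖e‖)
      (f := fun x => fderiv ℝ v x e) (measurable_fderiv_apply_const ℝ v e).aestronglyMeasurable
      (Eventually.of_forall fun x => (ContinuousLinearMap.le_opNorm _ _).trans
        (mul_le_mul_of_nonneg_right (norm_fderiv_le_of_lipschitz ℝ hC) (norm_nonneg _)))
    exact this
  ext m
  have hp := fun (f : E → E) (hf : Integrable f) => (coordL m).integral_comp_comm hf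
  simp only [coordL_apply] at hp
  rw [PiLp.neg_apply, ← hp _ hi1, ← hp _ hi2]
  have hCm : LipschitzWith C fun x => v x m := LipschitzWith.of_dist_le_mul fun x y => by
    have h3 : dist (v x m) (v y m) ≤ dist (v x) (v y) := by
      simpa [dist_eq_norm] using PiLp.norm_apply_le (v x - v y) m
    exact h3.trans (hC.dist_le_mul x y)
  have key := hCm.integral_lineDeriv_mul_eq (μ := volume) hD h2 e
  have hl : (fun x => lineDeriv ℝ φ x (-e) * v x m) = fun x => -((fderiv ℝ φ x e) • v x) m := by
    funext x
    rw [(hφd x).lineDeriv_eq_fderiv, map_neg, PiLp.smul_apply, smul_eq_mul, neg_mul]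
  -- By Rademacher's theorem the line derivative is almost everywhere given by the Fréchet
  -- derivative.
  have hr : ∫ x, lineDeriv ℝ (fun x => v x m) x e * φ x = ∫ x, (φ x • fderiv ℝ v x e) m := by
    refine integral_congr_ae ?_
    filter_upwards [hC.ae_differentiableAt] with x hx
    have hd : HasFDerivAt (fun x => v x m)
        ((coordL m).comp (fderiv ℝ v x)) x :=
      (coordL m).hasFDerivAt.comp x
        hx.hasFDerivAt
    rw [(hd.hasLineDerivAt e).lineDeriv]
    simp [mul_comm]
  rw [hr, hl, integral_neg] at key
  rw [key, neg_neg]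

/-- The classical derivative exists almost everywhere and is bounded by the Lipschitz constant. It
serves as the weak gradient; its default value zero elsewhere is harmless. -/
lemma BddLip.memH1 {U : Set E} (hU : volume U ≠ ⊤) {v : E → E} (hv : BddLip v) : MemH1 U v := by
  obtain ⟨⟨C, hC⟩, B, hB⟩ := id hv
  refine ⟨memLp_of_bound hU hC.continuous.aestronglyMeasurable hB, fderiv ℝ v,
    memLp_of_bound hU (measurable_fderiv ℝ v).aestronglyMeasurable
      (fun x => norm_fderiv_le_of_lipschitz ℝ hC), fun φ h1 h2 h3 e => ?_⟩
  rw [setIntegral_eq_of_tsupport h3, setIntegral_eq_of_tsupport h3,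
    integral_fderiv_smul_of_bddLip hv h1 h2]
  · intro x hx; rw [image_eq_zero_of_notMem_tsupport hx, zero_smul]
  · intro x hx
    rw [image_eq_zero_of_notMem_tsupport (fun h => hx (tsupport_fderiv_subset ℝ h)),
      _root_.zero_apply, zero_smul]

lemma MemH1.congr {U : Set E} (hU : MeasurableSet U) {v w : E → E} (hv : MemH1 U v)
    (h : EqOn w v U) :
    MemH1 U w := by
  obtain ⟨h1, g, h2, h3⟩ := hv
  have hae : v =ᵐ[volume.restrict U] w := (ae_restrict_mem hU).mono fun x hx => (h hx).symm
  refine ⟨h1.ae_eq hae, g, h2, fun φ a b c e => ?_⟩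
  rw [← h3 φ a b c e]
  exact setIntegral_congr_fun hU fun x hx => by simp only [h hx]

lemma volume_refTri_ne_top : volume refTri ≠ ⊤ := refTri_isCompact.measure_lt_top.ne

/-- The weak differentiability in the definition of the reference velocities is automatic. -/
lemma mem_refVel_iff {v : E → E} :
    v ∈ refVel ↔ ∀ i : Fin 3, ∀ j : Fin 2, IsPolyOn 2 (ctTri i) fun x => v x j := by
  refine ⟨fun h => h.2, fun h => ⟨?_, h⟩⟩
  -- A field that is quadratic on the closed triangles of the split coincides with its interpolant,
  -- whose formula is Lipschitz on the whole plane.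
  refine ((bddLip_ginterp fun k l => v (node k l)).memH1
    (measure_ne_top_of_subset interior_subset volume_refTri_ne_top)).congr
    isOpen_interior.measurableSet fun x hx => ?_
  exact (ginterp_eq_of_isPolyOn h (interior_subset hx)).symm

lemma ginterp_mem_refVel (ξ : Fin 4 → Fin 4 → E) : ginterp ξ ∈ refVel :=
  mem_refVel_iff.2 fun j m => isPolyOn_ginterp ξ j m

lemma memLp_fun_add {V : Type*} [NormedAddCommGroup V] {μ : Measure E} {a b : E → V}
    (ha : MemLp a 2 μ) (hb : MemLp b 2 μ) : MemLp (fun x => a x + b x) 2 μ := ha.add hb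

lemma tendsto_eLpNorm_add {V : Type*} [NormedAddCommGroup V] {μ : Measure E} {a b c : ℕ → E → V}
    (ha : ∀ n, AEStronglyMeasurable (a n) μ) (hb : ∀ n, AEStronglyMeasurable (b n) μ)
    (hc : ∀ n x, c n x = a n x + b n x)
    (h1 : Tendsto (fun n => eLpNorm (a n) 2 μ) atTop (𝓝 0))
    (h2 : Tendsto (fun n => eLpNorm (b n) 2 μ) atTop (𝓝 0)) :
    Tendsto (fun n => eLpNorm (c n) 2 μ) atTop (𝓝 0) := by
  have h3 := h1.add h2
  rw [add_zero] at h3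
  refine tendsto_of_tendsto_of_tendsto_of_le_of_le tendsto_const_nhds h3
    (fun n => bot_le) fun n => ?_
  have he : c n = a n + b n := funext (hc n)
  rw [he]
  exact eLpNorm_add_le (ha n) (hb n) one_le_two

lemma MemH10.add {U : Set E} {v w : E → E} (hv : MemH10 U v) (hw : MemH10 U w) :
    MemH10 U fun x => v x + w x := by
  obtain ⟨h1, g, h2, φ, h3, h4, h5⟩ := hv
  obtain ⟨h1', g', h2', φ', h3', h4', h5'⟩ := hw
  have k1 : ∀ n, AEStronglyMeasurable (fun x => φ n x - v x) (volume.restrict U) :=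
    fun n => (h3 n).1.continuous.aestronglyMeasurable.sub h1.1
  have k2 : ∀ n, AEStronglyMeasurable (fun x => φ' n x - w x) (volume.restrict U) :=
    fun n => (h3' n).1.continuous.aestronglyMeasurable.sub h1'.1
  have k3 : ∀ n, AEStronglyMeasurable (fun x => fderiv ℝ (φ n) x - g x) (volume.restrict U) :=
    fun n => ((h3 n).1.continuous_fderiv (by simp)).aestronglyMeasurable.sub h2.1
  have k4 : ∀ n, AEStronglyMeasurable (fun x => fderiv ℝ (φ' n) x - g' x) (volume.restrict U) :=
    fun n => ((h3' n).1.continuous_fderiv (by simp)).aestronglyMeasurable.sub h2'.1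
  refine ⟨memLp_fun_add h1 h1', fun x => g x + g' x, memLp_fun_add h2 h2', fun n x => φ n x + φ' n x, fun n => ?_,
    tendsto_eLpNorm_add k1 k2 (fun n x => ?_) h4 h4',
    tendsto_eLpNorm_add k3 k4 (fun n x => ?_) h5 h5'⟩
  · refine ⟨(h3 n).1.add (h3' n).1, (h3 n).2.1.add (h3' n).2.1, ?_⟩
    exact (tsupport_add (φ n) (φ' n)).trans (union_subset (h3 n).2.2 (h3' n).2.2)
  · exact add_sub_add_comm _ _ _ _
  · rw [fderiv_fun_add ((h3 n).1.differentiable (by simp) x)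
      ((h3' n).1.differentiable (by simp) x)]
    exact add_sub_add_comm _ _ _ _

lemma MemH10.const_smul {U : Set E} {v : E → E} (hv : MemH10 U v) (r : ℝ) :
    MemH10 U fun x => r • v x := by
  obtain ⟨h1, g, h2, φ, h3, h4, h5⟩ := hv
  refine ⟨h1.const_smul r, fun x => r • g x, h2.const_smul r, fun n x => r • φ n x, fun n => ?_,
    ?_, ?_⟩
  · refine ⟨(h3 n).1.const_smul r, ?_, ?_⟩
    · exact (h3 n).2.1.comp_left (g := fun y => r • y) (smul_zero r)
    · exact (tsupport_smul_subset_right (fun _ => r) (φ n)).trans (h3 n).2.2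
  · have := ENNReal.Tendsto.const_mul (a := ‖r‖ₑ) h4 (Or.inr enorm_ne_top)
    rw [mul_zero] at this
    refine this.congr fun n => ?_
    rw [← eLpNorm_const_smul]
    congr 1; funext x; simp [smul_sub]
  · have := ENNReal.Tendsto.const_mul (a := ‖r‖ₑ) h5 (Or.inr enorm_ne_top)
    rw [mul_zero] at this
    refine this.congr fun n => ?_
    rw [← eLpNorm_const_smul]
    congr 1; funext x
    rw [fderiv_fun_const_smul ((h3 n).1.differentiable (by simp) x)]
    simp [smul_sub]


/-- A constant field with zero boundary values vanishes. -/
lemma MemH10.const_eq_zero {U : Set E} (hU : IsOpen U) (hne : U.Nonempty)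
    (hb : Bornology.IsBounded U) {c : E} {v : E → E} (h : MemH10 U v) (hvc : ∀ x ∈ U, v x = c) :
    c = 0 := by
  obtain ⟨h1, g, h2, φ, h3, h4, h5⟩ := h
  have hfin : volume U ≠ ⊤ := hb.measure_lt_top.ne
  have : IsFiniteMeasure (volume.restrict U) :=
    ⟨by rw [Measure.restrict_apply_univ]; exact hfin.lt_top⟩
  -- pairing with bounded functions passes to the limit
  have hpair : ∀ {V : Type} [NormedAddCommGroup V] [NormedSpace ℝ V] (ψ : E → ℝ) (B : ℝ)
      (a : ℕ → E → V) (b : E → V), Continuous ψ → (∀ x ∈ U, ‖ψ x‖ ≤ B) →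
      (∀ n, MemLp (a n) 2 (volume.restrict U)) → MemLp b 2 (volume.restrict U) →
      Tendsto (fun n => eLpNorm (fun x => a n x - b x) 2 (volume.restrict U)) atTop (𝓝 0) →
      Tendsto (fun n => ∫ x in U, ψ x • a n x) atTop (𝓝 (∫ x in U, ψ x • b x)) := by
    intro V _ _ ψ B a b hψ hB ha hb hlim
    have hψb : ∀ᵐ x ∂(volume.restrict U), ‖ψ x‖ ≤ B :=
      (ae_restrict_mem hU.measurableSet).mono hB
    have hL : ∀ f : E → V, MemLp f 2 (volume.restrict U) →
        MemLp (fun x => ψ x • f x) 2 (volume.restrict U) := fun f hf =>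
      hf.smul (memLp_top_of_bound hψ.aestronglyMeasurable B hψb)
    refine tendsto_integral_of_L1 _ (hL b hb).1
      (Eventually.of_forall fun n => (hL _ (ha n)).integrable one_le_two) ?_
    have hB0 : 0 ≤ B := by
      obtain ⟨x, hx⟩ := hne
      exact (norm_nonneg _).trans (hB x hx)
    have h6 := ENNReal.Tendsto.const_mul (a := ENNReal.ofReal B
      * volume U ^ (1 / 2 : ℝ)) hlim (Or.inr (ENNReal.mul_ne_top ENNReal.ofReal_ne_top
        (ENNReal.rpow_ne_top_of_nonneg (by norm_num) hfin)))
    rw [mul_zero] at h6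
    refine tendsto_of_tendsto_of_tendsto_of_le_of_le tendsto_const_nhds h6 (fun n => bot_le)
      fun n => ?_
    have hm : AEStronglyMeasurable (fun x => a n x - b x) (volume.restrict U) :=
      (ha n).1.sub hb.1
    calc ∫⁻ x in U, ‖ψ x • a n x - ψ x • b x‖ₑ
        ≤ ∫⁻ x in U, ENNReal.ofReal B * ‖a n x - b x‖ₑ := by
          refine lintegral_mono_ae (hψb.mono fun x hx => ?_)
          rw [← smul_sub, enorm_smul]
          gcongr
          rw [← ofReal_norm]
          exact ENNReal.ofReal_le_ofReal hx
      _ = ENNReal.ofReal B * eLpNorm (fun x => a n x - b x) 1 (volume.restrict U) := by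
          rw [lintegral_const_mul'' _ hm.enorm, eLpNorm_one_eq_lintegral_enorm]
      _ ≤ ENNReal.ofReal B * (eLpNorm (fun x => a n x - b x) 2 (volume.restrict U)
            * volume U ^ (1 / 2 : ℝ)) := by
          gcongr
          have := eLpNorm_le_eLpNorm_mul_rpow_measure_univ (p := 1) (q := 2) one_le_two hm
          rw [Measure.restrict_apply_univ] at this
          have h7 : (1 : ℝ) / ENNReal.toReal 1 - 1 / ENNReal.toReal 2 = 1 / 2 := by norm_num
          rwa [h7] at this
      _ = ENNReal.ofReal B * volume U ^ (1 / 2 : ℝ)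
            * eLpNorm (fun x => a n x - b x) 2 (volume.restrict U) := by ring
  have hφ1 : ∀ n, MemLp (φ n) 2 (volume.restrict U) := fun n =>
    ((h3 n).1.continuous.memLp_of_hasCompactSupport (h3 n).2.1).restrict U
  have hφ2 : ∀ n, MemLp (fderiv ℝ (φ n)) 2 (volume.restrict U) := fun n =>
    (((h3 n).1.continuous_fderiv (by simp)).memLp_of_hasCompactSupport
      ((h3 n).2.1.fderiv ℝ)).restrict U
  let e : E := EuclideanSpace.single 0 1
  have hφe : ∀ n, Continuous fun x => fderiv ℝ (φ n) x e := fun n =>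
    ((h3 n).1.continuous_fderiv (by simp)).clm_apply continuous_const
  have hφs : ∀ n, HasCompactSupport fun x => fderiv ℝ (φ n) x e := fun n =>
    (h3 n).2.1.fderiv_apply ℝ e
  -- integration by parts against a smooth function
  have hparts : ∀ n (ψ : E → ℝ), ContDiff ℝ ∞ ψ →
      ∫ x in U, ψ x • fderiv ℝ (φ n) x e = - ∫ x in U, fderiv ℝ ψ x e • φ n x := by
    intro n ψ hψ
    have hs : ∀ {V : Type} [NormedAddCommGroup V] [NormedSpace ℝ V] (f : E → V),
        (∀ x, x ∉ tsupport (φ n) → f x = 0) → ∫ x in U, f x = ∫ x, f x := fun f hf =>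
      setIntegral_eq_integral_of_forall_compl_eq_zero
        fun x hx => hf x fun h' => hx ((h3 n).2.2 h')
    rw [hs, hs]
    · have hψ' : Continuous fun x => fderiv ℝ ψ x e :=
        (hψ.continuous_fderiv (by simp)).clm_apply continuous_const
      refine integral_smul_fderiv_eq_neg_fderiv_smul_of_integrable ?_ ?_ ?_
        (fun x _ => hψ.differentiable (by simp) x)
        (fun x _ => (h3 n).1.differentiable (by simp) x)
      · exact (hψ'.smul (h3 n).1.continuous).integrable_of_hasCompactSupport (h3 n).2.1.smul_left
      · exact (hψ.continuous.smul (hφe n)).integrable_of_hasCompactSupport (hφs n).smul_left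
      · exact (hψ.continuous.smul (h3 n).1.continuous).integrable_of_hasCompactSupport
          (h3 n).2.1.smul_left
    · intro x hx; rw [image_eq_zero_of_notMem_tsupport hx, smul_zero]
    · intro x hx
      rw [image_eq_zero_of_notMem_tsupport (fun h => hx (tsupport_fderiv_subset ℝ h)),
        _root_.zero_apply, smul_zero]
  -- In the limit, integration by parts holds for every smooth `ψ` that is bounded on `U` together
  -- with its derivative along `e`. No support condition on `ψ` is needed, since the approximants `φ
  -- n` have compact support in `U`.
  have hlim : ∀ (ψ : E → ℝ) (B : ℝ), ContDiff ℝ ∞ ψ → (∀ x ∈ U, ‖ψ x‖ ≤ B) →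
      (∀ x ∈ U, ‖fderiv ℝ ψ x e‖ ≤ B) →
      ∫ x in U, ψ x • g x e = - ∫ x in U, fderiv ℝ ψ x e • c := by
    intro ψ B hψ hB hB'
    have hψ' : Continuous fun x => fderiv ℝ ψ x e :=
      (hψ.continuous_fderiv (by simp)).clm_apply continuous_const
    have t1 := hpair ψ B (fun n => fderiv ℝ (φ n)) g hψ.continuous hB hφ2 h2 h5
    have hint : ∀ f : E → E →L[ℝ] E, MemLp f 2 (volume.restrict U) →
        (∫ x in U, ψ x • f x) e = ∫ x in U, ψ x • f x e := by
      intro f hf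
      have hi : Integrable (fun x => ψ x • f x) (volume.restrict U) :=
        (hf.smul (memLp_top_of_bound hψ.continuous.aestronglyMeasurable B
          ((ae_restrict_mem hU.measurableSet).mono hB)) (r := 2)).integrable one_le_two
      exact ContinuousLinearMap.integral_apply hi e
    have t1' := ((ContinuousLinearMap.apply ℝ E e).continuous.tendsto _).comp t1
    have t2 := (hpair (fun x => fderiv ℝ ψ x e) B φ v hψ' hB' hφ1 h1 h4).neg
    have t3 : Tendsto (fun n => ∫ x in U, ψ x • fderiv ℝ (φ n) x e) atTop
        (𝓝 (∫ x in U, ψ x • g x e)) := by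
      rw [← hint g h2]
      refine t1'.congr fun n => ?_
      simp only [Function.comp_apply, ContinuousLinearMap.apply_apply]
      exact hint _ (hφ2 n)
    simp only [hparts _ ψ hψ] at t3
    rw [tendsto_nhds_unique t3 t2]
    congr 1
    exact setIntegral_congr_fun hU.measurableSet fun x hx => by simp only [hvc x hx]
  -- For `ψ` supported in `U` the right-hand side is `c` times the integral of a derivative of `ψ`,
  -- hence zero. So the weak derivative vanishes.
  have hg : ∀ᵐ x, x ∈ U → g x e = 0 := by
    refine hU.ae_eq_zero_of_integral_contDiff_smul_eq_zero ?_ fun ψ h6 h7 h8 => ?_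
    · have : MemLp (fun x => g x e) 2 (volume.restrict U) :=
        (ContinuousLinearMap.apply ℝ E e).comp_memLp' h2
      have h16 : IntegrableOn (fun x => g x e) U := this.integrable one_le_two
      exact h16.locallyIntegrableOn
    · obtain ⟨B, hB⟩ := h7.exists_bound_of_continuous h6.continuous
      have hψ' : Continuous fun x => fderiv ℝ ψ x e :=
        (h6.continuous_fderiv (by simp)).clm_apply continuous_const
      obtain ⟨B', hB'⟩ := (h7.fderiv_apply ℝ e).exists_bound_of_continuous hψ'
      have h9 := hlim ψ (max B B') h6 (fun x _ => (hB x).trans (le_max_left _ _))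
        fun x _ => (hB' x).trans (le_max_right _ _)
      rw [setIntegral_eq_of_tsupport h8, integral_smul_const, setIntegral_eq_of_tsupport h8] at h9
      · rw [h9]
        have h10 := integral_smul_fderiv_eq_neg_fderiv_smul_of_integrable (μ := volume)
          (f := fun _ : E => (1 : ℝ)) (g := ψ) (v := e)
          (by simp) (by simpa using hψ'.integrable_of_hasCompactSupport (h7.fderiv_apply ℝ e))
          (by simpa using h6.continuous.integrable_of_hasCompactSupport h7)
          (fun x _ => differentiableAt_const _) (fun x _ => h6.differentiable (by simp) x)
        simp at h10
        rw [h10, zero_smul, neg_zero]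
      · intro x hx
        rw [image_eq_zero_of_notMem_tsupport (fun h => hx (tsupport_fderiv_subset ℝ h)),
          _root_.zero_apply]
      · intro x hx; rw [image_eq_zero_of_notMem_tsupport hx, zero_smul]
  obtain ⟨R, hR⟩ := hb.exists_norm_le
  have hd : ∀ x, HasFDerivAt (fun x : E => x 0) (coordL 0) x := fun x => (coordL 0).hasFDerivAt
  -- Now `ψ` is the first coordinate, which does not vanish on the boundary. Its derivative along
  -- `e` is one, and the identity becomes `0 = -|U| • c`.
  have h11 := hlim (fun x => x 0) (max R 1) (coordL 0).contDiff
    (fun x hx => (PiLp.norm_apply_le x 0).trans ((hR x hx).trans (le_max_left _ _)))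
    (fun x hx => by rw [(hd x).fderiv]; simp [e])
  have h12 : ∫ x in U, x 0 • g x e = 0 := by
    rw [← integral_zero E E (μ := volume.restrict U)]
    refine integral_congr_ae ?_
    filter_upwards [ae_restrict_of_ae hg, ae_restrict_mem hU.measurableSet] with x hx hx'
    rw [hx hx', smul_zero]
  rw [h12] at h11
  have h13 : ∀ x, fderiv ℝ (fun x : E => x 0) x e = 1 := fun x => by
    rw [(hd x).fderiv]; simp [e]
  simp only [h13, one_smul, setIntegral_const] at h11
  have h14 : volume.real U ≠ 0 :=
    ENNReal.toReal_ne_zero.2 ⟨(hU.measure_pos volume hne).ne', hfin⟩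
  have h15 := (zero_eq_neg.1 h11)
  exact (smul_eq_zero.1 h15).resolve_left h14

open scoped Convolution in
/-- Derivative of the mollification of a Lipschitz function. -/
lemma hasFDerivAt_mollify {v : E → E} (hv : BddLip v) (ψ : ContDiffBump (0 : E)) (x : E) :
    HasFDerivAt (fun x => ∫ y, ψ.normed volume y • v (x - y))
      (∫ y, ψ.normed volume y • fderiv ℝ v (x - y)) x := by
  obtain ⟨⟨C, hC⟩, B, hB⟩ := hv
  have hψ := ψ.integrable_normed (μ := volume)
  refine (hasFDerivAt_integral_of_dominated_loc_of_lip (s := univ)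
    (F := fun x y => ψ.normed volume y • v (x - y)) (bound := fun y => ψ.normed volume y * C)
    (F' := fun y => ψ.normed volume y • fderiv ℝ v (x - y))
    univ_mem (Eventually.of_forall fun z => ?_) ?_ ?_ ?_ (hψ.mul_const _) ?_).2
  · exact (ψ.continuous_normed.smul (hC.continuous.comp
      (continuous_const.sub continuous_id))).aestronglyMeasurable
  · exact hψ.smul_bdd B (f := fun y => v (x - y)) (hC.continuous.comp
      (continuous_const.sub continuous_id)).aestronglyMeasurable (Eventually.of_forall fun y => hB _)
  · exact ψ.continuous_normed.aestronglyMeasurable.smul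
      ((measurable_fderiv ℝ v).comp (measurable_const.sub measurable_id)).aestronglyMeasurable
  · refine Eventually.of_forall fun y => LipschitzOnWith.of_dist_le_mul fun a _ b _ => ?_
    have h0 := ψ.nonneg_normed (μ := volume) y
    rw [dist_eq_norm, ← smul_sub, norm_smul, Real.norm_of_nonneg h0, Real.coe_nnabs,
      abs_of_nonneg (mul_nonneg h0 C.coe_nonneg), mul_assoc, ← dist_eq_norm]
    refine mul_le_mul_of_nonneg_left ?_ h0
    simpa using hC.dist_le_mul (a - y) (b - y)
  -- For almost every `y` the function is differentiable at `x - y`, since `y ↦ x - y` respects null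
  -- sets.
  · have hq := (quasiMeasurePreserving_sub_left_of_right_invariant volume x).ae
      hC.ae_differentiableAt
    filter_upwards [hq] with y hy
    have h1 : HasFDerivAt (fun z => v (z - y)) (fderiv ℝ v (x - y)) x := by
      have := hy.hasFDerivAt.comp x ((hasFDerivAt_id x).sub_const y)
      rw [ContinuousLinearMap.comp_id] at this
      exact this
    exact h1.fun_const_smul _

lemma integral_normed_smul_congr {V : Type*} [NormedAddCommGroup V] [NormedSpace ℝ V]
    (ψ : ContDiffBump (0 : E)) {f g : E → V} (h : ∀ y, ‖y‖ < ψ.rOut → f y = g y) :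
    ∫ y, ψ.normed volume y • f y = ∫ y, ψ.normed volume y • g y := by
  refine integral_congr_ae (Eventually.of_forall fun y => ?_)
  by_cases hy : ‖y‖ < ψ.rOut
  · simp only [h y hy]
  · have : ψ.normed volume y = 0 := by
      rw [← Function.notMem_support, ψ.support_normed_eq]
      simpa using hy
    simp only [this, zero_smul]

open scoped Convolution in
/-- A Lipschitz function that vanishes outside of a bounded open set has zero boundary values. -/
lemma memH10_of_nonneg {U : Set E} (hUb : Bornology.IsBounded U) {b : E → ℝ}
    (hb : BddLip b) (h0 : ∀ x, 0 ≤ b x) (hz : ∀ x, x ∉ U → b x = 0) (e : E) :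
    MemH10 U fun x => b x • e := by
  obtain ⟨⟨L, hL⟩, B, hB⟩ := id hb
  have hfin : volume U ≠ ⊤ := hUb.measure_lt_top.ne
  have hLb : ∀ x y, |b x - b y| ≤ L * ‖x - y‖ := fun x y => by
    have := hL.dist_le_mul x y; rwa [Real.dist_eq, dist_eq_norm] at this
  have hv : BddLip fun x => b x • e := hb.smul (BddLip.const e)
  obtain ⟨⟨K, hK⟩, -⟩ := id hv
  let ε : ℕ → ℝ := fun n => 1 / ((n : ℝ) + 1)
  have hε : ∀ n, 0 < ε n := fun n => by positivity
  have hε1 : ∀ n, ε n ≤ 1 := fun n => by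
    simp only [ε]; rw [div_le_one (by positivity)]; linarith [(Nat.cast_nonneg n : (0 : ℝ) ≤ n)]
  have hεlim : Tendsto ε atTop (𝓝 0) := tendsto_one_div_add_atTop_nhds_zero_nat
  -- The radius satisfies `L * r + r = ε`. Where `b < r`, all values of `b` within distance `r` are
  -- below `ε`, so the truncation `(b - ε)⁺` vanishes there. Its mollification is therefore
  -- supported in `{r ≤ b}`, a closed subset of `U`.
  let r : ℕ → ℝ := fun n => ε n / (L + 1)
  have hL1 : (0 : ℝ) < L + 1 := by positivity
  have hr : ∀ n, 0 < r n := fun n => div_pos (hε n) hL1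
  have hrε : ∀ n, L * r n + r n = ε n := fun n => by
    simp only [r]; field_simp
  have hrlim : Tendsto r atTop (𝓝 0) := by simpa using hεlim.div_const ((L : ℝ) + 1)
  let ψ : ℕ → ContDiffBump (0 : E) := fun n => ⟨r n / 2, r n, half_pos (hr n), half_lt_self (hr n)⟩
  have hψr : ∀ n, (ψ n).rOut = r n := fun n => rfl
  let bn : ℕ → E → ℝ := fun n x => max (b x - ε n) 0
  have hbn0 : ∀ n x, 0 ≤ bn n x := fun n x => le_max_right _ _
  have hbnle : ∀ n x, bn n x ≤ b x := fun n x => max_le (by linarith [hε n]) (h0 x)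
  have hbnlip : ∀ n, LipschitzWith L (bn n) := fun n => by
    have := ((hL.sub (LipschitzWith.const (ε n))).max_const 0)
    simpa using this
  have hbnb : ∀ n, BddLip (bn n) := fun n =>
    ⟨⟨L, hbnlip n⟩, B, fun x => by
      rw [Real.norm_of_nonneg (hbn0 n x)]
      exact (hbnle n x).trans ((le_abs_self _).trans (hB x))⟩
  let vn : ℕ → E → E := fun n x => bn n x • e
  have hvnb : ∀ n, BddLip (vn n) := fun n => (hbnb n).smul (BddLip.const e)
  let φ : ℕ → E → E := fun n x => ∫ y, (ψ n).normed volume y • vn n (x - y)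
  have hφd : ∀ n x, HasFDerivAt (φ n) (∫ y, (ψ n).normed volume y • fderiv ℝ (vn n) (x - y)) x :=
    fun n x => hasFDerivAt_mollify (hvnb n) (ψ n) x
  -- near points where `b` is small, the truncation vanishes
  have hsmall : ∀ n x, b x < r n → ∀ y, ‖y‖ < r n → bn n (x - y) = 0 := by
    intro n x hx y hy
    refine max_eq_right ?_
    have h1 := hLb (x - y) x
    rw [sub_sub_cancel_left, norm_neg] at h1
    have h2 := (abs_le.1 h1).2
    have h3 := mul_le_mul_of_nonneg_left hy.le L.2
    have h4 : (L : ℝ) * ‖y‖ ≤ L * r n := h3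
    have := hrε n
    linarith
  have hφ0 : ∀ n x, b x < r n → φ n x = 0 := by
    intro n x hx
    have : φ n x = ∫ y, (ψ n).normed volume y • (0 : E) :=
      integral_normed_smul_congr (ψ n) fun y hy => by
        simp only [vn, hsmall n x hx y hy, zero_smul]
    rw [this]; simp
  have hint1 : ∀ n, ∫ y, (ψ n).normed volume y = 1 := fun n => (ψ n).integral_normed
  have hφv : ∀ n x, ‖φ n x - b x • e‖ ≤ 2 * ε n * ‖e‖ := by
    intro n x
    have h1 : b x • e = ∫ y, (ψ n).normed volume y • (b x • e) := by
      rw [integral_smul_const, hint1, one_smul]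
    have hi1 : Integrable fun y => (ψ n).normed volume y • vn n (x - y) := by
      obtain ⟨⟨C, hC⟩, B', hB'⟩ := hvnb n
      exact (ψ n).integrable_normed.smul_bdd B' (f := fun y => vn n (x - y)) (hC.continuous.comp
        (continuous_const.sub continuous_id)).aestronglyMeasurable
        (Eventually.of_forall fun y => hB' _)
    have hi2 : Integrable fun y => (ψ n).normed volume y • (b x • e) :=
      (ψ n).integrable_normed.smul_const _
    rw [h1, ← integral_sub hi1 hi2]
    have h2 : ∫ y, (ψ n).normed volume y * (2 * ε n * ‖e‖) = 2 * ε n * ‖e‖ := by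
      rw [integral_mul_const, hint1, one_mul]
    rw [← h2]
    refine norm_integral_le_of_norm_le ((ψ n).integrable_normed.mul_const _)
      (Eventually.of_forall fun y => ?_)
    have h3 := (ψ n).nonneg_normed (μ := volume) y
    rw [← smul_sub, norm_smul, Real.norm_of_nonneg h3]
    by_cases hy : ‖y‖ < r n
    · refine mul_le_mul_of_nonneg_left ?_ h3
      rw [← sub_smul, norm_smul]
      refine mul_le_mul_of_nonneg_right ?_ (norm_nonneg _)
      have h4 := hLb (x - y) x
      rw [sub_sub_cancel_left, norm_neg] at h4
      have h6 : (L : ℝ) * ‖y‖ ≤ L * r n := mul_le_mul_of_nonneg_left hy.le L.2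
      have h7 := hrε n
      have h8 := hr n
      have h9 : |bn n (x - y) - b (x - y)| ≤ ε n := by
        simp only [bn]
        rw [abs_le]
        refine ⟨by linarith [le_max_left (b (x - y) - ε n) 0], ?_⟩
        have := hbnle n (x - y)
        simp only [bn] at this
        linarith [hε n]
      rw [Real.norm_eq_abs]
      calc |bn n (x - y) - b x| ≤ |bn n (x - y) - b (x - y)| + |b (x - y) - b x| :=
            abs_sub_le _ _ _
        _ ≤ 2 * ε n := by linarith
    · have : (ψ n).normed volume y = 0 := by
        rw [← Function.notMem_support, (ψ n).support_normed_eq]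
        simpa using hy
      rw [this]; simp
  have hgb : ∀ n x, ‖fderiv ℝ (φ n) x‖ ≤ L * ‖e‖ := by
    intro n x
    rw [(hφd n x).fderiv]
    have h2 : ∫ y, (ψ n).normed volume y * (L * ‖e‖) = L * ‖e‖ := by
      rw [integral_mul_const, hint1, one_mul]
    rw [← h2]
    refine norm_integral_le_of_norm_le ((ψ n).integrable_normed.mul_const _)
      (Eventually.of_forall fun y => ?_)
    have h3 := (ψ n).nonneg_normed (μ := volume) y
    rw [norm_smul, Real.norm_of_nonneg h3]
    refine mul_le_mul_of_nonneg_left ?_ h3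
    have h4 : LipschitzWith (L * ‖e‖₊) (vn n) := LipschitzWith.of_dist_le_mul fun a c => by
      have := (hbnlip n).dist_le_mul a c
      rw [dist_eq_norm, ← sub_smul, norm_smul, NNReal.coe_mul, coe_nnnorm, mul_right_comm,
        ← dist_eq_norm]
      exact mul_le_mul_of_nonneg_right this (norm_nonneg _)
    simpa using norm_fderiv_le_of_lipschitz ℝ h4 (x₀ := x - y)
  let v : E → E := fun x => b x • e
  -- Setting the gradient to zero on the zero set of `b` avoids having to know that the derivative
  -- of `b` vanishes almost everywhere there.
  let g : E → E →L[ℝ] E := {x | 0 < b x}.indicator (fderiv ℝ v)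
  have hpos : MeasurableSet {x | 0 < b x} := (isOpen_lt continuous_const hL.continuous).measurableSet
  have hgm : Measurable g := (measurable_fderiv ℝ v).indicator hpos
  have hgB : ∀ x, ‖g x‖ ≤ K := fun x =>
    (norm_indicator_le_norm_self _ _).trans (norm_fderiv_le_of_lipschitz ℝ hK)
  have hφsm : ∀ n, ContDiff ℝ ∞ (φ n) := by
    intro n
    have h1 : φ n = (ψ n).normed volume ⋆[ContinuousLinearMap.lsmul ℝ ℝ, volume] vn n := by
      funext x
      simp [φ, convolution_def]
    rw [h1]
    obtain ⟨⟨C, hC⟩, -⟩ := hvnb n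
    exact (ψ n).hasCompactSupport_normed.contDiff_convolution_left _ (ψ n).contDiff_normed
      hC.continuous.locallyIntegrable
  have hsupp : ∀ n, tsupport (φ n) ⊆ {x | r n ≤ b x} := fun n =>
    closure_minimal (fun x hx => not_lt.1 fun h => hx (hφ0 n x h))
      (isClosed_le continuous_const hL.continuous)
  have hsuppU : ∀ n, {x | r n ≤ b x} ⊆ U := fun n x hx => by
    by_contra h
    have h1 : r n ≤ b x := hx
    rw [hz x h] at h1
    exact absurd h1 (not_le.2 (hr n))
  refine ⟨memLp_of_bound hfin hK.continuous.aestronglyMeasurable (C := B * ‖e‖) fun x => ?_, g,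
    memLp_of_bound hfin hgm.aestronglyMeasurable hgB, φ, fun n => ⟨hφsm n, ?_, ?_⟩, ?_, ?_⟩
  · rw [norm_smul]; exact mul_le_mul_of_nonneg_right (hB x) (norm_nonneg _)
  · exact Metric.isCompact_of_isClosed_isBounded (isClosed_tsupport _)
      (hUb.subset ((hsupp n).trans (hsuppU n)))
  · exact (hsupp n).trans (hsuppU n)
  · refine tendsto_eLpNorm_of_bound hfin
      (fun n => ((hφsm n).continuous.sub hK.continuous).aestronglyMeasurable) (C := 2 * 1 * ‖e‖)
      (fun n x => (hφv n x).trans ?_) (Eventually.of_forall fun x => ?_)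
    · have := hε1 n
      gcongr
    · refine squeeze_zero_norm (fun n => hφv n x) ?_
      have := (hεlim.const_mul 2).mul_const ‖e‖
      simpa using this
  · refine tendsto_eLpNorm_of_bound hfin (C := L * ‖e‖ + K)
      (fun n => (((hφsm n).continuous_fderiv (by simp)).aestronglyMeasurable).sub
        hgm.aestronglyMeasurable)
      (fun n x => (norm_sub_le _ _).trans (add_le_add (hgb n x) (hgB x))) ?_
    have hloc : LocallyIntegrable (fderiv ℝ v) volume := by
      refine LocallyIntegrable.mono (g := fderiv ℝ v) (f := fun _ : E => (K : ℝ))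
        (continuous_const.locallyIntegrable) (measurable_fderiv ℝ v).aestronglyMeasurable
        (Eventually.of_forall fun x => ?_)
      rw [Real.norm_of_nonneg K.coe_nonneg]
      exact norm_fderiv_le_of_lipschitz ℝ hK
    -- Lebesgue differentiation. The factor `2` is the ratio of the outer to the inner radius of the
    -- bumps.
    have hae := ContDiffBump.ae_convolution_tendsto_right_of_locallyIntegrable (φ := ψ) (K := 2)
      hrlim (Eventually.of_forall fun n => by
        change r n ≤ 2 * (r n / 2); linarith) hloc
    filter_upwards [ae_restrict_of_ae hae] with x hx
    simp only [(hφd _ x).fderiv]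
    -- Where `b` vanishes, the truncation is zero nearby and so is the derivative of `φ n`. Where
    -- `b` is positive, for large `n` the truncation just subtracts a constant nearby, so the
    -- derivative of `φ n` is the mollified derivative of `v`.
    rcases (h0 x).eq_or_lt with hbx | hbx
    · have hgx : g x = 0 := indicator_of_notMem (by simp [← hbx]) _
      refine tendsto_const_nhds.congr fun n => ?_
      rw [hgx, sub_zero]
      have : ∫ y, (ψ n).normed volume y • fderiv ℝ (vn n) (x - y) = 0 := by
        refine (integral_normed_smul_congr (ψ n) (g := fun _ => (0 : E →L[ℝ] E))
          fun y hy => ?_).trans (by simp only [smul_zero]; exact integral_zero _ _)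
        have h1 : vn n =ᶠ[𝓝 (x - y)] fun _ => 0 := by
          have h2 : ∀ᶠ z in 𝓝 (x - y), ‖x - z‖ < r n := by
            refine (isOpen_lt (by fun_prop) continuous_const).mem_nhds ?_
            change ‖x - (x - y)‖ < r n
            rw [sub_sub_cancel]; exact hy
          filter_upwards [h2] with z hz'
          have h3 := hsmall n x (hbx ▸ hr n) (x - z) hz'
          rw [sub_sub_cancel] at h3
          simp only [vn, h3, zero_smul]
        rw [h1.fderiv_eq, fderiv_const_apply]
      rw [this]
    · have hgx : g x = fderiv ℝ v x := indicator_of_mem (by exact hbx) _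
      rw [hgx]
      have h1 : Tendsto (fun n => ∫ y, (ψ n).normed volume y • fderiv ℝ v (x - y)) atTop
          (𝓝 (fderiv ℝ v x)) := by
        refine hx.congr fun n => ?_
        simp [convolution_def]
      have h2 := h1.sub_const (fderiv ℝ v x)
      rw [sub_self] at h2
      refine h2.congr' ?_
      have h3 : ∀ᶠ n in atTop, ε n < b x / 2 :=
        hεlim.eventually (gt_mem_nhds (half_pos hbx))
      filter_upwards [h3] with n hn
      congr 1
      refine integral_normed_smul_congr (ψ n) fun y hy => ?_
      have h4 : vn n =ᶠ[𝓝 (x - y)] fun z => v z - ε n • e := by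
        have h5 : ∀ᶠ z in 𝓝 (x - y), ‖x - z‖ < r n := by
          refine (isOpen_lt (by fun_prop) continuous_const).mem_nhds ?_
          change ‖x - (x - y)‖ < r n
          rw [sub_sub_cancel]; exact hy
        filter_upwards [h5] with z hz'
        have h6 := (abs_le.1 (hLb x z)).2
        have h7 : (L : ℝ) * ‖x - z‖ ≤ L * r n := mul_le_mul_of_nonneg_left hz'.le L.2
        have h8 := hrε n
        have h9 := hr n
        simp only [vn, bn, v, ← sub_smul]
        rw [max_eq_left (by linarith)]
      rw [h4.fderiv_eq, fderiv_sub_const]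

/-- The truncation argument needs a sign, so positive and negative parts are treated separately. -/
lemma memH10_of_bddLip {U : Set E} (hUb : Bornology.IsBounded U) {b : E → ℝ}
    (hb : BddLip b) (hz : ∀ x, x ∉ U → b x = 0) (e : E) : MemH10 U fun x => b x • e := by
  obtain ⟨⟨L, hL⟩, B, hB⟩ := id hb
  have hpart : ∀ s : ℝ, |s| ≤ 1 → BddLip fun x => max (s * b x) 0 := fun s hs => by
    obtain ⟨⟨C, hC⟩, -⟩ := (BddLip.const s).smul hb
    refine ⟨⟨C, ?_⟩, B, fun x => ?_⟩
    · simpa using hC.max_const 0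
    · rw [Real.norm_of_nonneg (le_max_right _ _)]
      refine max_le ((le_abs_self _).trans ?_) ((norm_nonneg _).trans (hB x))
      rw [abs_mul]
      exact (mul_le_of_le_one_left (abs_nonneg _) hs).trans (hB x)
  have h1 := memH10_of_nonneg hUb (hpart 1 (by simp)) (fun x => le_max_right _ _)
    (fun x hx => by simp [hz x hx]) e
  have h2 := memH10_of_nonneg hUb (hpart (-1) (by simp)) (fun x => le_max_right _ _)
    (fun x hx => by simp [hz x hx]) e
  have h3 := h1.add (h2.const_smul (-1))
  convert h3 using 2 with x
  rw [smul_smul, ← add_smul]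
  congr 1
  rcases le_total 0 (b x) with h | h
  · rw [max_eq_left (by linarith), max_eq_right (by linarith)]; ring
  · rw [max_eq_right (by linarith), max_eq_left (by linarith)]; ring

lemma BddLip.coord {v : E → E} (hv : BddLip v) (m : Fin 2) : BddLip fun x => v x m := by
  obtain ⟨⟨L, hL⟩, B, hB⟩ := hv
  refine ⟨⟨L, LipschitzWith.of_dist_le_mul fun x y => ?_⟩, B,
    fun x => (PiLp.norm_apply_le (v x) m).trans (hB x)⟩
  have h3 : dist (v x m) (v y m) ≤ dist (v x) (v y) := by
    simpa [dist_eq_norm] using PiLp.norm_apply_le (v x - v y) m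
  exact h3.trans (hL.dist_le_mul x y)

/-- The criterion by which all test velocities are admitted: no smoothness up to the boundary of `U`
is required, only a Lipschitz bound and zero values outside of `U`. -/
lemma BddLip.memH10 {U : Set E} (hUb : Bornology.IsBounded U) {v : E → E}
    (hv : BddLip v) (hz : ∀ x, x ∉ U → v x = 0) : MemH10 U v := by
  have h := (memH10_of_bddLip hUb (hv.coord 0) (fun x hx => by rw [hz x hx]; rfl)
    (EuclideanSpace.single 0 1)).add (memH10_of_bddLip hUb (hv.coord 1)
    (fun x hx => by rw [hz x hx]; rfl) (EuclideanSpace.single 1 1))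
  convert h using 2 with x
  ext m
  fin_cases m <;> simp

/-! ### Cyclic indices, and connectedness of a planar domain without finitely many points -/

lemma fin_three_ne_one (k : Fin 3) : k ≠ k + 1 := by revert k; decide
lemma fin_three_ne_two (k : Fin 3) : k ≠ k + 2 := by revert k; decide
lemma fin_three_one_ne_two (k : Fin 3) : k + 1 ≠ k + 2 := by revert k; decide

lemma forall_fin_three (k : Fin 3) {p : Fin 3 → Prop} (h0 : p k) (h1 : p (k + 1)) (h2 : p (k + 2))
    (m : Fin 3) : p m := by
  have : ∀ m k : Fin 3, m = k ∨ m = k + 1 ∨ m = k + 2 := by decide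
  rcases this m k with rfl | rfl | rfl <;> assumption

lemma sum_fin_three {V : Type*} [AddCommMonoid V] (k : Fin 3) (f : Fin 3 → V) :
    ∑ m, f m = f k + f (k + 1) + f (k + 2) := by
  rw [Fin.sum_univ_three]
  fin_cases k
  · rfl
  · change f 0 + f 1 + f 2 = f 1 + f 2 + f 0; abel
  · change f 0 + f 1 + f 2 = f 2 + f 0 + f 1; abel

/-- The point `z` removed from an open preconnected set of the plane leaves it preconnected. -/
lemma isPreconnected_diff_singleton {U : Set E} (hU : IsOpen U) (hc : IsPreconnected U) (z : E) :
    IsPreconnected (U \ {z}) := by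
  by_cases hz : z ∈ U
  swap
  · rwa [sdiff_singleton_eq_self hz]
  obtain ⟨r, hr, hball⟩ := Metric.isOpen_iff.1 hU z hz
  have hrank : 1 < Module.rank ℝ E := by
    rw [← Module.finrank_eq_rank, finrank_euclideanSpace_fin]; norm_num
  -- A punctured disc is the image of an interval times a circle under polar coordinates.
  have hpunct : IsPreconnected (Metric.ball z r \ {z}) := by
    have h1 : IsPreconnected (Ioo (0 : ℝ) r ×ˢ Metric.sphere (0 : E) 1) :=
      isPreconnected_Ioo.prod (isPreconnected_sphere hrank 0 1)
    have h2 := h1.image (fun p : ℝ × E => z + p.1 • p.2) (by fun_prop)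
    convert h2 using 1
    ext y
    simp only [Metric.mem_ball, Set.mem_sdiff, mem_singleton_iff, mem_image, mem_prod, mem_Ioo,
      mem_sphere_iff_norm, sub_zero, Prod.exists]
    constructor
    · rintro ⟨h3, h4⟩
      have h5 : 0 < ‖y - z‖ := norm_pos_iff.2 (sub_ne_zero.2 h4)
      refine ⟨‖y - z‖, ‖y - z‖⁻¹ • (y - z), ⟨⟨h5, by rwa [← dist_eq_norm]⟩, ?_⟩, ?_⟩
      · rw [norm_smul, norm_inv, norm_norm, inv_mul_cancel₀ h5.ne']
      · rw [smul_smul, mul_inv_cancel₀ h5.ne', one_smul, add_sub_cancel]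
    · rintro ⟨t, s, ⟨⟨h3, h4⟩, h5⟩, rfl⟩
      refine ⟨?_, fun h => ?_⟩
      · rw [dist_eq_norm, add_sub_cancel_left, norm_smul, h5, mul_one, Real.norm_of_nonneg h3.le]
        exact h4
      · rw [add_eq_left, smul_eq_zero] at h
        rcases h with h | h
        · exact h3.ne' h
        · rw [h, norm_zero] at h5; exact zero_ne_one h5
  -- Once one part of a separation contains the punctured disc, the point `z` can be added to it,
  -- which gives a separation of `U` itself.
  have key : ∀ u v : Set E, IsOpen u → IsOpen v → U \ {z} ⊆ u ∪ v → (U \ {z}) ∩ (u ∩ v) = ∅ →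
      Metric.ball z r \ {z} ⊆ u → U \ {z} ⊆ u := by
    intro u v hu hv huv hd hb
    rw [isPreconnected_iff_subset_of_disjoint] at hc
    have h1 := hc (u ∪ Metric.ball z r) (v \ {z}) (hu.union Metric.isOpen_ball)
      (hv.sdiff isClosed_singleton) ?_ ?_
    · rcases h1 with h1 | h1
      · rintro y ⟨hy, hyz⟩
        rcases h1 hy with h | h
        · exact h
        · exact hb ⟨h, hyz⟩
      · exact absurd rfl (h1 hz).2
    · intro y hy
      by_cases hyz : y = z
      · exact Or.inl (Or.inr (hyz ▸ Metric.mem_ball_self hr))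
      · rcases huv ⟨hy, hyz⟩ with h | h
        · exact Or.inl (Or.inl h)
        · exact Or.inr ⟨h, hyz⟩
    · rw [eq_empty_iff_forall_notMem] at hd ⊢
      rintro y ⟨hy, h2, h3, hyz⟩
      refine hd y ⟨⟨hy, hyz⟩, ?_, h3⟩
      rcases h2 with h | h
      · exact h
      · exact hb ⟨h, hyz⟩
  rw [isPreconnected_iff_subset_of_disjoint]
  intro u v hu hv huv hd
  have h1 := (isPreconnected_iff_subset_of_disjoint.1 hpunct) u v hu hv
    ((sdiff_subset_sdiff_left hball).trans huv)
    (subset_eq_empty (inter_subset_inter_left _ (sdiff_subset_sdiff_left hball)) hd)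
  rcases h1 with h1 | h1
  · exact Or.inl (key u v hu hv huv hd h1)
  · refine Or.inr (key v u hv hu (by rwa [union_comm]) (by rwa [inter_comm v u]) h1)

/-- Applied to the set of mesh vertices: paths between triangles can avoid the vertices, so they
have to cross edges. -/
lemma isPreconnected_diff_finite {U : Set E} (hU : IsOpen U) (hc : IsPreconnected U) {Z : Set E}
    (hZ : Z.Finite) : IsPreconnected (U \ Z) := by
  induction Z, hZ using Set.Finite.induction_on with
  | empty => simpa using hc
  | @insert z s hz hs ih =>
    have h1 : U \ insert z s = (U \ s) \ {z} := by
      rw [sdiff_sdiff, union_singleton]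
    rw [h1]
    exact isPreconnected_diff_singleton (hU.sdiff hs.isClosed) ih z

namespace AffineMesh

variable {ι : Type*} (M : AffineMesh ι)

/-! ### Barycentric coordinates on the triangles of the mesh -/

/-- The determinant of the affine element map. -/
def jac (i : ι) : ℝ := (M.vert i 0 - M.vert i 2) 0 * (M.vert i 1 - M.vert i 2) 1
      - (M.vert i 0 - M.vert i 2) 1 * (M.vert i 1 - M.vert i 2) 0

lemma jac_pos (i : ι) : 0 < M.jac i := M.orient i

/-- The linear part of the inverse of the affine element map. -/
def affInvLin (i : ι) : E →L[ℝ] E :=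
  (((M.vert i 1 - M.vert i 2) 1 / M.jac i) • coordL 0
      - ((M.vert i 1 - M.vert i 2) 0 / M.jac i) • coordL 1).smulRight (EuclideanSpace.single 0 1)
  + (((M.vert i 0 - M.vert i 2) 0 / M.jac i) • coordL 1
      - ((M.vert i 0 - M.vert i 2) 1 / M.jac i) • coordL 0).smulRight (EuclideanSpace.single 1 1)

/-- The inverse of the affine element map. -/
def affInv (i : ι) (y : E) : E := M.affInvLin i (y - M.vert i 2)

lemma affInv_zero (i : ι) (y : E) : M.affInv i y 0 =
    ((M.vert i 1 - M.vert i 2) 1 * (y - M.vert i 2) 0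
      - (M.vert i 1 - M.vert i 2) 0 * (y - M.vert i 2) 1) / M.jac i := by
  simp [affInv, affInvLin]; ring

lemma affInv_one (i : ι) (y : E) : M.affInv i y 1 =
    ((M.vert i 0 - M.vert i 2) 0 * (y - M.vert i 2) 1
      - (M.vert i 0 - M.vert i 2) 1 * (y - M.vert i 2) 0) / M.jac i := by
  simp [affInv, affInvLin]; ring

lemma lipschitz_affInv (i : ι) : ∃ C, LipschitzWith C (M.affInv i) :=
  ⟨_, (M.affInvLin i).lipschitz.comp (LipschitzWith.id.sub (LipschitzWith.const (M.vert i 2)))⟩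

lemma affMap_apply (i : ι) (x : E) (m : Fin 2) : M.affMap i x m =
    x 0 * M.vert i 0 m + x 1 * M.vert i 1 m + (1 - x 0 - x 1) * M.vert i 2 m := by
  simp [affMap, Fin.sum_univ_three]

@[simp] lemma affInv_affMap (i : ι) (x : E) : M.affInv i (M.affMap i x) = x := by
  have h := (M.jac_pos i).ne'
  ext m
  fin_cases m
  · change M.affInv i (M.affMap i x) 0 = x 0
    rw [affInv_zero, div_eq_iff h]
    simp only [PiLp.sub_apply, affMap_apply, jac]; ring
  · change M.affInv i (M.affMap i x) 1 = x 1
    rw [affInv_one, div_eq_iff h]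
    simp only [PiLp.sub_apply, affMap_apply, jac]; ring

@[simp] lemma affMap_affInv (i : ι) (y : E) : M.affMap i (M.affInv i y) = y := by
  have h := (M.jac_pos i).ne'
  have key : ∀ m, M.affMap i (M.affInv i y) m = M.vert i 2 m
      + M.affInv i y 0 * (M.vert i 0 - M.vert i 2) m
      + M.affInv i y 1 * (M.vert i 1 - M.vert i 2) m := fun m => by
    rw [affMap_apply]; simp only [PiLp.sub_apply]; ring
  ext m
  rw [key, affInv_zero, affInv_one]
  field_simp
  fin_cases m <;> simp only [jac, PiLp.sub_apply, Fin.zero_eta, Fin.mk_one] <;> ring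

lemma affMap_injective (i : ι) : Function.Injective (M.affMap i) :=
  Function.LeftInverse.injective (M.affInv_affMap i)

/-- The barycentric coordinates of the triangle `i`. -/
def lam (i : ι) (k : Fin 3) (y : E) : ℝ := bary k (M.affInv i y)

lemma lam_affMap (i : ι) (k : Fin 3) (x : E) : M.lam i k (M.affMap i x) = bary k x := by
  rw [lam, affInv_affMap]

lemma sum_lam (i : ι) (y : E) : ∑ k, M.lam i k y = 1 := sum_bary _

lemma sum_lam_smul (i : ι) (y : E) : ∑ k, M.lam i k y • M.vert i k = y := M.affMap_affInv i y

lemma affMap_ctVert (i : ι) (k : Fin 3) : M.affMap i (ctVert k.castSucc) = M.vert i k := by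
  simp [affMap, bary_ctVert]

lemma lam_vert (i : ι) (k m : Fin 3) : M.lam i k (M.vert i m) = if k = m then 1 else 0 := by
  rw [← affMap_ctVert, lam_affMap, bary_ctVert]

lemma lam_vert_self (i : ι) (k : Fin 3) : M.lam i k (M.vert i k) = 1 := by simp [lam_vert]

lemma lipschitz_lam (i : ι) (k : Fin 3) : ∃ C, LipschitzWith C (M.lam i k) := by
  obtain ⟨C, hC⟩ := M.lipschitz_affInv i
  obtain ⟨D, hD⟩ := lipschitz_bary k
  exact ⟨_, hD.comp hC⟩

lemma continuous_lam (i : ι) (k : Fin 3) : Continuous (M.lam i k) := by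
  obtain ⟨C, hC⟩ := M.lipschitz_lam i k
  exact hC.continuous

lemma affInv_combo (i : ι) (x y : E) {a b : ℝ} (hab : a + b = 1) :
    M.affInv i (a • x + b • y) = a • M.affInv i x + b • M.affInv i y := by
  obtain rfl : b = 1 - a := by linarith
  simp only [affInv, ← map_smul, ← map_add]
  congr 1
  module

lemma lam_combo (i : ι) (k : Fin 3) (x y : E) {a b : ℝ} (hab : a + b = 1) :
    M.lam i k (a • x + b • y) = a * M.lam i k x + b * M.lam i k y := by
  rw [lam, affInv_combo _ _ _ _ hab, bary_combo _ _ _ hab]; rfl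

/-- The coordinate is an affine function, hence determined by its values at the vertices of any
triangle. -/
lemma lam_eq_sum (i j : ι) (k : Fin 3) (y : E) :
    M.lam i k y = ∑ m, M.lam j m y * M.lam i k (M.vert j m) := by
  have h : ∃ a b c : ℝ, ∀ z : E, M.lam i k z = a + b * z 0 + c * z 1 := by
    have h0 : ∃ a b c : ℝ, ∀ z : E, M.affInv i z 0 = a + b * z 0 + c * z 1 := by
      refine ⟨((M.vert i 1 - M.vert i 2) 1 * (- M.vert i 2 0)
        + (M.vert i 1 - M.vert i 2) 0 * (M.vert i 2 1)) / M.jac i,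
        (M.vert i 1 - M.vert i 2) 1 / M.jac i, - (M.vert i 1 - M.vert i 2) 0 / M.jac i,
        fun z => ?_⟩
      rw [affInv_zero]; simp only [PiLp.sub_apply]; ring
    have h1 : ∃ a b c : ℝ, ∀ z : E, M.affInv i z 1 = a + b * z 0 + c * z 1 := by
      refine ⟨((M.vert i 0 - M.vert i 2) 1 * (M.vert i 2 0)
        - (M.vert i 0 - M.vert i 2) 0 * (M.vert i 2 1)) / M.jac i,
        - (M.vert i 0 - M.vert i 2) 1 / M.jac i, (M.vert i 0 - M.vert i 2) 0 / M.jac i,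
        fun z => ?_⟩
      rw [affInv_one]; simp only [PiLp.sub_apply]; ring
    obtain ⟨a, b, c, h0⟩ := h0
    obtain ⟨a', b', c', h1⟩ := h1
    fin_cases k
    · exact ⟨a, b, c, h0⟩
    · exact ⟨a', b', c', h1⟩
    · refine ⟨1 - a - a', -b - b', -c - c', fun z => ?_⟩
      change 1 - M.affInv i z 0 - M.affInv i z 1 = _
      rw [h0, h1]; ring
  obtain ⟨a, b, c, h⟩ := h
  have h1 := M.sum_lam j y
  have h2 := M.sum_lam_smul j y
  have e0 : y 0 = ∑ m, M.lam j m y * M.vert j m 0 := by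
    conv_lhs => rw [← h2]
    simp
  have e1 : y 1 = ∑ m, M.lam j m y * M.vert j m 1 := by
    conv_lhs => rw [← h2]
    simp
  simp only [h, e0, e1, mul_add, Finset.sum_add_distrib, ← Finset.sum_mul, h1, one_mul,
    Finset.mul_sum]
  congr 1
  · congr 1
    exact Finset.sum_congr rfl fun m _ => by ring
  · exact Finset.sum_congr rfl fun m _ => by ring

/-- The closed triangle `i`. -/
abbrev tri (i : ι) : Set E := convexHull ℝ (range (M.vert i))

lemma mem_tri {i : ι} {y : E} : y ∈ M.tri i ↔ ∀ k, 0 ≤ M.lam i k y := by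
  constructor
  · intro h
    have hc : Convex ℝ {y : E | ∀ k, 0 ≤ M.lam i k y} := by
      intro x hx y hy a b ha hb hab k
      rw [lam_combo _ _ _ _ _ hab]
      exact add_nonneg (mul_nonneg ha (hx k)) (mul_nonneg hb (hy k))
    refine convexHull_min ?_ hc h
    rintro _ ⟨m, rfl⟩ k
    rw [lam_vert]; split_ifs <;> norm_num
  · intro h
    rw [← M.sum_lam_smul i y]
    exact (convex_convexHull ℝ _).sum_mem (fun k _ => h k) (M.sum_lam i y)
      fun k _ => subset_convexHull ℝ _ ⟨k, rfl⟩

lemma affMap_mem_tri {i : ι} {x : E} (hx : x ∈ refTri) : M.affMap i x ∈ M.tri i :=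
  M.mem_tri.2 fun k => by rw [lam_affMap]; exact mem_refTri.1 hx k

lemma affInv_mem_refTri {i : ι} {y : E} (hy : y ∈ M.tri i) : M.affInv i y ∈ refTri :=
  mem_refTri.2 (M.mem_tri.1 hy)

/-- By conformity a common point is a convex combination of common vertices, and the `k`-th
coordinate vanishes at all of them. -/
lemma lam_eq_zero_of_mem_inter {i j : ι} (hij : i ≠ j) {y : E} (hi : y ∈ M.tri i)
    (hj : y ∈ M.tri j) {k : Fin 3} (hk : M.vert i k ∉ range (M.vert j)) : M.lam i k y = 0 := by
  have h1 : y ∈ convexHull ℝ (range (M.vert i) ∩ range (M.vert j)) := by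
    rw [← M.conforming i j hij]; exact ⟨hi, hj⟩
  have hc : Convex ℝ {y : E | M.lam i k y = 0} := by
    intro x hx y hy a b ha hb hab
    simp only [mem_ofPred_eq] at *
    rw [lam_combo _ _ _ _ _ hab, hx, hy]; simp
  refine convexHull_min ?_ hc h1
  rintro _ ⟨⟨m, rfl⟩, h2⟩
  have : k ≠ m := fun h => hk (h ▸ h2)
  simp [lam_vert, this]

lemma vert_injective (i : ι) : Function.Injective (M.vert i) := by
  intro k m h
  have h1 := M.lam_vert i k m
  rw [← h, lam_vert_self] at h1
  by_contra hne
  simp [hne] at h1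

lemma exists_vert_notMem {i j : ι} (hij : i ≠ j) : ∃ k, M.vert i k ∉ range (M.vert j) := by
  by_contra h
  push Not at h
  have h1 : range (M.vert i) ⊆ range (M.vert j) := by
    rintro _ ⟨k, rfl⟩; exact h k
  have h2 : ∀ i, (range (M.vert i)).ncard = 3 := fun i => by
    rw [← image_univ, ncard_image_of_injective _ (M.vert_injective i), ncard_univ]; simp
  exact hij (M.inj (eq_of_subset_of_ncard_le h1 (by rw [h2, h2]) (finite_range _)))

/-- If the triangles were different, some vertex of `i` would not be a vertex of `j`, and its
coordinate would vanish at the common point. -/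
lemma eq_of_pos {i j : ι} {y : E} (hi : ∀ k, 0 < M.lam i k y) (hj : y ∈ M.tri j) : i = j := by
  by_contra hij
  obtain ⟨k, hk⟩ := M.exists_vert_notMem hij
  have := M.lam_eq_zero_of_mem_inter hij (M.mem_tri.2 fun k => (hi k).le) hj hk
  exact (hi k).ne' this

lemma mem_domain_of_isOpen {W : Set E} (hW : IsOpen W) (h : W ⊆ ⋃ i, M.tri i) : W ⊆ M.domain :=
  hW.subset_interior_iff.2 h

lemma isOpen_pos (i : ι) : IsOpen {y | ∀ k, 0 < M.lam i k y} := by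
  have : {y | ∀ k, 0 < M.lam i k y} = ⋂ k, {y | 0 < M.lam i k y} := by ext; simp
  rw [this]
  exact isOpen_iInter_of_finite fun k => isOpen_lt continuous_const (M.continuous_lam i k)

lemma mem_domain_of_pos {i : ι} {y : E} (h : ∀ k, 0 < M.lam i k y) : y ∈ M.domain :=
  M.mem_domain_of_isOpen (M.isOpen_pos i)
    (fun _ hz => mem_iUnion.2 ⟨i, M.mem_tri.2 fun k => (hz k).le⟩) h

lemma domain_isOpen : IsOpen M.domain := isOpen_interior

lemma tri_isCompact (i : ι) : IsCompact (M.tri i) :=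
  (finite_range _).isCompact_convexHull (𝕜 := ℝ)

lemma domain_bounded [Finite ι] : Bornology.IsBounded M.domain :=
  (isCompact_iUnion fun i => M.tri_isCompact i).isBounded.subset interior_subset

lemma domain_nonempty : M.domain.Nonempty := M.connected.nonempty

/-! ### Neighbouring triangles -/

/-- The edges `k` of `i` and `l` of `j` coincide. -/
def SharesEdge (i j : ι) (k l : Fin 3) : Prop :=
  i ≠ j ∧ M.vert i (k + 1) = M.vert j (l + 2) ∧ M.vert i (k + 2) = M.vert j (l + 1)

/-- Two triangles with a common edge lie on opposite sides of it. Otherwise a point near the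
midpoint of the edge would be in both, with a positive coordinate for a vertex that is not shared.
Since `lam i k` vanishes on the common edge, it is a multiple of `lam j l`. -/
lemma lam_opposite_aux {i j : ι} (hij : i ≠ j) {k l : Fin 3}
    (h1 : M.vert i (k + 1) ∈ range (M.vert j)) (h2 : M.vert i (k + 2) ∈ range (M.vert j))
    (hl : ∀ m, m ≠ l → M.vert j m = M.vert i (k + 1) ∨ M.vert j m = M.vert i (k + 2)) :
    M.lam i k (M.vert j l) < 0 ∧ ∀ y, M.lam i k y = M.lam i k (M.vert j l) * M.lam j l y := by
  have hk1 := fin_three_ne_one k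
  have hk2 := fin_three_ne_two k
  have hzero : ∀ m, m ≠ l → M.lam i k (M.vert j m) = 0 := by
    intro m hm
    rcases hl m hm with h | h <;> rw [h, lam_vert]
    · simp [hk1]
    · simp [hk2]
  have hlin : ∀ y, M.lam i k y = M.lam i k (M.vert j l) * M.lam j l y := by
    intro y
    rw [M.lam_eq_sum i j k y, Finset.sum_eq_single l]
    · ring
    · intro m _ hm; rw [hzero m hm, mul_zero]
    · simp
  refine ⟨?_, hlin⟩
  have hkn : M.vert i k ∉ range (M.vert j) := by
    intro h
    obtain ⟨m, hm⟩ := M.exists_vert_notMem hij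
    exact hm (forall_fin_three k (p := fun m => M.vert i m ∈ range (M.vert j)) h h1 h2 m)
  by_contra hneg
  rw [not_lt] at hneg
  rcases hneg.eq_or_lt with h0 | hpos
  · have := hlin (M.vert i k)
    rw [← h0, lam_vert_self] at this; simp at this
  set A := M.lam i (k + 1) (M.vert j l)
  set B := M.lam i (k + 2) (M.vert j l)
  -- The step from the midpoint `p` towards the third vertex of `j` is so short that the coordinates
  -- at the ends of the edge stay nonnegative: `(1 - t) / 2 = t * (|A| + |B|)`.
  let t : ℝ := 1 / (1 + 2 * |A| + 2 * |B|)
  have hden : 0 < 1 + 2 * |A| + 2 * |B| := by positivity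
  have ht : 0 < t := by positivity
  have htA : t * (1 + 2 * |A| + 2 * |B|) = 1 := by simp only [t]; field_simp
  have ht1 : t ≤ 1 := by
    have := mul_nonneg ht.le (abs_nonneg A); have := mul_nonneg ht.le (abs_nonneg B)
    nlinarith
  let p : E := (1 / 2 : ℝ) • M.vert i (k + 1) + (1 / 2 : ℝ) • M.vert i (k + 2)
  let y : E := (1 - t) • p + t • M.vert j l
  have hp : ∀ m, M.lam i m p = 1 / 2 * M.lam i m (M.vert i (k + 1))
      + 1 / 2 * M.lam i m (M.vert i (k + 2)) := fun m => M.lam_combo i m _ _ (by norm_num)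
  have hy : ∀ m, M.lam i m y = (1 - t) * M.lam i m p + t * M.lam i m (M.vert j l) :=
    fun m => M.lam_combo i m _ _ (by ring)
  have hk12 := fin_three_one_ne_two k
  have hyk : M.lam i k y = t * M.lam i k (M.vert j l) := by
    rw [hy, hp]; simp [lam_vert, hk1, hk2]
  have hyi : y ∈ M.tri i := by
    refine M.mem_tri.2 (forall_fin_three k ?_ ?_ ?_)
    · rw [hyk]; positivity
    · rw [hy, hp]; simp only [lam_vert, if_true, hk12, if_false]
      change 0 ≤ (1 - t) * (1 / 2 * 1 + 1 / 2 * 0) + t * A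
      have h3 := mul_le_mul_of_nonneg_left (neg_abs_le A) ht.le
      have h4 := mul_nonneg ht.le (abs_nonneg B)
      nlinarith
    · rw [hy, hp]; simp only [lam_vert, if_true, hk12.symm, if_false]
      change 0 ≤ (1 - t) * (1 / 2 * 0 + 1 / 2 * 1) + t * B
      have h3 := mul_le_mul_of_nonneg_left (neg_abs_le B) ht.le
      have h4 := mul_nonneg ht.le (abs_nonneg A)
      nlinarith
  have hyj : y ∈ M.tri j := by
    have hcv := convex_convexHull ℝ (range (M.vert j))
    refine hcv (hcv (subset_convexHull ℝ _ h1) (subset_convexHull ℝ _ h2) (by norm_num)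
      (by norm_num) (by norm_num)) (subset_convexHull ℝ _ ⟨l, rfl⟩) (by linarith) ht.le (by ring)
  have h5 := M.lam_eq_zero_of_mem_inter hij hyi hyj hkn
  rw [hyk] at h5
  exact (mul_pos ht hpos).ne' h5

/-- Both sides are twice the signed area of the triangle spanned by the edge and `y`. This form
depends on the direction of the edge, so it detects orientation. -/
lemma jac_mul_lam (i : ι) (k : Fin 3) (y : E) : M.jac i * M.lam i k y =
    (M.vert i (k + 2) - M.vert i (k + 1)) 0 * (y - M.vert i (k + 1)) 1
      - (M.vert i (k + 2) - M.vert i (k + 1)) 1 * (y - M.vert i (k + 1)) 0 := by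
  have h0 := (eq_div_iff (M.jac_pos i).ne').1 (M.affInv_zero i y)
  have h1 := (eq_div_iff (M.jac_pos i).ne').1 (M.affInv_one i y)
  rw [mul_comm] at h0 h1
  simp only [PiLp.sub_apply] at h0 h1 ⊢
  fin_cases k
  · change M.jac i * M.affInv i y 0 = (M.vert i 2 0 - M.vert i 1 0) * (y 1 - M.vert i 1 1)
      - (M.vert i 2 1 - M.vert i 1 1) * (y 0 - M.vert i 1 0)
    rw [h0]; ring
  · change M.jac i * M.affInv i y 1 = (M.vert i 0 0 - M.vert i 2 0) * (y 1 - M.vert i 2 1)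
      - (M.vert i 0 1 - M.vert i 2 1) * (y 0 - M.vert i 2 0)
    rw [h1]
  · change M.jac i * (1 - M.affInv i y 0 - M.affInv i y 1)
      = (M.vert i 1 0 - M.vert i 0 0) * (y 1 - M.vert i 0 1)
      - (M.vert i 1 1 - M.vert i 0 1) * (y 0 - M.vert i 0 0)
    rw [mul_sub, mul_sub, h0, h1]; simp only [jac, PiLp.sub_apply]; ring

/-- Two triangles with two common vertices share an edge, with opposite orientations. -/
lemma exists_sharesEdge {i j : ι} (hij : i ≠ j) {p q : E} (hpq : p ≠ q)
    (hp : p ∈ range (M.vert i) ∩ range (M.vert j)) (hq : q ∈ range (M.vert i) ∩ range (M.vert j)) :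
    ∃ k l, M.SharesEdge i j k l := by
  have hfin : ∀ a b : Fin 3, a ≠ b → ∃ k, (a = k + 1 ∧ b = k + 2) ∨ (a = k + 2 ∧ b = k + 1) := by
    decide
  obtain ⟨⟨a, rfl⟩, c, hc⟩ := hp
  obtain ⟨⟨b, rfl⟩, d, hd⟩ := hq
  have hab : a ≠ b := fun h => hpq (by rw [h])
  have hcd : c ≠ d := fun h => hpq (by rw [← hc, ← hd, h])
  have main : ∀ k c d, c ≠ d → M.vert j c = M.vert i (k + 1) → M.vert j d = M.vert i (k + 2) →
      ∃ k l, M.SharesEdge i j k l := by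
    intro k c d hcd hc hd
    obtain ⟨l, ⟨rfl, rfl⟩ | ⟨rfl, rfl⟩⟩ := hfin c d hcd
    -- If both triangles ran through the edge in the same direction, the signed area of `j` would be
    -- computed from the edge of `i`. It is positive by orientation, but the third vertex of `j`
    -- lies on the negative side.
    · exfalso
      have h1 := (M.lam_opposite_aux hij (k := k) (l := l) ⟨_, hc⟩ ⟨_, hd⟩
        (forall_fin_three l (fun h => absurd rfl h) (fun _ => Or.inl hc) (fun _ => Or.inr hd))).1
      have h2 := M.jac_mul_lam i k (M.vert j l)
      rw [← hc, ← hd, ← M.jac_mul_lam j l, lam_vert_self, mul_one] at h2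
      have := M.jac_pos i
      have := M.jac_pos j
      nlinarith
    · exact ⟨k, l, hij, hc.symm, hd.symm⟩
  obtain ⟨k, ⟨rfl, rfl⟩ | ⟨rfl, rfl⟩⟩ := hfin a b hab
  · exact main k c d hcd hc hd
  · exact main k d c hcd.symm hd hc

lemma SharesEdge.symm {M : AffineMesh ι} {i j : ι} {k l : Fin 3} (h : M.SharesEdge i j k l) :
    M.SharesEdge j i l k := ⟨h.1.symm, h.2.2.symm, h.2.1.symm⟩

lemma SharesEdge.lam_opposite {M : AffineMesh ι} {i j : ι} {k l : Fin 3}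
    (h : M.SharesEdge i j k l) :
    M.lam i k (M.vert j l) < 0 ∧ ∀ y, M.lam i k y = M.lam i k (M.vert j l) * M.lam j l y :=
  M.lam_opposite_aux h.1 ⟨_, h.2.1.symm⟩ ⟨_, h.2.2.symm⟩
    (forall_fin_three l (fun h => absurd rfl h) (fun _ => Or.inr h.2.2.symm)
      (fun _ => Or.inl h.2.1.symm))

/-- At most two triangles share an edge. -/
lemma SharesEdge.eq_or_eq {M : AffineMesh ι} {i j : ι} {k l : Fin 3} (h : M.SharesEdge i j k l)
    {m : ι} (h1 : M.vert i (k + 1) ∈ range (M.vert m)) (h2 : M.vert i (k + 2) ∈ range (M.vert m)) :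
    m = i ∨ m = j := by
  by_contra hne
  push Not at hne
  obtain ⟨hmi, hmj⟩ := hne
  obtain ⟨a, ha⟩ := h1
  obtain ⟨b, hb⟩ := h2
  have hk12 := fin_three_one_ne_two k
  have hab : a ≠ b := fun hab => hk12 (M.vert_injective i (by rw [← ha, ← hb, hab]))
  have hfin : ∀ a b : Fin 3, a ≠ b → ∃ c, ∀ m, m ≠ c → m = a ∨ m = b := by decide
  obtain ⟨c, hc⟩ := hfin a b hab
  have h3 := (M.lam_opposite_aux hmi.symm (k := k) (l := c) ⟨a, ha⟩ ⟨b, hb⟩ fun m hm => by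
    rcases hc m hm with rfl | rfl
    · exact Or.inl ha
    · exact Or.inr hb).1
  have h4 := (M.lam_opposite_aux hmj.symm (k := l) (l := c) ⟨b, hb.trans h.2.2⟩
    ⟨a, ha.trans h.2.1⟩ fun m hm => by
    rcases hc m hm with rfl | rfl
    · exact Or.inr (ha.trans h.2.1)
    · exact Or.inl (hb.trans h.2.2)).1
  -- The third vertex of `m` would lie opposite to `i` and opposite to `j`, although `i` and `j` are
  -- themselves on opposite sides.
  have h5 := h.lam_opposite
  have h6 := h5.2 (M.vert m c)
  have := mul_pos_of_neg_of_neg h5.1 h4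
  linarith

/-- The triangles are connected through edges. -/
lemma eq_of_sharesEdge [Finite ι] {α : Type*} (c : ι → α)
    (h : ∀ i j k l, M.SharesEdge i j k l → c i = c j) (i j : ι) : c i = c j := by
  by_contra hne
  -- Triangles with the value of `i` and all other triangles form two closed sets that cover the
  -- domain.
  let A : Set E := ⋃ m : {m // c m = c i}, M.tri m
  let B : Set E := ⋃ m : {m // c m ≠ c i}, M.tri m
  let Z : Set E := ⋃ m, range (M.vert m)
  have hA : IsClosed A := (isCompact_iUnion fun m => M.tri_isCompact _).isClosed
  have hB : IsClosed B := (isCompact_iUnion fun m => M.tri_isCompact _).isClosed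
  have hZ : Z.Finite := finite_iUnion fun m => finite_range _
  have hpre := isPreconnected_diff_finite M.domain_isOpen M.connected.isPreconnected hZ
  have hcov : M.domain \ Z ⊆ A ∪ B := by
    rintro y ⟨hy, -⟩
    obtain ⟨m, hm⟩ := mem_iUnion.1 (interior_subset hy)
    by_cases hc : c m = c i
    · exact Or.inl (mem_iUnion.2 ⟨⟨m, hc⟩, hm⟩)
    · exact Or.inr (mem_iUnion.2 ⟨⟨m, hc⟩, hm⟩)
  have hpt : ∀ m, ∃ y ∈ M.domain \ Z, y ∈ M.tri m := by
    intro m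
    obtain ⟨x, hx⟩ := ctPiece_nonempty 0
    have hpos : ∀ k, 0 < M.lam m k (M.affMap m x) := fun k => by
      rw [lam_affMap]; exact ctPiece_pos hx k
    refine ⟨M.affMap m x, ⟨M.mem_domain_of_pos hpos, fun hz => ?_⟩,
      M.affMap_mem_tri (ctPiece_subset_refTri 0 hx)⟩
    obtain ⟨n, k, hk⟩ := mem_iUnion.1 hz
    have hmn : m = n := M.eq_of_pos hpos (by rw [← hk]; exact subset_convexHull ℝ _ ⟨k, rfl⟩)
    subst hmn
    have := hpos (k + 1)
    rw [← hk, lam_vert] at this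
    have hk1 := (fin_three_ne_one k).symm
    simp [hk1] at this
  obtain ⟨y, hy1, hy2⟩ := hpt i
  obtain ⟨z, hz1, hz2⟩ := hpt j
  -- Connectedness without the vertices gives a non-vertex `w` in two triangles with different
  -- values. These share no edge, so by conformity they meet in at most one vertex, which excludes
  -- `w`.
  obtain ⟨w, hw, hwA, hwB⟩ := isPreconnected_closed_iff.1 hpre A B hA hB hcov
    ⟨y, hy1, mem_iUnion.2 ⟨⟨i, rfl⟩, hy2⟩⟩ ⟨z, hz1, mem_iUnion.2 ⟨⟨j, Ne.symm hne⟩, hz2⟩⟩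
  obtain ⟨⟨m, hm⟩, hwm⟩ := mem_iUnion.1 hwA
  obtain ⟨⟨n, hn⟩, hwn⟩ := mem_iUnion.1 hwB
  have hmn : m ≠ n := fun h => hn (h ▸ hm)
  have hw' : w ∈ convexHull ℝ (range (M.vert m) ∩ range (M.vert n)) := by
    rw [← M.conforming m n hmn]; exact ⟨hwm, hwn⟩
  have hsub : (range (M.vert m) ∩ range (M.vert n)).Subsingleton := by
    intro p hp q hq
    by_contra hpq
    obtain ⟨k, l, hs⟩ := M.exists_sharesEdge hmn hpq hp hq
    exact hn ((h _ _ _ _ hs).symm.trans hm)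
  rcases hsub.eq_empty_or_singleton with h0 | ⟨p, hp⟩
  · rw [h0, convexHull_empty] at hw'; exact hw'
  · have hpm : p ∈ range (M.vert m) := by
      have : p ∈ range (M.vert m) ∩ range (M.vert n) := hp ▸ mem_singleton p
      exact this.1
    rw [hp, convexHull_singleton, mem_singleton_iff] at hw'
    exact hw.2 (mem_iUnion.2 ⟨m, hw' ▸ hpm⟩)

end AffineMesh

/-! ### Nodal data of edge bubbles and of fields interior to one element -/

lemma memLp_fun_zero {V : Type*} [NormedAddCommGroup V] {μ : Measure E} :
    MemLp (fun _ : E => (0 : V)) 2 μ := MemLp.zero'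

lemma eLpNorm_fun_zero {V : Type*} [NormedAddCommGroup V] {μ : Measure E} :
    eLpNorm (fun _ : E => (0 : V)) 2 μ = 0 := eLpNorm_zero'

lemma zero_mem_refVel : (fun _ => 0 : E → E) ∈ refVel :=
  mem_refVel_iff.2 fun _ _ => ⟨0, by simp, fun x _ => by simp⟩

lemma refVel_add {v w : E → E} (hv : v ∈ refVel) (hw : w ∈ refVel) :
    (fun x => v x + w x) ∈ refVel := by
  rw [mem_refVel_iff] at *
  exact fun i j => (hv i j).add (hw i j)

lemma refVel_smul {v : E → E} (hv : v ∈ refVel) (r : ℝ) : (fun x => r • v x) ∈ refVel := by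
  rw [mem_refVel_iff] at *
  exact fun i j => (hv i j).const_mul r

/-- Nodal values that are `e` at the midpoint of the edge `k` of the reference triangle and zero
otherwise. -/
def edgeData (k : Fin 3) (e : E) (a b : Fin 4) : E :=
  if (a = (k + 1).castSucc ∧ b = (k + 2).castSucc) ∨ (a = (k + 2).castSucc ∧ b = (k + 1).castSucc)
  then e else 0

lemma edgeData_symm (k : Fin 3) (e : E) (a b : Fin 4) : edgeData k e a b = edgeData k e b a := by
  unfold edgeData
  congr 1
  apply propext
  tauto

lemma interp_edgeData (j k : Fin 3) (e x : E) : interp j (edgeData k e) x =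
    (4 * (ctHat j (k + 1).castSucc x * ctHat j (k + 2).castSucc x)) • e := by
  have h : ∀ h : Fin 4 → ℝ, quadInterp h (edgeData k e) =
      (4 * (h (k + 1).castSucc * h (k + 2).castSucc)) • e := by
    intro h
    fin_cases k <;> simp [quadInterp, edgeData, Fin.sum_univ_four] <;> module
  exact h _

/-- On the triangle at the edge both factors are its local coordinates; on each of the other two,
one truncated factor vanishes. The single product formula is what is later glued to its mirror image
across the edge. -/
lemma ginterp_edgeData (k : Fin 3) (e : E) {x : E} (hx : x ∈ refTri) : ginterp (edgeData k e) x =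
    (4 * (clamp (bary (k + 1) x - bary k x) * clamp (bary (k + 2) x - bary k x))) • e := by
  obtain ⟨j, hj⟩ := exists_mem_ctTri hx
  rw [ginterp_eq_interp hj, interp_edgeData]
  have h := mem_ctTri.1 hj
  have h0 : ∀ m, 0 ≤ bary m x - bary j x := fun m => by
    have := h m.castSucc; rwa [ctHat_castSucc] at this
  have hb := mem_refTri.1 hx
  have hs := sum_bary x
  rw [sum_fin_three k] at hs
  simp only [ctHat_castSucc]
  congr 2
  refine forall_fin_three k (p := fun j => (∀ m, 0 ≤ bary m x - bary j x) →
    (bary (k + 1) x - bary j x) * (bary (k + 2) x - bary j x)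
      = clamp (bary (k + 1) x - bary k x) * clamp (bary (k + 2) x - bary k x)) ?_ ?_ ?_ j h0
  · intro h0
    rw [clamp_of_mem (h0 _), clamp_of_mem (h0 _)]
    · linarith [hb k, hb (k + 1)]
    · linarith [hb k, hb (k + 2)]
  · intro h0
    rw [clamp_of_nonpos (t := bary (k + 1) x - bary k x) (by linarith [h0 k]), sub_self]; simp
  · intro h0
    rw [clamp_of_nonpos (t := bary (k + 2) x - bary k x) (by linarith [h0 k]), sub_self]; simp

/-- Nodal values that vanish on the boundary of the reference triangle. -/
def IsInteriorData (ξ : Fin 4 → Fin 4 → E) : Prop :=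
  (∀ k l, ξ k l = ξ l k) ∧ ∀ k l, k ≠ 3 → l ≠ 3 → ξ k l = 0

lemma ginterp_eq_zero {ξ : Fin 4 → Fin 4 → E} (hξ : IsInteriorData ξ) {x : E}
    (hx : gHat 3 x = 0) : ginterp ξ x = 0 := by
  unfold ginterp quadInterp
  have h1 : ∀ k l, (gHat k x * gHat l x) • ξ k l = 0 := by
    intro k l
    by_cases hk : k = 3
    · rw [hk, hx, zero_mul, zero_smul]
    by_cases hl : l = 3
    · rw [hl, hx, mul_zero, zero_smul]
    rw [hξ.2 k l hk hl, smul_zero]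
  have h2 : ∀ k, gHat k x • ξ k k = 0 := by
    intro k
    by_cases hk : k = 3
    · rw [hk, hx, zero_smul]
    rw [hξ.2 k k hk hk, smul_zero]
  simp [h1, h2]

lemma pos_of_gHat_three_ne {x : E} (hx : gHat 3 x ≠ 0) (k : Fin 3) : 0 < bary k x := by
  have h : 0 < baryMin x := by
    by_contra h
    exact hx (clamp_of_nonpos (by simp; linarith))
  refine h.trans_le ?_
  fin_cases k
  · exact min_le_left _ _
  · exact (min_le_right _ _).trans (min_le_left _ _)
  · exact (min_le_right _ _).trans (min_le_right _ _)

namespace AffineMesh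

variable {ι : Type*} (M : AffineMesh ι)

/-! ### The finite element spaces in terms of nodal values and coefficients -/

/-- The nodal values of the velocities on the affine mesh. -/
def velData : Submodule ℝ (ι → Fin 4 → Fin 4 → E) where
  carrier := {x | ∃ v ∈ M.vel, ∀ i k l, x i k l = v (M.affMap i (node k l))}
  add_mem' := by
    rintro x y ⟨v, ⟨hv0, hv⟩, hx⟩ ⟨w, ⟨hw0, hw⟩, hy⟩
    refine ⟨fun z => v z + w z, ⟨hv0.add hw0, fun i => ?_⟩, fun i k l => by
      simp only [Pi.add_apply, hx, hy]⟩
    obtain ⟨a, ha, ha'⟩ := hv i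
    obtain ⟨b, hb, hb'⟩ := hw i
    exact ⟨_, refVel_add ha hb, fun x hx => by simp only [ha' x hx, hb' x hx]⟩
  zero_mem' := by
    refine ⟨fun _ => 0, ⟨?_, fun i => ⟨_, zero_mem_refVel, fun _ _ => rfl⟩⟩, fun i k l => rfl⟩
    refine ⟨MemLp.zero', fun _ => 0, memLp_fun_zero, fun _ _ => 0, fun _ => ⟨contDiff_const, ?_, ?_⟩,
      ?_, ?_⟩
    · exact HasCompactSupport.zero
    · have h : tsupport (fun _ : E => (0 : E)) = ∅ := tsupport_eq_empty_iff.2 rfl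
      rw [h]; exact empty_subset _
    · simp only [sub_zero, eLpNorm_zero']; exact tendsto_const_nhds
    · have h : ∀ x : E, fderiv ℝ (fun _ : E => (0 : E)) x - 0 = 0 := fun x => by
        rw [fderiv_const_apply, sub_zero]
      simp only [h]
      simp only [eLpNorm_fun_zero]; exact tendsto_const_nhds
  smul_mem' := by
    rintro r x ⟨v, ⟨hv0, hv⟩, hx⟩
    refine ⟨fun z => r • v z, ⟨hv0.const_smul r, fun i => ?_⟩, fun i k l => by
      simp only [Pi.smul_apply, hx]⟩
    obtain ⟨a, ha, ha'⟩ := hv i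
    exact ⟨_, refVel_smul ha r, fun x hx => by simp only [ha' x hx]⟩

lemma velData_symm {x : ι → Fin 4 → Fin 4 → E} (hx : x ∈ M.velData) (i : ι) (k l : Fin 4) :
    x i k l = x i l k := by
  obtain ⟨v, -, hv⟩ := hx
  rw [hv, hv, node_comm]

/-- The coefficients of the pressures on the affine mesh. -/
def presData [Finite ι] : Submodule ℝ (ι → Fin 3 → Fin 3 → ℝ) where
  carrier := {y | ∃ q ∈ M.pres, ∀ i j, ∀ x ∈ ctPiece j,
    q (M.affMap i x) = y i j 0 + y i j 1 * x 0 + y i j 2 * x 1}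
  add_mem' := by
    rintro x y ⟨v, ⟨hv0, hv⟩, hx⟩ ⟨w, ⟨hw0, hw⟩, hy⟩
    refine ⟨fun z => v z + w z, ⟨⟨hv0.1.add hw0.1, ?_⟩, fun i => ?_⟩, fun i j z hz => by
      simp only [Pi.add_apply, hx i j z hz, hy i j z hz]; ring⟩
    · have : IsFiniteMeasure (volume.restrict M.domain) := by
        exact ⟨by rw [Measure.restrict_apply_univ]; exact M.domain_bounded.measure_lt_top⟩
      rw [integral_add (hv0.1.integrable one_le_two) (hw0.1.integrable one_le_two), hv0.2, hw0.2,
        add_zero]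
    · obtain ⟨a, ha, ha'⟩ := hv i
      obtain ⟨b, hb, hb'⟩ := hw i
      exact ⟨_, fun i => (ha i).add (hb i), fun x hx => by simp only [ha' x hx, hb' x hx]⟩
  zero_mem' := by
    refine ⟨fun _ => 0, ⟨⟨MemLp.zero', by simp⟩, fun i => ⟨fun _ => 0, fun _ =>
      ⟨0, by simp, fun x _ => by simp⟩, fun _ _ => rfl⟩⟩, fun i j z _ => by simp⟩
  smul_mem' := by
    rintro r x ⟨v, ⟨hv0, hv⟩, hx⟩
    refine ⟨fun z => r * v z, ⟨⟨hv0.1.const_mul r, ?_⟩, fun i => ?_⟩, fun i j z hz => by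
      simp only [Pi.smul_apply, hx i j z hz, smul_eq_mul]; ring⟩
    · rw [integral_const_mul, hv0.2, mul_zero]
    · obtain ⟨a, ha, ha'⟩ := hv i
      exact ⟨_, fun i => (ha i).const_mul r, fun x hx => by simp only [ha' x hx]⟩

/-- The truncated coordinate of the barycenter vanishes outside of the triangle, so the
interpolation formula for interior data is its own extension by zero. -/
lemma single_mem_velData [Finite ι] [DecidableEq ι] (i : ι) {ξ : Fin 4 → Fin 4 → E}
    (hξ : IsInteriorData ξ) : Pi.single i ξ ∈ M.velData := by
  obtain ⟨C, hC⟩ := M.lipschitz_affInv i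
  have hpos : ∀ y, ginterp ξ (M.affInv i y) ≠ 0 → ∀ k, 0 < M.lam i k y := fun y hy k =>
    pos_of_gHat_three_ne (fun h => hy (ginterp_eq_zero hξ h)) k
  have hz : ∀ j, j ≠ i → ∀ x ∈ refTri, ginterp ξ (M.affInv i (M.affMap j x)) = 0 := by
    intro j hj x hx
    by_contra h
    exact hj (M.eq_of_pos (hpos _ h) (M.affMap_mem_tri hx)).symm
  refine ⟨fun y => ginterp ξ (M.affInv i y), ⟨?_, fun j => ?_⟩, fun j k l => ?_⟩
  · refine ((bddLip_ginterp ξ).comp_lipschitz hC).memH10 M.domain_bounded fun y hy => ?_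
    by_contra h
    exact hy (M.mem_domain_of_pos (hpos y h))
  · by_cases hj : j = i
    · subst hj
      exact ⟨_, ginterp_mem_refVel ξ, fun x _ => by simp only [affInv_affMap]⟩
    · exact ⟨_, zero_mem_refVel, hz j hj⟩
  · by_cases hj : j = i
    · subst hj
      rw [Pi.single_eq_same]
      simp only [affInv_affMap, ginterp_node hξ.1]
    · rw [Pi.single_eq_of_ne hj]
      exact (hz j hj _ (node_mem_refTri k l)).symm

/-- The bubble is `4 * clamp P * clamp Q`, where the piecewise affine `P` and `Q` switch from the
formula of one element to that of the other at the line through the edge, on which both formulas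
agree. It lives on the set where `P` and `Q` are positive, inside the two elements. -/
lemma SharesEdge.mem_velData {M : AffineMesh ι} [Finite ι] [DecidableEq ι] {i j : ι} {k l : Fin 3}
    (h : M.SharesEdge i j k l) (e : E) :
    Pi.single i (edgeData k e) + Pi.single j (edgeData l e) ∈ M.velData := by
  -- the hat functions of the end points of the edge on the quadrilateral given by the edge
  -- and the barycenters of its triangles
  have hat : ∀ a b : Fin 3, a ≠ k → b ≠ l → (∀ m, m ≠ k → M.lam j b (M.vert i m)
      = M.lam i a (M.vert i m)) → ∃ P : E → ℝ, (∃ C, LipschitzWith C P) ∧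
      (∀ y, 0 ≤ M.lam i k y → P y = M.lam i a y - M.lam i k y) ∧
      (∀ y, M.lam i k y ≤ 0 → P y = M.lam j b y - M.lam j l y) := by
    intro a b ha hb hab
    -- `D` corrects the value at the vertex `k` of `i` to the required `-1`; on the common edge the
    -- correction vanishes.
    let D : ℝ := -1 - (M.lam j b (M.vert i k) - M.lam j l (M.vert i k))
    refine ⟨fun y => M.lam j b y - M.lam j l y + D * max (M.lam i k y) 0, ?_, ?_, ?_⟩
    · obtain ⟨C1, h1⟩ := M.lipschitz_lam j b
      obtain ⟨C2, h2⟩ := M.lipschitz_lam j l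
      obtain ⟨C3, h3⟩ := M.lipschitz_lam i k
      exact ⟨_, (h1.sub h2).add ((lipschitzWith_smul D).comp (h3.max_const 0))⟩
    · intro y hy
      beta_reduce
      rw [max_eq_left hy]
      have e1 := M.lam_eq_sum j i b y
      have e2 : M.lam j l y = M.lam j l (M.vert i k) * M.lam i k y := h.symm.lam_opposite.2 y
      have e3 : M.lam i a y = ∑ m, M.lam i m y * M.lam i a (M.vert i m) := M.lam_eq_sum i i a y
      rw [sum_fin_three k] at e1 e3
      rw [hab (k + 1) (fin_three_ne_one k).symm, hab (k + 2) (fin_three_ne_two k).symm] at e1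
      rw [M.lam_vert i a k, if_neg ha] at e3
      simp only [D]
      linear_combination e1 - e2 - e3
    · intro y hy
      beta_reduce
      rw [max_eq_right hy]; ring
  obtain ⟨P, hPL, hP1, hP2⟩ := hat (k + 1) (l + 2) (fin_three_ne_one k).symm
    (fin_three_ne_two l).symm (forall_fin_three k (fun h => absurd rfl h)
      (fun _ => by rw [h.2.1, lam_vert_self, ← h.2.1, lam_vert_self])
      (fun _ => by
        rw [lam_vert, if_neg (fin_three_one_ne_two k), h.2.2, lam_vert,
          if_neg (fin_three_one_ne_two l).symm]))
  obtain ⟨Q, hQL, hQ1, hQ2⟩ := hat (k + 2) (l + 1) (fin_three_ne_two k).symm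
    (fin_three_ne_one l).symm (forall_fin_three k (fun h => absurd rfl h)
      (fun _ => by
        rw [lam_vert, if_neg (fin_three_one_ne_two k).symm, h.2.1, lam_vert,
          if_neg (fin_three_one_ne_two l)])
      (fun _ => by rw [h.2.2, lam_vert_self, ← h.2.2, lam_vert_self]))
  have hopp := h.lam_opposite
  have hsign : ∀ y, M.lam i k y ≤ 0 → 0 ≤ M.lam j l y := fun y hy => by
    by_contra hc
    have := mul_pos_of_neg_of_neg hopp.1 (not_le.1 hc)
    rw [← hopp.2] at this
    linarith
  have hsign' : ∀ y, M.lam i k y < 0 → 0 < M.lam j l y := fun y hy => by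
    by_contra hc
    have := mul_nonneg_of_nonpos_of_nonpos hopp.1.le (not_lt.1 hc)
    rw [← hopp.2] at this
    linarith
  let W : Set E := {y | 0 < P y} ∩ {y | 0 < Q y}
  have hWo : IsOpen W := by
    obtain ⟨C, hC⟩ := hPL
    obtain ⟨D, hD⟩ := hQL
    exact (isOpen_lt continuous_const hC.continuous).inter
      (isOpen_lt continuous_const hD.continuous)
  have hWi : ∀ y ∈ W, 0 ≤ M.lam i k y → 0 < M.lam i (k + 1) y ∧ 0 < M.lam i (k + 2) y := by
    rintro y ⟨hp, hq⟩ h0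
    have hp' : 0 < P y := hp
    have hq' : 0 < Q y := hq
    rw [hP1 y h0] at hp'
    rw [hQ1 y h0] at hq'
    exact ⟨by linarith, by linarith⟩
  have hWj : ∀ y ∈ W, M.lam i k y ≤ 0 → 0 < M.lam j (l + 1) y ∧ 0 < M.lam j (l + 2) y := by
    rintro y ⟨hp, hq⟩ h0
    have hp' : 0 < P y := hp
    have hq' : 0 < Q y := hq
    rw [hP2 y h0] at hp'
    rw [hQ2 y h0] at hq'
    have := hsign y h0
    exact ⟨by linarith, by linarith⟩
  have hWsub : W ⊆ ⋃ m, M.tri m := by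
    intro y hy
    rcases le_total 0 (M.lam i k y) with h0 | h0
    · have h1 := hWi y hy h0
      exact mem_iUnion.2 ⟨i, M.mem_tri.2 (forall_fin_three k h0 h1.1.le h1.2.le)⟩
    · have h1 := hWj y hy h0
      exact mem_iUnion.2 ⟨j, M.mem_tri.2 (forall_fin_three l (hsign y h0) h1.1.le h1.2.le)⟩
  -- Off the edge line, a point of `W` is interior to `i` or `j`. On the line it is interior to the
  -- edge, and no third triangle contains that edge.
  have hWtri : ∀ m, m ≠ i → m ≠ j → ∀ y ∈ W, y ∉ M.tri m := by
    intro m hmi hmj y hy hym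
    rcases lt_trichotomy (M.lam i k y) 0 with h0 | h0 | h0
    · have h1 := hWj y hy h0.le
      exact hmj (M.eq_of_pos (forall_fin_three l (hsign' y h0) h1.1 h1.2) hym).symm
    · have h1 := hWi y hy h0.ge
      have hyi : y ∈ M.tri i := M.mem_tri.2 (forall_fin_three k h0.ge h1.1.le h1.2.le)
      have h2 : M.vert i (k + 1) ∈ range (M.vert m) := by
        by_contra hc
        exact h1.1.ne' (M.lam_eq_zero_of_mem_inter hmi.symm hyi hym hc)
      have h3 : M.vert i (k + 2) ∈ range (M.vert m) := by
        by_contra hc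
        exact h1.2.ne' (M.lam_eq_zero_of_mem_inter hmi.symm hyi hym hc)
      rcases h.eq_or_eq h2 h3 with h4 | h4
      · exact hmi h4
      · exact hmj h4
    · have h1 := hWi y hy h0.le
      exact hmi (M.eq_of_pos (forall_fin_three k h0 h1.1 h1.2) hym).symm
  let v : E → E := fun y => (4 * (clamp (P y) * clamp (Q y))) • e
  have hvW : ∀ y, y ∉ W → v y = 0 := by
    intro y hy
    have : P y ≤ 0 ∨ Q y ≤ 0 := by
      by_contra hc
      push Not at hc
      exact hy hc
    rcases this with h | h <;> simp [v, clamp_of_nonpos h]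
  have hvi : ∀ x ∈ refTri, v (M.affMap i x) = ginterp (edgeData k e) x := by
    intro x hx
    have h0 : 0 ≤ M.lam i k (M.affMap i x) := by rw [lam_affMap]; exact mem_refTri.1 hx k
    rw [ginterp_edgeData k e hx]
    simp only [v, hP1 _ h0, hQ1 _ h0, lam_affMap]
  have hvj : ∀ x ∈ refTri, v (M.affMap j x) = ginterp (edgeData l e) x := by
    intro x hx
    have h0 : M.lam i k (M.affMap j x) ≤ 0 := by
      rw [hopp.2, lam_affMap]
      exact mul_nonpos_of_nonpos_of_nonneg hopp.1.le (mem_refTri.1 hx l)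
    rw [ginterp_edgeData l e hx, mul_comm (clamp _)]
    simp only [v, hP2 _ h0, hQ2 _ h0, lam_affMap]
  have hvm : ∀ m, m ≠ i → m ≠ j → ∀ x ∈ refTri, v (M.affMap m x) = 0 := fun m hmi hmj x hx =>
    hvW _ fun hc => hWtri m hmi hmj _ hc (M.affMap_mem_tri hx)
  refine ⟨v, ⟨?_, fun m => ?_⟩, fun m a b => ?_⟩
  · have hb : BddLip v := by
      have h1 := (BddLip.const (4 : ℝ)).smul ((bddLip_clamp hPL).smul (bddLip_clamp hQL))
      exact h1.smul (BddLip.const e)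
    exact hb.memH10 M.domain_bounded fun y hy => hvW y fun hc =>
      hy (M.mem_domain_of_isOpen hWo hWsub hc)
  · by_cases hmi : m = i
    · subst hmi; exact ⟨_, ginterp_mem_refVel _, hvi⟩
    by_cases hmj : m = j
    · subst hmj; exact ⟨_, ginterp_mem_refVel _, hvj⟩
    exact ⟨_, zero_mem_refVel, hvm m hmi hmj⟩
  · by_cases hmi : m = i
    · subst hmi
      rw [hvi _ (node_mem_refTri a b), ginterp_node (edgeData_symm k e), Pi.add_apply,
        Pi.single_eq_same, Pi.single_eq_of_ne h.1, add_zero]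
    by_cases hmj : m = j
    · subst hmj
      rw [hvj _ (node_mem_refTri a b), ginterp_node (edgeData_symm l e), Pi.add_apply,
        Pi.single_eq_same, Pi.single_eq_of_ne h.1.symm, zero_add]
    rw [hvm m hmi hmj _ (node_mem_refTri a b), Pi.add_apply, Pi.single_eq_of_ne hmi,
      Pi.single_eq_of_ne hmj, add_zero]
    rfl

end AffineMesh

/-! ### Linear maps of the plane -/

/-- The standard basis of the plane. -/
def eb (m : Fin 2) : E := EuclideanSpace.single m 1

lemma eb_apply (m n : Fin 2) : eb m n = if n = m then 1 else 0 := by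
  simp [eb]

lemma eq_sum_eb (v : E) : v = v 0 • eb 0 + v 1 • eb 1 := by
  ext m; fin_cases m <;> simp [eb_apply]

lemma clm_apply_eq (B : E →L[ℝ] E) (v : E) : B v = v 0 • B (eb 0) + v 1 • B (eb 1) := by
  conv_lhs => rw [eq_sum_eb v]
  simp

lemma clm_det (B : E →L[ℝ] E) : B.det = B (eb 0) 0 * B (eb 1) 1 - B (eb 1) 0 * B (eb 0) 1 := by
  have h := LinearMap.det_toMatrix (EuclideanSpace.basisFun (Fin 2) ℝ).toBasis (B : E →ₗ[ℝ] E)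
  rw [ContinuousLinearMap.det, ← h, Matrix.det_fin_two]
  simp [LinearMap.toMatrix_apply, eb]

/-- The adjugate of a linear map of the plane. -/
def adj (B : E →L[ℝ] E) : E →L[ℝ] E :=
  (B (eb 0) 0 + B (eb 1) 1) • ContinuousLinearMap.id ℝ E - B

lemma adj_apply (B : E →L[ℝ] E) (v : E) : adj B v = (B (eb 0) 0 + B (eb 1) 1) • v - B v := rfl

/-- Cayley–Hamilton, with the adjugate written as `tr B - B`. -/
lemma adj_apply_apply (B : E →L[ℝ] E) (v : E) : adj B (B v) = B.det • v := by
  rw [adj_apply, clm_det, clm_apply_eq B (B v), clm_apply_eq B v]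
  ext m
  fin_cases m <;> simp <;> ring

lemma apply_adj_apply (B : E →L[ℝ] E) (v : E) : B (adj B v) = B.det • v := by
  rw [← adj_apply_apply, adj_apply, adj_apply, map_sub, map_smul]

@[fun_prop]
lemma contDiff_adj {n : WithTop ℕ∞} : ContDiff ℝ n adj := by
  have h : ∀ k m : Fin 2, ContDiff ℝ n fun B : E →L[ℝ] E => B (eb k) m := fun k m =>
    ((coordL m).comp (ContinuousLinearMap.apply ℝ E (eb k))).contDiff
  exact (((h 0 0).add (h 1 1)).smul contDiff_const).sub contDiff_id

@[fun_prop]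
lemma contDiff_clm_det {n : WithTop ℕ∞} : ContDiff ℝ n fun B : E →L[ℝ] E => B.det := by
  have h : ∀ k m : Fin 2, ContDiff ℝ n fun B : E →L[ℝ] E => B (eb k) m := fun k m =>
    ((coordL m).comp (ContinuousLinearMap.apply ℝ E (eb k))).contDiff
  simp only [clm_det]
  exact ((h 0 0).mul (h 1 1)).sub ((h 1 0).mul (h 0 1))

/-- The derivative of a function that is given by its pull-back. -/
lemma hasFDerivAt_of_comp {F U v : E → E} {S : Set E} (hS : IsOpen S) {x : E} (hx : x ∈ S)
    (hF : ContDiff ℝ 1 F) (hdet : (fderiv ℝ F x).det ≠ 0) (hU : DifferentiableAt ℝ U x)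
    (hv : ∀ z ∈ S, v (F z) = U z) :
    HasFDerivAt v ((fderiv ℝ F x).det⁻¹ • (fderiv ℝ U x ∘L adj (fderiv ℝ F x))) (F x) := by
  have hst : HasStrictFDerivAt F (fderiv ℝ F x) x :=
    hF.contDiffAt.hasStrictFDerivAt (by simp)
  let e := (fderiv ℝ F x).toContinuousLinearEquivOfDetNeZero hdet
  have hst' : HasStrictFDerivAt F (e : E →L[ℝ] E) x := by
    simpa [e] using hst
  have hinv := hst'.to_localInverse
  have h1 : hst'.localInverse F e x (F x) = x := hst'.localInverse_apply_image
  have h2 : ∀ᶠ y in 𝓝 (F x), hst'.localInverse F e x y ∈ S :=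
    hst'.localInverse_continuousAt.eventually (by rw [h1]; exact hS.mem_nhds hx)
  -- By the inverse function theorem, `v` is `U` composed with a local inverse of `F` near `F x`.
  have h3 : v =ᶠ[𝓝 (F x)] fun y => U (hst'.localInverse F e x y) := by
    filter_upwards [h2, hst'.eventually_right_inverse] with y hy hy'
    rw [← hv _ hy, hy']
  have h4 : HasFDerivAt U (fderiv ℝ U x) (hst'.localInverse F e x (F x)) := by
    rw [h1]; exact hU.hasFDerivAt
  have h5 := (h4.comp (F x) hinv.hasFDerivAt).congr_of_eventuallyEq h3
  have heq : (fderiv ℝ F x).det⁻¹ • (fderiv ℝ U x ∘L adj (fderiv ℝ F x))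
      = fderiv ℝ U x ∘L (e.symm : E →L[ℝ] E) := by
    refine ContinuousLinearMap.ext fun w => ?_
    change (fderiv ℝ F x).det⁻¹ • fderiv ℝ U x (adj (fderiv ℝ F x) w) = fderiv ℝ U x (e.symm w)
    rw [← map_smul]
    congr 1
    apply e.injective
    rw [ContinuousLinearEquiv.apply_symm_apply]
    change fderiv ℝ F x _ = w
    rw [map_smul, apply_adj_apply, smul_smul, inv_mul_cancel₀ hdet, one_smul]
  rw [heq]
  exact h5

/-! ### Element maps and Piola transforms -/

namespace IsoMesh

variable {ι : Type*} (M : IsoMesh ι)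

lemma contDiff_F (i : ι) {n : WithTop ℕ∞} : ContDiff ℝ n (M.F i) := by
  unfold F AffineMesh.quadMap; fun_prop

/-- The Jacobian determinant of the element map. -/
def jacDet (i : ι) (x : E) : ℝ := (fderiv ℝ (M.F i) x).det

lemma contDiff_fderiv_F (i : ι) {n : WithTop ℕ∞} : ContDiff ℝ n (fderiv ℝ (M.F i)) :=
  (M.contDiff_F i (n := n + 1)).fderiv_right le_rfl

lemma contDiff_jacDet (i : ι) {n : WithTop ℕ∞} : ContDiff ℝ n (M.jacDet i) :=
  contDiff_clm_det.comp (M.contDiff_fderiv_F i)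

lemma jacDet_pos (i : ι) {x : E} (hx : x ∈ refTri) : 0 < M.jacDet i x := M.det_pos i x hx

lemma piola_apply (i : ι) (x v : E) :
    M.piola i x v = (M.jacDet i x)⁻¹ • fderiv ℝ (M.F i) x v := rfl

/-- The adjugate of `DF` inverts `DF / det DF`. So it recovers reference nodal values from physical
ones without any further division. -/
lemma adj_piola (i : ι) {x : E} (hx : x ∈ refTri) (v : E) :
    adj (fderiv ℝ (M.F i) x) (M.piola i x v) = v := by
  rw [piola_apply, map_smul, adj_apply_apply, smul_smul]
  change ((M.jacDet i x)⁻¹ * M.jacDet i x) • v = v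
  rw [inv_mul_cancel₀ (M.jacDet_pos i hx).ne', one_smul]

lemma piola_adj (i : ι) {x : E} (hx : x ∈ refTri) (v : E) :
    M.piola i x (adj (fderiv ℝ (M.F i) x) v) = v := by
  rw [piola_apply, apply_adj_apply, smul_smul]
  change ((M.jacDet i x)⁻¹ * M.jacDet i x) • v = v
  rw [inv_mul_cancel₀ (M.jacDet_pos i hx).ne', one_smul]

/-- Nodal values, transformed to the reference triangle. -/
def pullData (i : ι) (ξ : Fin 4 → Fin 4 → E) (k l : Fin 4) : E :=
  adj (fderiv ℝ (M.F i) (node k l)) (ξ k l)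

lemma pullData_add (i : ι) (ξ η : Fin 4 → Fin 4 → E) :
    M.pullData i (ξ + η) = M.pullData i ξ + M.pullData i η := by
  funext k l; simp [pullData]

lemma pullData_smul (i : ι) (r : ℝ) (ξ : Fin 4 → Fin 4 → E) :
    M.pullData i (r • ξ) = r • M.pullData i ξ := by
  funext k l; simp [pullData]

/-- The pull-back of the velocity with given nodal values, as a smooth field on the piece `j`. -/
def pullVel (i : ι) (j : Fin 3) (ξ : Fin 4 → Fin 4 → E) (x : E) : E :=
  M.piola i x (interp j (M.pullData i ξ) x)

lemma pullVel_add (i : ι) (j : Fin 3) (ξ η : Fin 4 → Fin 4 → E) (x : E) :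
    M.pullVel i j (ξ + η) x = M.pullVel i j ξ x + M.pullVel i j η x := by
  rw [pullVel, pullData_add, interp_add, map_add]; rfl

lemma pullVel_smul (i : ι) (j : Fin 3) (r : ℝ) (ξ : Fin 4 → Fin 4 → E) (x : E) :
    M.pullVel i j (r • ξ) x = r • M.pullVel i j ξ x := by
  rw [pullVel, pullData_smul, interp_smul, map_smul]; rfl

/-- The set where the element map is a local diffeomorphism. -/
def good (i : ι) : Set E := {x | 0 < M.jacDet i x}

lemma isOpen_good (i : ι) : IsOpen (M.good i) :=
  isOpen_lt continuous_const (M.contDiff_jacDet i (n := 0)).continuous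

lemma refTri_subset_good (i : ι) : refTri ⊆ M.good i := fun _ hx => M.jacDet_pos i hx

lemma contDiffOn_pullVel (i : ι) (j : Fin 3) (ξ : Fin 4 → Fin 4 → E) {n : WithTop ℕ∞} :
    ContDiffOn ℝ n (M.pullVel i j ξ) (M.good i) := by
  have h : ContDiff ℝ n fun x => fderiv ℝ (M.F i) x (interp j (M.pullData i ξ) x) :=
    (M.contDiff_fderiv_F i).clm_apply (contDiff_interp j _)
  exact ((M.contDiff_jacDet i).contDiffOn.inv fun x hx => ne_of_gt hx).smul h.contDiffOn

lemma differentiableAt_pullVel (i : ι) (j : Fin 3) (ξ : Fin 4 → Fin 4 → E) {x : E}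
    (hx : x ∈ M.good i) : DifferentiableAt ℝ (M.pullVel i j ξ) x :=
  ((M.contDiffOn_pullVel i j ξ (n := 1)).differentiableOn (by simp)).differentiableAt
    ((M.isOpen_good i).mem_nhds hx)

lemma continuousOn_fderiv_pullVel (i : ι) (j : Fin 3) (ξ : Fin 4 → Fin 4 → E) :
    ContinuousOn (fderiv ℝ (M.pullVel i j ξ)) (M.good i) :=
  (M.contDiffOn_pullVel i j ξ (n := 1)).continuousOn_fderiv_of_isOpen (M.isOpen_good i) (by simp)

/-! ### The element maps and the open elements -/

lemma F_eq_imp {i j : ι} {x y : E} (hx : x ∈ refTri) (hy : y ∈ refTri) (h : M.F i x = M.F j y) :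
    M.affMap i x = M.affMap j y := M.G_inj i j x hx y hy h

lemma F_injOn (i : ι) : InjOn (M.F i) refTri := fun _ hx _ hy h =>
  M.toAffineMesh.affMap_injective i (M.F_eq_imp hx hy h)

/-- Injectivity of `G_h` carries the disjointness of the affine triangles over to the curved ones.
-/
lemma eq_of_F_eq {i j : ι} {x y : E} (hx : x ∈ interior refTri) (hy : y ∈ refTri)
    (h : M.F i x = M.F j y) : i = j := by
  have h1 := M.F_eq_imp (interior_subset hx) hy h
  refine M.toAffineMesh.eq_of_pos (y := M.affMap i x) (fun k => ?_) ?_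
  · rw [AffineMesh.lam_affMap]; exact interior_refTri_pos hx k
  · rw [h1]; exact M.toAffineMesh.affMap_mem_tri hy

lemma isOpen_F_image (i : ι) {S : Set E} (hS : IsOpen S) (h : S ⊆ refTri) :
    IsOpen (M.F i '' S) := by
  rw [isOpen_iff_mem_nhds]
  rintro _ ⟨x, hx, rfl⟩
  have hst : HasStrictFDerivAt (M.F i) (fderiv ℝ (M.F i) x) x :=
    (M.contDiff_F i (n := 1)).contDiffAt.hasStrictFDerivAt (by simp)
  have hdet : (fderiv ℝ (M.F i) x).det ≠ 0 := (M.jacDet_pos i (h hx)).ne'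
  let e := (fderiv ℝ (M.F i) x).toContinuousLinearEquivOfDetNeZero hdet
  have hst' : HasStrictFDerivAt (M.F i) (e : E →L[ℝ] E) x := by
    simpa [e] using hst
  rw [← hst'.map_nhds_eq_of_equiv]
  exact image_mem_map (hS.mem_nhds hx)

lemma F_image_subset_Omega (i : ι) {S : Set E} (hS : IsOpen S) (h : S ⊆ refTri) :
    M.F i '' S ⊆ M.Omega :=
  (M.isOpen_F_image i hS h).subset_interior_iff.2
    ((image_mono h).trans (subset_iUnion (fun i => M.elt i) i))

/-- The images of the open triangles of the split. -/
def piece (p : ι × Fin 3) : Set E := M.F p.1 '' ctPiece p.2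

lemma isOpen_piece (p : ι × Fin 3) : IsOpen (M.piece p) :=
  M.isOpen_F_image _ (isOpen_ctPiece _) (ctPiece_subset_refTri _)

lemma disjoint_piece {p q : ι × Fin 3} (hpq : p ≠ q) : Disjoint (M.piece p) (M.piece q) := by
  obtain ⟨i, j⟩ := p
  obtain ⟨i', j'⟩ := q
  rw [Set.disjoint_left]
  rintro _ ⟨x, hx, rfl⟩ ⟨y, hy, hxy⟩
  obtain rfl : i = i' := M.eq_of_F_eq (ctPiece_subset_interior_refTri _ hx)
    (ctPiece_subset_refTri _ hy) hxy.symm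
  have h1 := M.F_injOn i (ctPiece_subset_refTri _ hy) (ctPiece_subset_refTri _ hx) hxy
  subst h1
  have hj : j ≠ j' := fun h => hpq (by rw [h])
  exact Set.disjoint_left.1 (disjoint_ctPiece hj) hx hy

/-- What is left of `Ω_h` is covered by the images of the lines of the split, and differentiable
maps preserve null sets. -/
lemma Omega_ae_eq [Finite ι] : (⋃ p, M.piece p) =ᵐ[volume] M.Omega := by
  have h1 : (⋃ p, M.piece p) ⊆ M.Omega :=
    iUnion_subset fun p => M.F_image_subset_Omega _ (isOpen_ctPiece _) (ctPiece_subset_refTri _)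
  refine h1.eventuallyLE.antisymm ?_
  rw [ae_le_set]
  have h2 : M.Omega \ (⋃ p, M.piece p) ⊆ ⋃ i, M.F i '' (refTri \ ⋃ j, ctPiece j) := by
    rintro y ⟨hy, hn⟩
    obtain ⟨i, x, hx, rfl⟩ := mem_iUnion.1 (interior_subset hy)
    refine mem_iUnion.2 ⟨i, x, ⟨hx, fun hc => hn ?_⟩, rfl⟩
    obtain ⟨j, hj⟩ := mem_iUnion.1 hc
    exact mem_iUnion.2 ⟨(i, j), x, hj, rfl⟩
  refine measure_mono_null h2 (measure_iUnion_null fun i => ?_)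
  exact addHaar_image_eq_zero_of_differentiableOn_of_addHaar_eq_zero volume
    ((M.contDiff_F i (n := 1)).differentiable (by simp)).differentiableOn volume_refTri_diff

lemma ae_Omega [Finite ι] {p : E → Prop}
    (h : ∀ i j, ∀ x ∈ ctPiece j, p (M.F i x)) : ∀ᵐ y ∂(volume.restrict M.Omega), p y := by
  rw [← Measure.restrict_congr_set M.Omega_ae_eq]
  refine (ae_restrict_mem (MeasurableSet.iUnion fun p => (M.isOpen_piece p).measurableSet)).mono
    fun y hy => ?_
  obtain ⟨⟨i, j⟩, x, hx, rfl⟩ := mem_iUnion.1 hy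
  exact h i j x hx

lemma F_injOn_ctPiece (i : ι) (j : Fin 3) : InjOn (M.F i) (ctPiece j) :=
  (M.F_injOn i).mono (ctPiece_subset_refTri j)

lemma hasFDerivWithinAt_F (i : ι) (S : Set E) :
    ∀ x ∈ S, HasFDerivWithinAt (M.F i) (fderiv ℝ (M.F i) x) S x := fun x _ =>
  ((M.contDiff_F i (n := 1)).differentiable (by simp) x).hasFDerivAt.hasFDerivWithinAt

lemma integrableOn_piece_iff {V : Type*} [NormedAddCommGroup V] [NormedSpace ℝ V] (i : ι)
    (j : Fin 3) {h : E → V} : IntegrableOn h (M.piece (i, j)) ↔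
      IntegrableOn (fun x => M.jacDet i x • h (M.F i x)) (ctPiece j) := by
  rw [piece, integrableOn_image_iff_integrableOn_abs_det_fderiv_smul volume
    (isOpen_ctPiece j).measurableSet (M.hasFDerivWithinAt_F i _) (M.F_injOn_ctPiece i j)]
  refine integrableOn_congr_fun (fun x hx => ?_) (isOpen_ctPiece j).measurableSet
  have hd : |(fderiv ℝ (M.F i) x).det| = M.jacDet i x :=
    abs_of_pos (M.jacDet_pos i (ctPiece_subset_refTri j hx))
  simp only [hd]

lemma integral_Omega [Fintype ι] {h : E → ℝ}
    (hi : ∀ i j, IntegrableOn (fun x => M.jacDet i x * h (M.F i x)) (ctPiece j)) :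
    ∫ y in M.Omega, h y = ∑ i, ∑ j, ∫ x in ctPiece j, M.jacDet i x * h (M.F i x) := by
  rw [← Measure.restrict_congr_set M.Omega_ae_eq, integral_iUnion_fintype
    (fun p => (M.isOpen_piece p).measurableSet) (fun p q hpq => M.disjoint_piece hpq)
    (fun p => (M.integrableOn_piece_iff p.1 p.2).2 (hi p.1 p.2)), Fintype.sum_prod_type]
  refine Finset.sum_congr rfl fun i _ => Finset.sum_congr rfl fun j _ => ?_
  rw [piece, integral_image_eq_integral_abs_det_fderiv_smul volume
    (isOpen_ctPiece j).measurableSet (M.hasFDerivWithinAt_F i _) (M.F_injOn_ctPiece i j)]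
  refine setIntegral_congr_fun (isOpen_ctPiece j).measurableSet fun x hx => ?_
  have hd : |(fderiv ℝ (M.F i) x).det| = M.jacDet i x :=
    abs_of_pos (M.jacDet_pos i (ctPiece_subset_refTri j hx))
  simp only [hd, smul_eq_mul]

/-! ### Velocities and pressures in terms of nodal values and coefficients -/

/-- `v` is the velocity with nodal values `x`. -/
def HasVelData (v : E → E) (x : ι → Fin 4 → Fin 4 → E) : Prop :=
  ∀ i j, ∀ z ∈ ctPiece j, v (M.F i z) = M.pullVel i j (x i) z

/-- `q` is the pressure with coefficients `y`. -/
def HasPresData (q : E → ℝ) (y : ι → Fin 3 → Fin 3 → ℝ) : Prop :=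
  ∀ i j, ∀ z ∈ ctPiece j, q (M.F i z) = y i j 0 + y i j 1 * z 0 + y i j 2 * z 1

/-- The reference field is quadratic on the split, so it is determined by its nodal values. These
come from the prescribed values by inverting the Piola matrix at the nodes. -/
lemma exists_velData {v : E → E} (hv : v ∈ M.vel) :
    ∃ x ∈ M.toAffineMesh.velData, M.HasVelData v x := by
  obtain ⟨vt, hvt, hv⟩ := hv
  refine ⟨fun i k l => vt (M.affMap i (node k l)), ⟨vt, hvt, fun _ _ _ => rfl⟩,
    fun i j z hz => ?_⟩
  obtain ⟨w, ⟨⟨vhat, hvhat, hw⟩, hn⟩, hvw⟩ := hv i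
  rw [hvw ⟨z, ctPiece_subset_interior_refTri j hz, rfl⟩, hw z (ctPiece_subset_refTri j hz), pullVel,
    ← interp_eq_of_isPolyOn (hvhat.2 j) (ctPiece_subset_ctTri j hz)]
  congr 2
  funext k l
  change vhat (node k l) = adj (fderiv ℝ (M.F i) (node k l)) (vt (M.affMap i (node k l)))
  rw [← hn _ (node_mem_refNodes k l), hw _ (node_mem_refTri k l),
    M.adj_piola i (node_mem_refTri k l)]

lemma exists_vel {x : ι → Fin 4 → Fin 4 → E} (hx : x ∈ M.toAffineMesh.velData) :
    ∃ v ∈ M.vel, M.HasVelData v x := by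
  classical
  obtain ⟨vt, hvt, hxv⟩ := id hx
  have hsymm : ∀ i k l, M.pullData i (x i) k l = M.pullData i (x i) l k := fun i k l => by
    rw [pullData, pullData, node_comm, M.toAffineMesh.velData_symm hx]
  let w : ι → E → E := fun i y =>
    M.piola i (Function.invFunOn (M.F i) refTri y)
      (ginterp (M.pullData i (x i)) (Function.invFunOn (M.F i) refTri y))
  have hw : ∀ i, ∀ z ∈ refTri, w i (M.F i z) = M.piola i z (ginterp (M.pullData i (x i)) z) := by
    intro i z hz
    have : Function.invFunOn (M.F i) refTri (M.F i z) = z :=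
      (M.F_injOn i).leftInvOn_invFunOn hz
    simp only [w, this]
  -- The open elements are disjoint, so the choice of `i` is forced; the value zero elsewhere plays
  -- no role.
  let v : E → E := fun y => if h : ∃ i, y ∈ M.F i '' interior refTri then w h.choose y else 0
  have hv : ∀ i, EqOn v (w i) (M.F i '' interior refTri) := by
    intro i y hy
    have hex : ∃ i, y ∈ M.F i '' interior refTri := ⟨i, hy⟩
    simp only [v, dif_pos hex]
    congr 1
    obtain ⟨z, hz, hzy⟩ := hy
    obtain ⟨z', hz', hzy'⟩ := hex.choose_spec
    exact M.eq_of_F_eq hz' (interior_subset hz) (hzy'.trans hzy.symm)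
  refine ⟨v, ⟨vt, hvt, fun i => ⟨w i, ⟨⟨_, ginterp_mem_refVel _, hw i⟩, ?_⟩, hv i⟩⟩, ?_⟩
  · rintro _ ⟨k, l, rfl⟩
    change w i (M.F i (node k l)) = vt (M.affMap i (node k l))
    rw [hw i _ (node_mem_refTri k l), ginterp_node (hsymm i), pullData,
      M.piola_adj i (node_mem_refTri k l), hxv]
  · intro i j z hz
    rw [hv i ⟨z, ctPiece_subset_interior_refTri j hz, rfl⟩, hw i z (ctPiece_subset_refTri j hz),
      ginterp_eq_interp (ctPiece_subset_ctTri j hz)]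
    rfl

lemma exists_presData [Finite ι] {q : E → ℝ} (hq : q ∈ M.pres) :
    ∃ y ∈ M.toAffineMesh.presData, M.HasPresData q y := by
  obtain ⟨qt, hqt, hq⟩ := hq
  have h : ∀ i j, ∃ c : Fin 3 → ℝ, ∀ z ∈ ctPiece j,
      qt (M.affMap i z) = c 0 + c 1 * z 0 + c 2 * z 1 := by
    intro i j
    obtain ⟨qh, h1, h2⟩ := hqt.2 i
    obtain ⟨c, hc⟩ := (h1 j).exists_affine
    exact ⟨c, fun z hz => by
      rw [h2 z (ctPiece_subset_interior_refTri j hz), hc z (ctPiece_subset_interior j hz)]⟩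
  choose c hc using h
  refine ⟨c, ⟨qt, hqt, hc⟩, fun i j z hz => ?_⟩
  rw [hq i z (ctPiece_subset_interior_refTri j hz), hc i j z hz]

lemma exists_pres [Finite ι] {y : ι → Fin 3 → Fin 3 → ℝ} (hy : y ∈ M.toAffineMesh.presData) :
    ∃ q ∈ M.pres, M.HasPresData q y := by
  classical
  obtain ⟨qt, hqt, hyq⟩ := id hy
  -- A point on a common edge has several preimages, but all of them correspond to the same point of
  -- the affine mesh.
  let q : E → ℝ := fun z =>
    if h : ∃ p : ι × E, p.2 ∈ refTri ∧ M.F p.1 p.2 = z then qt (M.affMap h.choose.1 h.choose.2)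
    else 0
  have hq : ∀ i, ∀ x ∈ interior refTri, q (M.F i x) = qt (M.affMap i x) := by
    intro i x hx
    have hex : ∃ p : ι × E, p.2 ∈ refTri ∧ M.F p.1 p.2 = M.F i x :=
      ⟨(i, x), interior_subset hx, rfl⟩
    simp only [q, dif_pos hex]
    congr 1
    exact M.F_eq_imp hex.choose_spec.1 (interior_subset hx) hex.choose_spec.2
  refine ⟨q, ⟨qt, hqt, hq⟩, fun i j z hz => ?_⟩
  rw [hq i z (ctPiece_subset_interior_refTri j hz), hyq i j z hz]

lemma HasVelData.hasFDerivAt {M : IsoMesh ι} {v : E → E} {x : ι → Fin 4 → Fin 4 → E}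
    (h : M.HasVelData v x) (i : ι) {j : Fin 3} {z : E} (hz : z ∈ ctPiece j) :
    HasFDerivAt v ((M.jacDet i z)⁻¹ • (fderiv ℝ (M.pullVel i j (x i)) z
      ∘L adj (fderiv ℝ (M.F i) z))) (M.F i z) :=
  hasFDerivAt_of_comp (isOpen_ctPiece j) hz (M.contDiff_F i)
    (M.jacDet_pos i (ctPiece_subset_refTri j hz)).ne'
    (M.differentiableAt_pullVel i j _ (M.refTri_subset_good i (ctPiece_subset_refTri j hz)))
    fun w hw => h i j w hw

end IsoMesh

/-! ### The viscous form on nodal values -/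

/-- The Frobenius product of linear maps of the plane. -/
def frob (A B : E →L[ℝ] E) : ℝ := ∑ i : Fin 2, ∑ j : Fin 2, A (eb j) i * B (eb j) i

lemma gradDot_eq_frob (u v : E → E) (x : E) : gradDot u v x = frob (fderiv ℝ u x) (fderiv ℝ v x) :=
  rfl

lemma frob_add_left (A A' B : E →L[ℝ] E) : frob (A + A') B = frob A B + frob A' B := by
  simp [frob, Fin.sum_univ_two]; ring

lemma frob_smul_left (r : ℝ) (A B : E →L[ℝ] E) : frob (r • A) B = r * frob A B := by
  simp [frob, Fin.sum_univ_two]; ring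

lemma frob_comm (A B : E →L[ℝ] E) : frob A B = frob B A := by
  simp [frob, Fin.sum_univ_two]; ring

lemma frob_self_nonneg (A : E →L[ℝ] E) : 0 ≤ frob A A :=
  Finset.sum_nonneg fun _ _ => Finset.sum_nonneg fun _ _ => mul_self_nonneg _

lemma eq_zero_of_frob_self {A : E →L[ℝ] E} (h : frob A A = 0) : A = 0 := by
  simp only [frob, Fin.sum_univ_two] at h
  have h1 := mul_self_nonneg (A (eb 0) 0)
  have h2 := mul_self_nonneg (A (eb 1) 0)
  have h3 := mul_self_nonneg (A (eb 0) 1)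
  have h4 := mul_self_nonneg (A (eb 1) 1)
  have e1 := mul_self_eq_zero.1 (by linarith : A (eb 0) 0 * A (eb 0) 0 = 0)
  have e2 := mul_self_eq_zero.1 (by linarith : A (eb 1) 0 * A (eb 1) 0 = 0)
  have e3 := mul_self_eq_zero.1 (by linarith : A (eb 0) 1 * A (eb 0) 1 = 0)
  have e4 := mul_self_eq_zero.1 (by linarith : A (eb 1) 1 * A (eb 1) 1 = 0)
  refine ContinuousLinearMap.ext fun v => ?_
  rw [clm_apply_eq]
  ext m
  fin_cases m <;> simp [e1, e2, e3, e4]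

lemma ContinuousOn.frob {f g : E → E →L[ℝ] E} {S : Set E} (hf : ContinuousOn f S)
    (hg : ContinuousOn g S) : ContinuousOn (fun z => frob (f z) (g z)) S := by
  have h : ∀ {f : E → E →L[ℝ] E}, ContinuousOn f S → ∀ k m : Fin 2,
      ContinuousOn (fun z => f z (eb k) m) S := fun hf k m =>
    ((coordL m).comp (ContinuousLinearMap.apply ℝ E (eb k))).continuous.comp_continuousOn hf
  simp only [IsoStokes.frob, Fin.sum_univ_two]
  exact (((h hf 0 0).mul (h hg 0 0)).add ((h hf 1 0).mul (h hg 1 0))).add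
    (((h hf 0 1).mul (h hg 0 1)).add ((h hf 1 1).mul (h hg 1 1)))

lemma integrableOn_ctPiece {V : Type*} [NormedAddCommGroup V] {f : E → V}
    (hf : ContinuousOn f refTri) (j : Fin 3) : IntegrableOn f (ctPiece j) :=
  (hf.integrableOn_compact refTri_isCompact).mono_set (ctPiece_subset_refTri j)

lemma divergence_eq_of_hasFDerivAt {v : E → E} {x : E} {A : E →L[ℝ] E} (h : HasFDerivAt v A x) :
    divergence v x = A (eb 0) 0 + A (eb 1) 1 := by
  rw [divergence, h.fderiv, Fin.sum_univ_two]; rfl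

namespace IsoMesh

variable {ι : Type*} (M : IsoMesh ι)

/-- The pull-back of the velocity gradient. -/
def pullGrad (i : ι) (j : Fin 3) (ξ : Fin 4 → Fin 4 → E) (z : E) : E →L[ℝ] E :=
  (M.jacDet i z)⁻¹ • (fderiv ℝ (M.pullVel i j ξ) z ∘L adj (fderiv ℝ (M.F i) z))

lemma pullGrad_add (i : ι) (j : Fin 3) (ξ η : Fin 4 → Fin 4 → E) {z : E} (hz : z ∈ M.good i) :
    M.pullGrad i j (ξ + η) z = M.pullGrad i j ξ z + M.pullGrad i j η z := by
  have h : M.pullVel i j (ξ + η) = fun z => M.pullVel i j ξ z + M.pullVel i j η z :=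
    funext (M.pullVel_add i j ξ η)
  rw [pullGrad, h, fderiv_fun_add (M.differentiableAt_pullVel i j _ hz)
    (M.differentiableAt_pullVel i j _ hz), ContinuousLinearMap.add_comp, smul_add]
  rfl

lemma pullGrad_smul (i : ι) (j : Fin 3) (r : ℝ) (ξ : Fin 4 → Fin 4 → E) {z : E}
    (hz : z ∈ M.good i) : M.pullGrad i j (r • ξ) z = r • M.pullGrad i j ξ z := by
  have h : M.pullVel i j (r • ξ) = fun z => r • M.pullVel i j ξ z :=
    funext (M.pullVel_smul i j r ξ)
  rw [pullGrad, h, fderiv_fun_const_smul (M.differentiableAt_pullVel i j _ hz),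
    ContinuousLinearMap.smul_comp, smul_comm]
  rfl

lemma continuousOn_pullGrad (i : ι) (j : Fin 3) (ξ : Fin 4 → Fin 4 → E) :
    ContinuousOn (M.pullGrad i j ξ) refTri := by
  have h1 : ContinuousOn (fun z => (M.jacDet i z)⁻¹) refTri :=
    (M.contDiff_jacDet i (n := 0)).continuous.continuousOn.inv₀
      fun x hx => (M.jacDet_pos i hx).ne'
  have h2 : ContinuousOn (fderiv ℝ (M.pullVel i j ξ)) refTri :=
    (M.continuousOn_fderiv_pullVel i j ξ).mono (M.refTri_subset_good i)
  have h3 : ContDiff ℝ 0 fun z : E => adj (fderiv ℝ (M.F i) z) :=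
    contDiff_adj.comp (M.contDiff_fderiv_F i)
  exact h1.smul (h2.clm_comp h3.continuous.continuousOn)

lemma HasVelData.fderiv_eq {M : IsoMesh ι} {v : E → E} {x : ι → Fin 4 → Fin 4 → E}
    (h : M.HasVelData v x) (i : ι) {j : Fin 3} {z : E} (hz : z ∈ ctPiece j) :
    fderiv ℝ v (M.F i z) = M.pullGrad i j (x i) z := (h.hasFDerivAt i hz).fderiv

/-- The integrand of the viscous term on the reference triangle. -/
def gradInt (i : ι) (j : Fin 3) (ξ η : Fin 4 → Fin 4 → E) (z : E) : ℝ :=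
  M.jacDet i z * frob (M.pullGrad i j ξ z) (M.pullGrad i j η z)

lemma continuousOn_gradInt (i : ι) (j : Fin 3) (ξ η : Fin 4 → Fin 4 → E) :
    ContinuousOn (M.gradInt i j ξ η) refTri :=
  (M.contDiff_jacDet i (n := 0)).continuous.continuousOn.mul
    (ContinuousOn.frob (M.continuousOn_pullGrad i j ξ) (M.continuousOn_pullGrad i j η))

lemma integrableOn_gradInt (i : ι) (j : Fin 3) (ξ η : Fin 4 → Fin 4 → E) :
    IntegrableOn (M.gradInt i j ξ η) (ctPiece j) :=
  integrableOn_ctPiece (M.continuousOn_gradInt i j ξ η) j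

lemma gradInt_comm (i : ι) (j : Fin 3) (ξ η : Fin 4 → Fin 4 → E) (z : E) :
    M.gradInt i j ξ η z = M.gradInt i j η ξ z := by
  rw [gradInt, frob_comm]; rfl

/-- The viscous form on nodal values. -/
def gradVal [Fintype ι] (x y : ι → Fin 4 → Fin 4 → E) : ℝ :=
  ∑ i, ∑ j, ∫ z in ctPiece j, M.gradInt i j (x i) (y i) z

lemma gradVal_comm [Fintype ι] (x y : ι → Fin 4 → Fin 4 → E) :
    M.gradVal x y = M.gradVal y x := by
  unfold gradVal
  simp only [gradInt_comm _ _ _ (x _)]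

lemma gradVal_add_left [Fintype ι] (x x' y : ι → Fin 4 → Fin 4 → E) :
    M.gradVal (x + x') y = M.gradVal x y + M.gradVal x' y := by
  simp only [gradVal, ← Finset.sum_add_distrib]
  refine Finset.sum_congr rfl fun i _ => Finset.sum_congr rfl fun j _ => ?_
  rw [← integral_add (M.integrableOn_gradInt i j _ _) (M.integrableOn_gradInt i j _ _)]
  refine setIntegral_congr_fun (isOpen_ctPiece j).measurableSet fun z hz => ?_
  have hg := M.refTri_subset_good i (ctPiece_subset_refTri j hz)
  simp only [gradInt, Pi.add_apply, M.pullGrad_add i j _ _ hg, frob_add_left, mul_add]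

lemma gradVal_smul_left [Fintype ι] (r : ℝ) (x y : ι → Fin 4 → Fin 4 → E) :
    M.gradVal (r • x) y = r * M.gradVal x y := by
  simp only [gradVal, Finset.mul_sum, ← integral_const_mul]
  refine Finset.sum_congr rfl fun i _ => Finset.sum_congr rfl fun j _ => ?_
  refine setIntegral_congr_fun (isOpen_ctPiece j).measurableSet fun z hz => ?_
  have hg := M.refTri_subset_good i (ctPiece_subset_refTri j hz)
  simp only [gradInt, Pi.smul_apply, M.pullGrad_smul i j _ _ hg, frob_smul_left]
  ring

/-- The viscous form as a bilinear form. -/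
def gradForm [Fintype ι] :
    (ι → Fin 4 → Fin 4 → E) →ₗ[ℝ] (ι → Fin 4 → Fin 4 → E) →ₗ[ℝ] ℝ :=
  LinearMap.mk₂ ℝ M.gradVal M.gradVal_add_left M.gradVal_smul_left
    (fun x y y' => by
      rw [gradVal_comm, gradVal_add_left, M.gradVal_comm y, M.gradVal_comm y'])
    (fun r x y => by rw [gradVal_comm, gradVal_smul_left, M.gradVal_comm y]; rfl)

lemma gradForm_apply [Fintype ι] (x y : ι → Fin 4 → Fin 4 → E) :
    M.gradForm x y = ∑ i, ∑ j, ∫ z in ctPiece j, M.gradInt i j (x i) (y i) z := rfl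

lemma integral_gradDot [Fintype ι] {u v : E → E} {x y : ι → Fin 4 → Fin 4 → E}
    (hu : M.HasVelData u x) (hv : M.HasVelData v y) (ν : ℝ) :
    ∫ z in M.Omega, ν * gradDot u v z = ν * M.gradForm x y := by
  have h : ∀ i j, ∀ z ∈ ctPiece j,
      M.jacDet i z * gradDot u v (M.F i z) = M.gradInt i j (x i) (y i) z := by
    intro i j z hz
    rw [gradDot_eq_frob, hu.fderiv_eq i hz, hv.fderiv_eq i hz]; rfl
  rw [integral_const_mul, integral_Omega, gradForm_apply]
  · congr 1
    exact Finset.sum_congr rfl fun i _ => Finset.sum_congr rfl fun j _ =>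
      setIntegral_congr_fun (isOpen_ctPiece j).measurableSet fun z hz => h i j z hz
  · intro i j
    exact (M.integrableOn_gradInt i j (x i) (y i)).congr_fun (fun z hz => (h i j z hz).symm)
      (isOpen_ctPiece j).measurableSet

/-! ### The divergence -/

/-- The Piola transform preserves the divergence. -/
lemma jacDet_mul_divergence (i : ι) {W : E → E} {z : E} (hz : z ∈ M.good i)
    (hW : DifferentiableAt ℝ W z) {A : E →L[ℝ] E}
    (hA : A = (M.jacDet i z)⁻¹ •
      (fderiv ℝ (fun z => M.piola i z (W z)) z ∘L adj (fderiv ℝ (M.F i) z))) :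
    M.jacDet i z * (A (eb 0) 0 + A (eb 1) 1) = divergence W z := by
  have hJ0 : M.jacDet i z ≠ 0 := ne_of_gt hz
  have hB : HasFDerivAt (fderiv ℝ (M.F i)) (fderiv ℝ (fderiv ℝ (M.F i)) z) z :=
    ((M.contDiff_fderiv_F i (n := 1)).differentiable (by simp) z).hasFDerivAt
  -- Symmetry of the second derivative is the analytic content of the Piola identity. Once it is
  -- used, the rest is algebra in the components of `DF`, `D²F`, `W` and `DW`.
  have hsym : ∀ v w, fderiv ℝ (fderiv ℝ (M.F i)) z v w = fderiv ℝ (fderiv ℝ (M.F i)) z w v :=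
    fun v w => ((M.contDiff_F i (n := 2)).contDiffAt.isSymmSndFDerivAt (by simp)).eq v w
  set B' := fderiv ℝ (fderiv ℝ (M.F i)) z
  have hBkm : ∀ k m : Fin 2, HasFDerivAt (fun z => fderiv ℝ (M.F i) z (eb k) m)
      (((coordL m).comp (ContinuousLinearMap.apply ℝ E (eb k))).comp B') z := fun k m =>
    (((coordL m).comp (ContinuousLinearMap.apply ℝ E (eb k))).hasFDerivAt).comp z hB
  have hJ := ((hBkm 0 0).mul (hBkm 1 1)).sub ((hBkm 1 0).mul (hBkm 0 1))
  have hJeq : M.jacDet i = fun z => fderiv ℝ (M.F i) z (eb 0) 0 * fderiv ℝ (M.F i) z (eb 1) 1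
      - fderiv ℝ (M.F i) z (eb 1) 0 * fderiv ℝ (M.F i) z (eb 0) 1 := funext fun z => clm_det _
  have hJinv : HasFDerivAt (fun z => (M.jacDet i z)⁻¹) _ z :=
    (hasFDerivAt_inv hJ0).comp z (by rw [hJeq]; exact hJ)
  have hU := hJinv.smul (hB.clm_apply hW.hasFDerivAt)
  have hU' : fderiv ℝ (fun z => M.piola i z (W z)) z = _ := hU.fderiv
  rw [hU'] at hA
  have hJz : M.jacDet i z = fderiv ℝ (M.F i) z (eb 0) 0 * fderiv ℝ (M.F i) z (eb 1) 1
      - fderiv ℝ (M.F i) z (eb 1) 0 * fderiv ℝ (M.F i) z (eb 0) 1 := clm_det _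
  rw [hA, divergence_eq_of_hasFDerivAt hW.hasFDerivAt]
  set B := fderiv ℝ (M.F i) z
  set W' := fderiv ℝ W z
  have e0 : adj B (eb 0) = B (eb 1) 1 • eb 0 - B (eb 0) 1 • eb 1 := by
    rw [adj_apply]; ext m; fin_cases m <;> simp [eb_apply]
  have e1 : adj B (eb 1) = B (eb 0) 0 • eb 1 - B (eb 1) 0 • eb 0 := by
    rw [adj_apply]; ext m; fin_cases m <;> simp [eb_apply]
  have hBW := clm_apply_eq B (W z)
  have hBW0 := clm_apply_eq B (W' (eb 0))
  have hBW1 := clm_apply_eq B (W' (eb 1))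
  have hD0 := clm_apply_eq (B' (eb 0)) (W z)
  have hD1 := clm_apply_eq (B' (eb 1)) (W z)
  have hs := hsym (eb 1) (eb 0)
  simp only [_root_.smul_apply, ContinuousLinearMap.comp_apply, e0, e1, map_sub, map_smul,
    _root_.add_apply, _root_.sub_apply, ContinuousLinearMap.smulRight_apply, PiLp.add_apply,
    PiLp.sub_apply, PiLp.smul_apply, smul_eq_mul, ContinuousLinearMap.flip_apply,
    ContinuousLinearMap.apply_apply, coordL_apply, hBW, hBW0, hBW1, hD0, hD1, hs,
    ContinuousLinearMap.toSpanSingleton_apply]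
  generalize M.jacDet i z = J at hJ0 hJz
  field_simp
  rw [hJz]
  ring

end IsoMesh

lemma divergence_add {v w : E → E} {x : E} (hv : DifferentiableAt ℝ v x)
    (hw : DifferentiableAt ℝ w x) :
    divergence (v + w) x = divergence v x + divergence w x := by
  rw [divergence_eq_of_hasFDerivAt (hv.hasFDerivAt.add hw.hasFDerivAt),
    divergence_eq_of_hasFDerivAt hv.hasFDerivAt, divergence_eq_of_hasFDerivAt hw.hasFDerivAt]
  simp only [_root_.add_apply, PiLp.add_apply]
  ring

lemma divergence_smul {v : E → E} {x : E} (r : ℝ) (hv : DifferentiableAt ℝ v x) :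
    divergence (r • v) x = r * divergence v x := by
  rw [divergence_eq_of_hasFDerivAt (hv.hasFDerivAt.const_smul r),
    divergence_eq_of_hasFDerivAt hv.hasFDerivAt]
  simp only [_root_.smul_apply, PiLp.smul_apply, smul_eq_mul]
  ring

lemma differentiable_interp (j : Fin 3) (ξ : Fin 4 → Fin 4 → E) :
    Differentiable ℝ (interp j ξ) := (contDiff_interp j ξ (n := 1)).differentiable (by simp)

lemma continuous_divergence_interp (j : Fin 3) (ξ : Fin 4 → Fin 4 → E) :
    Continuous (divergence (interp j ξ)) := by
  have h : Continuous (fderiv ℝ (interp j ξ)) :=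
    (contDiff_interp j ξ (n := 1)).continuous_fderiv (by simp)
  have h' : ∀ k m : Fin 2, Continuous fun z => fderiv ℝ (interp j ξ) z (eb k) m := fun k m =>
    ((coordL m).comp (ContinuousLinearMap.apply ℝ E (eb k))).continuous.comp h
  have : divergence (interp j ξ)
      = fun z => fderiv ℝ (interp j ξ) z (eb 0) 0 + fderiv ℝ (interp j ξ) z (eb 1) 1 :=
    funext fun z => divergence_eq_of_hasFDerivAt (differentiable_interp j ξ z).hasFDerivAt
  rw [this]
  exact (h' 0 0).add (h' 1 1)

lemma divergence_interp_add (j : Fin 3) (ξ η : Fin 4 → Fin 4 → E) (z : E) :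
    divergence (interp j (ξ + η)) z = divergence (interp j ξ) z + divergence (interp j η) z := by
  have h : interp j (ξ + η) = interp j ξ + interp j η := funext fun z => interp_add j ξ η z
  rw [h, divergence_add (differentiable_interp j ξ z) (differentiable_interp j η z)]

lemma divergence_interp_smul (j : Fin 3) (r : ℝ) (ξ : Fin 4 → Fin 4 → E) (z : E) :
    divergence (interp j (r • ξ)) z = r * divergence (interp j ξ) z := by
  have h : interp j (r • ξ) = r • interp j ξ := funext fun z => interp_smul j r ξ z
  rw [h, divergence_smul r (differentiable_interp j ξ z)]

/-- The affine function with given coefficients. -/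
def affVal (c : Fin 3 → ℝ) (z : E) : ℝ := c 0 + c 1 * z 0 + c 2 * z 1

@[fun_prop]
lemma continuous_affVal (c : Fin 3 → ℝ) : Continuous (affVal c) := by
  unfold affVal; fun_prop

lemma integrableOn_divergence_interp (j : Fin 3) (ξ : Fin 4 → Fin 4 → E) (c : Fin 3 → ℝ) :
    IntegrableOn (fun z => divergence (interp j ξ) z * affVal c z) (ctPiece j) :=
  integrableOn_ctPiece
    ((continuous_divergence_interp j ξ).mul (continuous_affVal c)).continuousOn j

/-- The divergence form on one triangle of the split. -/
def divInt (j : Fin 3) (ξ : Fin 4 → Fin 4 → E) (c : Fin 3 → ℝ) : ℝ :=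
  ∫ z in ctPiece j, divergence (interp j ξ) z * affVal c z

lemma divInt_add_left (j : Fin 3) (ξ η : Fin 4 → Fin 4 → E) (c : Fin 3 → ℝ) :
    divInt j (ξ + η) c = divInt j ξ c + divInt j η c := by
  rw [divInt, divInt, divInt, ← integral_add (integrableOn_divergence_interp j ξ c)
    (integrableOn_divergence_interp j η c)]
  simp only [divergence_interp_add, add_mul]

lemma divInt_smul_left (j : Fin 3) (r : ℝ) (ξ : Fin 4 → Fin 4 → E) (c : Fin 3 → ℝ) :
    divInt j (r • ξ) c = r * divInt j ξ c := by
  rw [divInt, divInt, ← integral_const_mul]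
  simp only [divergence_interp_smul, mul_assoc]

lemma divInt_add_right (j : Fin 3) (ξ : Fin 4 → Fin 4 → E) (c d : Fin 3 → ℝ) :
    divInt j ξ (c + d) = divInt j ξ c + divInt j ξ d := by
  rw [divInt, divInt, divInt, ← integral_add (integrableOn_divergence_interp j ξ c)
    (integrableOn_divergence_interp j ξ d)]
  congr 1
  funext z
  simp only [affVal, Pi.add_apply]
  ring

lemma divInt_smul_right (j : Fin 3) (r : ℝ) (ξ : Fin 4 → Fin 4 → E) (c : Fin 3 → ℝ) :
    divInt j ξ (r • c) = r * divInt j ξ c := by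
  rw [divInt, divInt, ← integral_const_mul]
  congr 1
  funext z
  simp only [affVal, Pi.smul_apply, smul_eq_mul]
  ring

namespace IsoMesh

variable {ι : Type*} (M : IsoMesh ι)

/-- The divergence form as a bilinear form on nodal values and pressure coefficients. -/
def divForm [Fintype ι] :
    (ι → Fin 4 → Fin 4 → E) →ₗ[ℝ] (ι → Fin 3 → Fin 3 → ℝ) →ₗ[ℝ] ℝ :=
  LinearMap.mk₂ ℝ (fun x y => ∑ i, ∑ j, divInt j (M.pullData i (x i)) (y i j))
    (fun x x' y => by
      simp only [Pi.add_apply, pullData_add, divInt_add_left, Finset.sum_add_distrib])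
    (fun r x y => by
      simp only [Pi.smul_apply, pullData_smul, divInt_smul_left, smul_eq_mul, Finset.mul_sum])
    (fun x y y' => by
      simp only [Pi.add_apply, divInt_add_right, Finset.sum_add_distrib])
    (fun r x y => by
      simp only [Pi.smul_apply, divInt_smul_right, smul_eq_mul, Finset.mul_sum])

lemma divForm_apply [Fintype ι] (x : ι → Fin 4 → Fin 4 → E) (y : ι → Fin 3 → Fin 3 → ℝ) :
    M.divForm x y = ∑ i, ∑ j, divInt j (M.pullData i (x i)) (y i j) := rfl

lemma integral_divergence [Fintype ι] {v : E → E} {x : ι → Fin 4 → Fin 4 → E} {q : E → ℝ}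
    {y : ι → Fin 3 → Fin 3 → ℝ} (hv : M.HasVelData v x) (hq : M.HasPresData q y) :
    ∫ z in M.Omega, divergence v z * q z = M.divForm x y := by
  have h : ∀ i j, ∀ z ∈ ctPiece j, M.jacDet i z * (divergence v (M.F i z) * q (M.F i z))
      = divergence (interp j (M.pullData i (x i))) z * affVal (y i j) z := by
    intro i j z hz
    rw [← M.jacDet_mul_divergence i (M.refTri_subset_good i (ctPiece_subset_refTri j hz))
      (differentiable_interp j (M.pullData i (x i)) z) rfl, hq i j z hz, affVal,
      divergence_eq_of_hasFDerivAt (hv.hasFDerivAt i hz), mul_assoc]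
    rfl
  rw [integral_Omega, divForm_apply]
  · exact Finset.sum_congr rfl fun i _ => Finset.sum_congr rfl fun j _ =>
      setIntegral_congr_fun (isOpen_ctPiece j).measurableSet fun z hz => h i j z hz
  · intro i j
    exact (integrableOn_divergence_interp j (M.pullData i (x i)) (y i j)).congr_fun
      (fun z hz => (h i j z hz).symm) (isOpen_ctPiece j).measurableSet

/-! ### The load -/

lemma volume_Omega_ne_top [Finite ι] : volume M.Omega ≠ ⊤ := by
  have h : IsCompact (⋃ i, M.elt i) := isCompact_iUnion fun i =>
    refTri_isCompact.image (M.contDiff_F i (n := 0)).continuous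
  exact ((measure_mono interior_subset).trans_lt h.measure_lt_top).ne

variable {f : E → E}

lemma integrableOn_load [Finite ι] (hf : MemLp f 2 (volume.restrict M.Omega)) (i : ι) (j : Fin 3) (ξ : Fin 4 → Fin 4 → E) :
    IntegrableOn (fun z => M.jacDet i z * inner ℝ (f (M.F i z)) (M.pullVel i j ξ z))
      (ctPiece j) := by
  have : IsFiniteMeasure (volume.restrict M.Omega) :=
    ⟨by rw [Measure.restrict_apply_univ]; exact M.volume_Omega_ne_top.lt_top⟩
  have h1 : IntegrableOn f (M.piece (i, j)) :=
    IntegrableOn.mono_set (hf.integrable one_le_two)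
      (M.F_image_subset_Omega _ (isOpen_ctPiece _) (ctPiece_subset_refTri _))
  have h2 := (M.integrableOn_piece_iff i j).1 h1
  have h3 : ∀ m : Fin 2, IntegrableOn
      (fun z => (M.jacDet i z * f (M.F i z) m) * M.pullVel i j ξ z m) (ctPiece j) := by
    intro m
    have h4 : IntegrableOn (fun z => M.jacDet i z * f (M.F i z) m) (ctPiece j) :=
      (coordL m).integrable_comp h2
    refine h4.mul_continuousOn_of_subset ?_ (isOpen_ctPiece j).measurableSet refTri_isCompact
      (ctPiece_subset_refTri j)
    exact (coordL m).continuous.comp_continuousOn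
      (((M.contDiffOn_pullVel i j ξ (n := 0)).continuousOn).mono (M.refTri_subset_good i))
  refine ((h3 0).add (h3 1)).congr_fun (fun z _ => ?_) (isOpen_ctPiece j).measurableSet
  simp only [PiLp.inner_apply, Fin.sum_univ_two, Pi.add_apply, RCLike.inner_apply, conj_trivial]
  ring

/-- The right hand side as a linear form on nodal values. -/
def load [Fintype ι] (hf : MemLp f 2 (volume.restrict M.Omega)) : (ι → Fin 4 → Fin 4 → E) →ₗ[ℝ] ℝ where
  toFun x := ∑ i, ∑ j, ∫ z in ctPiece j,
    M.jacDet i z * inner ℝ (f (M.F i z)) (M.pullVel i j (x i) z)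
  map_add' x y := by
    simp only [← Finset.sum_add_distrib]
    refine Finset.sum_congr rfl fun i _ => Finset.sum_congr rfl fun j _ => ?_
    rw [← integral_add (M.integrableOn_load hf i j _) (M.integrableOn_load hf i j _)]
    simp only [Pi.add_apply, pullVel_add, inner_add_right, mul_add]
  map_smul' r x := by
    simp only [Finset.mul_sum, ← integral_const_mul, smul_eq_mul, RingHom.id_apply]
    refine Finset.sum_congr rfl fun i _ => Finset.sum_congr rfl fun j _ => ?_
    congr 1
    funext z
    rw [Pi.smul_apply, pullVel_smul, inner_smul_right]
    ring

lemma integral_load [Fintype ι] (hf : MemLp f 2 (volume.restrict M.Omega)) {v : E → E} {x : ι → Fin 4 → Fin 4 → E}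
    (hv : M.HasVelData v x) : ∫ z in M.Omega, inner ℝ (f z) (v z) = M.load hf x := by
  have h : ∀ i j, ∀ z ∈ ctPiece j, M.jacDet i z * inner ℝ (f (M.F i z)) (v (M.F i z))
      = M.jacDet i z * inner ℝ (f (M.F i z)) (M.pullVel i j (x i) z) := by
    intro i j z hz
    rw [hv i j z hz]
  rw [integral_Omega]
  · exact Finset.sum_congr rfl fun i _ => Finset.sum_congr rfl fun j _ =>
      setIntegral_congr_fun (isOpen_ctPiece j).measurableSet fun z hz => h i j z hz
  · intro i j
    exact (M.integrableOn_load hf i j (x i)).congr_fun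
      (fun z hz => (h i j z hz).symm) (isOpen_ctPiece j).measurableSet

end IsoMesh

/-! ### Definiteness of the viscous form -/

lemma AffineMesh.exists_affMap_eq {ι : Type*} (M : AffineMesh ι) {y : E} (hy : y ∈ M.domain) :
    ∃ i, ∃ x ∈ refTri, M.affMap i x = y := by
  obtain ⟨i, hi⟩ := mem_iUnion.1 (interior_subset hy)
  exact ⟨i, M.affInv i y, M.affInv_mem_refTri hi, M.affMap_affInv i y⟩

namespace IsoMesh

variable {ι : Type*} (M : IsoMesh ι)

lemma pullVel_node {i : ι} {j : Fin 3} {ξ : Fin 4 → Fin 4 → E} (hs : ∀ k l, ξ k l = ξ l k)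
    {k l : Fin 4} (hk : k ≠ j.castSucc) (hl : l ≠ j.castSucc) :
    M.pullVel i j ξ (node k l) = ξ k l := by
  rw [pullVel, interp_node (fun a b => by rw [pullData, pullData, node_comm, hs]) hk hl, pullData,
    M.piola_adj i (node_mem_refTri k l)]

lemma gradInt_self_nonneg (i : ι) (j : Fin 3) (ξ : Fin 4 → Fin 4 → E) {z : E} (hz : z ∈ refTri) :
    0 ≤ M.gradInt i j ξ ξ z :=
  mul_nonneg (M.jacDet_pos i hz).le (frob_self_nonneg _)

lemma integral_gradInt_self_nonneg (i : ι) (j : Fin 3) (ξ : Fin 4 → Fin 4 → E) :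
    0 ≤ ∫ z in ctPiece j, M.gradInt i j ξ ξ z :=
  setIntegral_nonneg (isOpen_ctPiece j).measurableSet fun _ hz =>
    M.gradInt_self_nonneg i j ξ (ctPiece_subset_refTri j hz)

/-- Velocities without viscous energy are constant on every triangle of the split. -/
lemma eq_of_integral_gradInt_eq_zero {i : ι} {j : Fin 3} {ξ : Fin 4 → Fin 4 → E}
    (hs : ∀ k l, ξ k l = ξ l k) (h : ∫ z in ctPiece j, M.gradInt i j ξ ξ z = 0) :
    ∃ c, ∀ k l, k ≠ j.castSucc → l ≠ j.castSucc → ξ k l = c := by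
  have hae : M.gradInt i j ξ ξ =ᵐ[volume.restrict (ctPiece j)] 0 := by
    refine (setIntegral_eq_zero_iff_of_nonneg_ae ?_ (M.integrableOn_gradInt i j ξ ξ)).1 h
    filter_upwards [ae_restrict_mem (isOpen_ctPiece j).measurableSet] with z hz
    exact M.gradInt_self_nonneg i j ξ (ctPiece_subset_refTri j hz)
  -- The integrand is continuous, so vanishing almost everywhere means vanishing at every point of
  -- the open triangle.
  have hz0 : EqOn (M.gradInt i j ξ ξ) 0 (ctPiece j) :=
    Measure.eqOn_open_of_ae_eq hae (isOpen_ctPiece j)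
      ((M.continuousOn_gradInt i j ξ ξ).mono (ctPiece_subset_refTri j)) continuousOn_const
  have hf0 : EqOn (fderiv ℝ (M.pullVel i j ξ)) 0 (ctPiece j) := by
    intro z hz
    have hJ := M.jacDet_pos i (ctPiece_subset_refTri j hz)
    have h1 : M.pullGrad i j ξ z = 0 :=
      eq_zero_of_frob_self ((mul_eq_zero.1 (hz0 hz)).resolve_left hJ.ne')
    refine ContinuousLinearMap.ext fun w => ?_
    have h2 : (M.jacDet i z)⁻¹ • fderiv ℝ (M.pullVel i j ξ) z
        (adj (fderiv ℝ (M.F i) z) (fderiv ℝ (M.F i) z w)) = 0 :=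
      congrArg (fun A : E →L[ℝ] E => A (fderiv ℝ (M.F i) z w)) h1
    rw [adj_apply_apply, map_smul, smul_smul] at h2
    change ((M.jacDet i z)⁻¹ * M.jacDet i z) • _ = (0 : E) at h2
    rwa [inv_mul_cancel₀ hJ.ne', one_smul] at h2
  obtain ⟨y, hy⟩ := ctPiece_nonempty j
  refine ⟨M.pullVel i j ξ y, fun k l hk hl => ?_⟩
  have hc : EqOn (M.pullVel i j ξ) (fun _ => M.pullVel i j ξ y) (ctPiece j) := fun z hz =>
    (isOpen_ctPiece j).is_const_of_fderiv_eq_zero (ctPiece_convex j).isPreconnected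
      (fun w hw => (M.differentiableAt_pullVel i j ξ (M.refTri_subset_good i
        (ctPiece_subset_refTri j hw))).differentiableWithinAt) hf0 hz hy
  rw [← M.pullVel_node hs hk hl]
  -- The nodes are on the boundary of the open triangle; they are reached by continuity.
  exact hc.of_subset_closure ((M.contDiffOn_pullVel i j ξ (n := 0)).continuousOn.mono
    ((ctTri_subset_refTri j).trans (M.refTri_subset_good i))) continuousOn_const
    (ctPiece_subset_ctTri j) (ctTri_subset_closure j) (node_mem_ctTri hk hl)

/-- The viscous form is definite. -/
lemma eq_zero_of_gradForm_self [Fintype ι] {x : ι → Fin 4 → Fin 4 → E}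
    (hx : x ∈ M.toAffineMesh.velData) (h : M.gradForm x x = 0) : x = 0 := by
  have hs := M.toAffineMesh.velData_symm hx
  rw [gradForm_apply, Finset.sum_eq_zero_iff_of_nonneg fun i _ =>
    Finset.sum_nonneg fun j _ => M.integral_gradInt_self_nonneg i j _] at h
  -- Index `3` is the barycenter, which belongs to every triangle of the split and so fixes one
  -- constant per element.
  have hloc : ∀ i k l, x i k l = x i 3 3 := by
    intro i k l
    obtain ⟨j, hk, hl⟩ := exists_ne_castSucc k l
    have h1 := h i (Finset.mem_univ i)
    rw [Finset.sum_eq_zero_iff_of_nonneg fun j _ => M.integral_gradInt_self_nonneg i j _] at h1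
    obtain ⟨c, hc⟩ := M.eq_of_integral_gradInt_eq_zero (hs i) (h1 j (Finset.mem_univ j))
    have h3 : (3 : Fin 4) ≠ j.castSucc := (Fin.castSucc_lt_last j).ne'
    rw [hc k l hk hl, hc 3 3 h3 h3]
  obtain ⟨v, hv, hxv⟩ := id hx
  have hvert : ∀ i (k : Fin 3), v (M.vert i k) = x i 3 3 := fun i k => by
    rw [← hloc i k.castSucc k.castSucc, hxv, node_self, M.toAffineMesh.affMap_ctVert]
  -- The constants of adjacent elements are both the value of the affine field at a common vertex.
  have hconst := M.toAffineMesh.eq_of_sharesEdge (fun i => x i 3 3) fun i j k l hij => by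
    rw [← hvert i (k + 1), hij.2.1, hvert]
  obtain ⟨y, hy⟩ := M.toAffineMesh.domain_nonempty
  obtain ⟨i₀, -⟩ := M.toAffineMesh.exists_affMap_eq hy
  have hvc : ∀ y ∈ M.domain, v y = x i₀ 3 3 := by
    intro y hy
    obtain ⟨i, z, hz, rfl⟩ := M.toAffineMesh.exists_affMap_eq hy
    obtain ⟨vhat, hvhat, hvz⟩ := hv.2 i
    have hd : (fun k l => vhat (node k l)) = fun _ _ => x i₀ 3 3 := by
      funext k l
      rw [← hvz _ (node_mem_refTri k l), ← hxv, hloc]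
      exact hconst i i₀
    rw [hvz z hz, ← ginterp_eq_of_isPolyOn hvhat.2 hz, hd]
    obtain ⟨j, hj⟩ := exists_mem_ctTri hz
    rw [ginterp_eq_interp hj]
    exact quadInterp_const (sum_ctHat j z) _
  have hc0 := hv.1.const_eq_zero M.toAffineMesh.domain_isOpen M.toAffineMesh.domain_nonempty
    M.toAffineMesh.domain_bounded hvc
  funext i k l
  rw [hloc, show x i 3 3 = x i₀ 3 3 from hconst i i₀, hc0]
  rfl

end IsoMesh

/-! ### Integration of quadratic polynomials -/

/-- The quadratic polynomial with given coefficients. -/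
def quadVal (c : Fin 6 → ℝ) (s t : ℝ) : ℝ :=
  c 0 + c 1 * s + c 2 * t + c 3 * s ^ 2 + c 4 * (s * t) + c 5 * t ^ 2

lemma integral_quadVal (c : Fin 6 → ℝ) (s b : ℝ) : ∫ t in (0 : ℝ)..b, quadVal c s t
    = (c 0 + c 1 * s + c 3 * s ^ 2) * b + (c 2 + c 4 * s) * (b ^ 2 / 2) + c 5 * (b ^ 3 / 3) := by
  have h : ∀ t ∈ uIcc 0 b, HasDerivAt (fun t => (c 0 + c 1 * s + c 3 * s ^ 2) * t
      + (c 2 + c 4 * s) * (t ^ 2 / 2) + c 5 * (t ^ 3 / 3)) (quadVal c s t) t := by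
    intro t _
    have h1 := (((hasDerivAt_id t).const_mul (c 0 + c 1 * s + c 3 * s ^ 2)).add
      (((hasDerivAt_pow 2 t).div_const 2).const_mul (c 2 + c 4 * s))).add
      (((hasDerivAt_pow 3 t).div_const 3).const_mul (c 5))
    refine h1.congr_deriv ?_
    simp only [quadVal]
    norm_num
    ring
  rw [intervalIntegral.integral_eq_sub_of_hasDerivAt h
    (Continuous.intervalIntegrable (by unfold quadVal; fun_prop) _ _)]
  ring

lemma integral_integral_quadVal (c : Fin 6 → ℝ) :
    ∫ s in (0 : ℝ)..1, ∫ t in (0 : ℝ)..(1 - s), quadVal c s t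
      = c 0 / 2 + c 1 / 6 + c 2 / 6 + c 3 / 12 + c 4 / 24 + c 5 / 12 := by
  simp only [integral_quadVal]
  have h : ∀ s ∈ uIcc (0 : ℝ) 1, HasDerivAt (fun s => c 0 * (s - s ^ 2 / 2)
      + c 1 * (s ^ 2 / 2 - s ^ 3 / 3) + c 3 * (s ^ 3 / 3 - s ^ 4 / 4) - c 2 * (1 - s) ^ 3 / 6
      + c 4 / 2 * (s ^ 2 / 2 - 2 * s ^ 3 / 3 + s ^ 4 / 4) - c 5 * (1 - s) ^ 4 / 12)
      ((c 0 + c 1 * s + c 3 * s ^ 2) * (1 - s) + (c 2 + c 4 * s) * ((1 - s) ^ 2 / 2)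
        + c 5 * ((1 - s) ^ 3 / 3)) s := by
    intro s _
    have hs := (hasDerivAt_id s).const_sub 1
    have h1 := (((((((hasDerivAt_id s).sub ((hasDerivAt_pow 2 s).div_const 2)).const_mul (c 0)).add
      ((((hasDerivAt_pow 2 s).div_const 2).sub ((hasDerivAt_pow 3 s).div_const 3)).const_mul
        (c 1))).add
      ((((hasDerivAt_pow 3 s).div_const 3).sub ((hasDerivAt_pow 4 s).div_const 4)).const_mul
        (c 3))).sub (((hs.pow 3).const_mul (c 2)).div_const 6)).add
      (((((hasDerivAt_pow 2 s).div_const 2).sub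
        (((hasDerivAt_pow 3 s).const_mul 2).div_const 3)).add
        ((hasDerivAt_pow 4 s).div_const 4)).const_mul (c 4 / 2))).sub
      (((hs.pow 4).const_mul (c 5)).div_const 12)
    refine h1.congr_deriv ?_
    norm_num
    ring
  rw [intervalIntegral.integral_eq_sub_of_hasDerivAt h
    (Continuous.intervalIntegrable (by fun_prop) _ _)]
  norm_num
  ring

/-- The open reference triangle. -/
def openTri : Set E := {z | 0 < z 0 ∧ 0 < z 1 ∧ z 0 + z 1 < 1}

lemma integral_openTri (c : Fin 6 → ℝ) : ∫ z in openTri, quadVal c (z 0) (z 1)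
    = c 0 / 2 + c 1 / 6 + c 2 / 6 + c 3 / 12 + c 4 / 24 + c 5 / 12 := by
  let R : Set (ℝ × ℝ) := {p | 0 < p.1 ∧ 0 < p.2 ∧ p.1 + p.2 < 1}
  have hR : MeasurableSet R := by
    refine IsOpen.measurableSet ?_
    exact (isOpen_lt continuous_const continuous_fst).inter
      ((isOpen_lt continuous_const continuous_snd).inter
        (isOpen_lt (continuous_fst.add continuous_snd) continuous_const))
  let φ : E ≃ᵐ ℝ × ℝ :=
    (MeasurableEquiv.toLp 2 (Fin 2 → ℝ)).symm.trans MeasurableEquiv.finTwoArrow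
  have hφ : MeasurePreserving φ volume volume :=
    (volume_preserving_finTwoArrow ℝ).comp (EuclideanSpace.volume_preserving_symm_measurableEquiv_toLp (Fin 2))
  have h1 : ∫ z in openTri, quadVal c (z 0) (z 1) = ∫ p in R, quadVal c p.1 p.2 :=
    hφ.setIntegral_preimage_emb φ.measurableEmbedding (fun p => quadVal c p.1 p.2) R
  have hcont : Continuous fun p : ℝ × ℝ => quadVal c p.1 p.2 := by unfold quadVal; fun_prop
  have hint : Integrable (R.indicator fun p : ℝ × ℝ => quadVal c p.1 p.2) := by
    rw [integrable_indicator_iff hR]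
    refine (hcont.continuousOn.integrableOn_compact
      (isCompact_Icc (a := ((0 : ℝ), (0 : ℝ))) (b := (1, 1)))).mono_set fun p hp => ?_
    obtain ⟨h1, h2, h3⟩ := hp
    exact ⟨⟨h1.le, h2.le⟩, ⟨by dsimp; linarith, by dsimp; linarith⟩⟩
  rw [h1, ← integral_indicator hR, Measure.volume_eq_prod, integral_prod _ hint,
    ← integral_integral_quadVal, intervalIntegral.integral_of_le zero_le_one,
    integral_Ioc_eq_integral_Ioo, ← integral_indicator measurableSet_Ioo]
  congr 1
  funext s
  by_cases hs : s ∈ Ioo (0 : ℝ) 1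
  · rw [indicator_of_mem hs, intervalIntegral.integral_of_le (by linarith [hs.2]),
      integral_Ioc_eq_integral_Ioo, ← integral_indicator measurableSet_Ioo]
    congr 1
    funext t
    have h2 : (s, t) ∈ R ↔ t ∈ Ioo 0 (1 - s) :=
      ⟨fun h => ⟨h.2.1, by have := h.2.2; dsimp at this; linarith⟩,
        fun h => ⟨hs.1, h.1, by have := h.2; dsimp; linarith⟩⟩
    by_cases ht : t ∈ Ioo 0 (1 - s)
    · rw [indicator_of_mem ht, indicator_of_mem (h2.2 ht)]
    · rw [indicator_of_notMem ht, indicator_of_notMem (fun h => ht (h2.1 h))]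
  · rw [indicator_of_notMem hs]
    refine integral_eq_zero_of_ae (Eventually.of_forall fun t => indicator_of_notMem (fun h => hs ?_) _)
    exact ⟨h.1, by have := h.2.1; have := h.2.2; dsimp at *; linarith⟩

/-! ### Exact integration on the triangles of the split -/

/-- The affine map of the reference triangle onto the `j`-th triangle of the split. -/
def ctMap (j : Fin 3) (z : E) : E :=
  z 0 • ctVert (j + 1).castSucc + z 1 • ctVert (j + 2).castSucc + (1 - z 0 - z 1) • ctVert 3

/-- The linear part of `ctMap`. -/
def ctLin (j : Fin 3) : E →L[ℝ] E :=
  (coordL 0).smulRight (ctVert (j + 1).castSucc - ctVert 3)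
    + (coordL 1).smulRight (ctVert (j + 2).castSucc - ctVert 3)

lemma ctMap_eq (j : Fin 3) (z : E) : ctMap j z = ctLin j z + ctVert 3 := by
  simp only [ctMap, ctLin, _root_.add_apply, ContinuousLinearMap.smulRight_apply, coordL_apply]
  module

lemma hasFDerivAt_ctMap (j : Fin 3) (z : E) : HasFDerivAt (ctMap j) (ctLin j) z := by
  have : ctMap j = fun z => ctLin j z + ctVert 3 := funext (ctMap_eq j)
  rw [this]
  exact (ctLin j).hasFDerivAt.add_const _

lemma det_ctLin (j : Fin 3) : (ctLin j).det = 1 / 3 := by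
  rw [clm_det]
  fin_cases j <;> simp [ctLin, ctVert, eb_apply] <;> norm_num

lemma bary_ctMap (j k : Fin 3) (z : E) : bary k (ctMap j z)
    = (if k = j + 1 then z 0 else if k = j + 2 then z 1 else 0) + (1 - z 0 - z 1) / 3 := by
  fin_cases j <;> fin_cases k <;> simp [ctMap, ctVert] <;> ring

lemma ctMap_image (j : Fin 3) : ctMap j '' openTri = ctPiece j := by
  have h1 := (fin_three_ne_one j).symm
  have h2 := (fin_three_ne_two j).symm
  have h3 := (fin_three_one_ne_two j).symm
  ext x
  constructor
  · rintro ⟨z, ⟨hz0, hz1, hz⟩, rfl⟩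
    refine ⟨?_, fun k hk => ?_⟩
    · rw [bary_ctMap, if_neg h1.symm, if_neg h2.symm]; linarith
    · rw [bary_ctMap, bary_ctMap, if_neg h1.symm, if_neg h2.symm]
      have hk' : k = j + 1 ∨ k = j + 2 := by revert j k; decide
      rcases hk' with rfl | rfl
      · rw [if_pos rfl]; linarith
      · rw [if_neg h3, if_pos rfl]; linarith
  · rintro ⟨hj, hk⟩
    have e1 := hk _ h1
    have e2 := hk _ h2
    have hs : bary (j + 1) x + bary (j + 2) x + bary j x = 1 := by
      rw [← sum_bary x, sum_fin_three j]; ring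
    refine ⟨!₂[bary (j + 1) x - bary j x, bary (j + 2) x - bary j x], ⟨?_, ?_, ?_⟩, ?_⟩
    · simpa using e1
    · simpa using e2
    · simp; linarith
    · ext m
      fin_cases j <;> fin_cases m <;> simp [ctMap, ctVert] <;> ring

lemma ctMap_injective (j : Fin 3) : Function.Injective (ctMap j) := by
  intro z w h
  have hk := fun k => congrArg (bary k) h
  have h1 := hk (j + 1)
  have h2 := hk (j + 2)
  have h0 := hk j
  have n1 := fin_three_ne_one j
  have n2 := fin_three_ne_two j
  have n3 := (fin_three_one_ne_two j).symm
  simp only [bary_ctMap, if_true, if_neg n1, if_neg n2, if_neg n3] at h0 h1 h2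
  ext m
  fin_cases m
  · change z 0 = w 0; linarith
  · change z 1 = w 1; linarith

/-- Each triangle of the split has a third of the area; the other weights are the integrals of the
monomials over the reference triangle. -/
lemma integral_ctPiece {j : Fin 3} {f : E → ℝ} (c : Fin 6 → ℝ)
    (h : ∀ z, f (ctMap j z) = quadVal c (z 0) (z 1)) : ∫ x in ctPiece j, f x
      = (c 0 / 2 + c 1 / 6 + c 2 / 6 + c 3 / 12 + c 4 / 24 + c 5 / 12) / 3 := by
  have hm : MeasurableSet openTri := by
    have : IsOpen openTri := by
      have h0 : Continuous fun z : E => z 0 := by fun_prop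
      have h1 : Continuous fun z : E => z 1 := by fun_prop
      exact (isOpen_lt continuous_const h0).inter ((isOpen_lt continuous_const h1).inter
        (isOpen_lt (h0.add h1) continuous_const))
    exact this.measurableSet
  rw [← ctMap_image, integral_image_eq_integral_abs_det_fderiv_smul volume hm
    (fun z _ => (hasFDerivAt_ctMap j z).hasFDerivWithinAt) (ctMap_injective j).injOn,
    ← integral_openTri c, ← integral_div]
  congr 1
  funext z
  rw [det_ctLin, h, abs_of_pos (by norm_num), smul_eq_mul]
  ring

/-! ### The divergence form in terms of nodal values -/

/-- The trace of a linear map of the plane. -/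
def tr : (E →L[ℝ] E) →ₗ[ℝ] ℝ where
  toFun A := A (eb 0) 0 + A (eb 1) 1
  map_add' A B := by simp only [_root_.add_apply, PiLp.add_apply]; ring
  map_smul' r A := by
    simp only [_root_.smul_apply, PiLp.smul_apply, smul_eq_mul, RingHom.id_apply]; ring

lemma tr_smulRight (L : E →L[ℝ] ℝ) (e : E) : tr (L.smulRight e) = L e := by
  conv_rhs => rw [eq_sum_eb e]
  simp [tr]
  ring

/-- The differentials of the barycentric coordinates. -/
def dBary (k : Fin 3) : E →L[ℝ] ℝ := ![coordL 0, coordL 1, -coordL 0 - coordL 1] k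

lemma sum_dBary (k : Fin 3) (e : E) : dBary k e + dBary (k + 1) e + dBary (k + 2) e = 0 := by
  fin_cases k <;> simp [dBary]; ring

lemma hasFDerivAt_bary (k : Fin 3) (x : E) : HasFDerivAt (bary k) (dBary k) x := by
  have h : bary k = fun x => dBary k x + bary k 0 := by
    funext x; fin_cases k <;> simp [dBary]; ring
  rw [h]
  exact (dBary k).hasFDerivAt.add_const _

/-- The differentials of the barycentric coordinates of the `j`-th triangle of the split. -/
def dHat (j : Fin 3) (k : Fin 4) : E →L[ℝ] ℝ :=
  ![dBary 0 - dBary j, dBary 1 - dBary j, dBary 2 - dBary j, (3 : ℝ) • dBary j] k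

lemma dHat_castSucc (j k : Fin 3) : dHat j k.castSucc = dBary k - dBary j := by
  fin_cases k <;> rfl

lemma dHat_castSucc_apply (j k : Fin 3) (e : E) :
    dHat j k.castSucc e = dBary k e - dBary j e := by
  rw [dHat_castSucc]; rfl

lemma dHat_three_apply (j : Fin 3) (e : E) : dHat j 3 e = 3 * dBary j e := rfl

lemma hasFDerivAt_ctHat (j : Fin 3) (k : Fin 4) (x : E) :
    HasFDerivAt (ctHat j k) (dHat j k) x := by
  induction k using Fin.lastCases with
  | last => exact (hasFDerivAt_bary j x).const_mul 3
  | cast k =>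
    rw [dHat_castSucc, show ctHat j k.castSucc = fun x => bary k x - bary j x from
      funext (ctHat_castSucc j k)]
    exact (hasFDerivAt_bary k x).sub (hasFDerivAt_bary j x)

lemma divergence_interp (j : Fin 3) (ξ : Fin 4 → Fin 4 → E) (x : E) :
    divergence (interp j ξ) x
      = 2 * (∑ k, ∑ l, (ctHat j k x * dHat j l (ξ k l) + ctHat j l x * dHat j k (ξ k l)))
        - ∑ k, dHat j k (ξ k k) := by
  have h1 : ∀ k l, HasFDerivAt (fun x => (ctHat j k x * ctHat j l x) • ξ k l)
      ((ctHat j k x • dHat j l + ctHat j l x • dHat j k).smulRight (ξ k l)) x := fun k l =>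
    ((hasFDerivAt_ctHat j k x).mul (hasFDerivAt_ctHat j l x)).smul_const _
  have h2 : ∀ k, HasFDerivAt (fun x => ctHat j k x • ξ k k) ((dHat j k).smulRight (ξ k k)) x :=
    fun k => (hasFDerivAt_ctHat j k x).smul_const _
  have h3 : HasFDerivAt (interp j ξ) ((2 : ℝ) • (∑ k, ∑ l,
      (ctHat j k x • dHat j l + ctHat j l x • dHat j k).smulRight (ξ k l))
      - ∑ k, (dHat j k).smulRight (ξ k k)) x :=
    ((HasFDerivAt.fun_sum fun k _ => HasFDerivAt.fun_sum fun l _ => h1 k l).const_smul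
      (2 : ℝ)).sub (HasFDerivAt.fun_sum fun k _ => h2 k)
  rw [divergence_eq_of_hasFDerivAt h3]
  change tr _ = _
  simp only [map_sub, map_smul, map_sum, tr_smulRight, _root_.add_apply, _root_.smul_apply,
    smul_eq_mul]

lemma ctHat_ctMap (j : Fin 3) (z : E) : ctHat j j.castSucc (ctMap j z) = 0 ∧
    ctHat j (j + 1).castSucc (ctMap j z) = z 0 ∧ ctHat j (j + 2).castSucc (ctMap j z) = z 1 ∧
    ctHat j 3 (ctMap j z) = 1 - z 0 - z 1 := by
  have n1 := fin_three_ne_one j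
  have n2 := fin_three_ne_two j
  have n3 := (fin_three_one_ne_two j).symm
  simp only [ctHat_castSucc, ctHat_three, bary_ctMap, if_true, if_neg n1, if_neg n2, if_neg n3]
  refine ⟨?_, ?_, ?_, ?_⟩ <;> ring

lemma affVal_ctMap (j : Fin 3) (c : Fin 3 → ℝ) (z : E) : affVal c (ctMap j z)
    = z 0 * affVal c (ctVert (j + 1).castSucc) + z 1 * affVal c (ctVert (j + 2).castSucc)
      + (1 - z 0 - z 1) * affVal c (ctVert 3) := by
  simp only [affVal, ctMap, PiLp.add_apply, PiLp.smul_apply, smul_eq_mul]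
  ring

lemma sum_fin_four {V : Type*} [AddCommMonoid V] (j : Fin 3) (f : Fin 4 → V) :
    ∑ k, f k = f j.castSucc + f (j + 1).castSucc + f (j + 2).castSucc + f 3 := by
  rw [Fin.sum_univ_castSucc, sum_fin_three j]; rfl

/-- The divergence form on a triangle of the split in terms of nodal values. -/
lemma divInt_eq (j : Fin 3) {ξ : Fin 4 → Fin 4 → E} (hs : ∀ k l, ξ k l = ξ l k) (c : Fin 3 → ℝ)
    {a b : Fin 4} (ha : a = (j + 1).castSucc) (hb : b = (j + 2).castSucc) {p q r s : ℝ}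
    (hp : p = affVal c (ctVert a)) (hq : q = affVal c (ctVert b)) (hr : r = affVal c (ctVert 3))
    (hS : s = p + q + r) :
    divInt j ξ c = (dHat j a (ξ a a) * p + dHat j b (ξ b b) * q + dHat j 3 (ξ 3 3) * r
      + dHat j b (ξ a b) * (p + s) + dHat j a (ξ a b) * (q + s)
      + dHat j 3 (ξ a 3) * (p + s) + dHat j a (ξ a 3) * (r + s)
      + dHat j 3 (ξ b 3) * (q + s) + dHat j b (ξ b 3) * (r + s)) / 18 := by
  have h0 : ∀ e, dHat j j.castSucc e = 0 := fun e => by rw [dHat_castSucc_apply, sub_self]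
  -- The divergence is affine on the triangle; its values at the vertices `a`, `b` and at the
  -- barycenter are `A - D`, `B - D` and `C - D`.
  let A := 4 * (dHat j a (ξ a a) + dHat j b (ξ a b) + dHat j 3 (ξ a 3))
  let B := 4 * (dHat j a (ξ a b) + dHat j b (ξ b b) + dHat j 3 (ξ b 3))
  let C := 4 * (dHat j a (ξ a 3) + dHat j b (ξ b 3) + dHat j 3 (ξ 3 3))
  let D := dHat j a (ξ a a) + dHat j b (ξ b b) + dHat j 3 (ξ 3 3)
  have hdiv : ∀ z, divergence (interp j ξ) (ctMap j z)
      = z 0 * A + z 1 * B + (1 - z 0 - z 1) * C - D := by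
    intro z
    obtain ⟨e0, e1, e2, e3⟩ := ctHat_ctMap j z
    rw [divergence_interp]
    simp only [sum_fin_four j, h0, e0, e1, e2, e3]
    rw [← ha, ← hb, hs b a, hs 3 a, hs 3 b]
    simp only [A, B, C, D]
    ring
  rw [divInt, integral_ctPiece ![(C - D) * r, (A - C) * r + (C - D) * (p - r),
    (B - C) * r + (C - D) * (q - r), (A - C) * (p - r), (A - C) * (q - r) + (B - C) * (p - r),
    (B - C) * (q - r)]]
  · simp only [Matrix.cons_val, A, B, C, D, hS]
    ring
  · intro z
    rw [hdiv, affVal_ctMap, ← ha, ← hb, ← hp, ← hq, ← hr]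
    simp only [quadVal, Matrix.cons_val]
    ring

/-! ### Pressures orthogonal to the divergences of interior fields -/

/-- Nodal values that vanish on the boundary of the reference triangle; `u k` is the value at the
midpoint of the `k`-th vertex and the barycenter. -/
def innerData (u : Fin 4 → E) (k l : Fin 4) : E := if l = 3 then u k else if k = 3 then u l else 0

lemma isInteriorData_innerData (u : Fin 4 → E) : IsInteriorData (innerData u) := by
  refine ⟨fun k l => ?_, fun k l hk hl => ?_⟩
  · unfold innerData
    by_cases hk : k = 3 <;> by_cases hl : l = 3 <;> simp [hk, hl]
  · simp [innerData, hk, hl]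

lemma exists_dBary_eq (m : Fin 3) (s t : ℝ) : ∃ e, dBary (m + 1) e = s ∧ dBary (m + 2) e = t := by
  fin_cases m
  · exact ⟨!₂[-s - t, s], by simp [dBary]⟩
  · exact ⟨!₂[t, -s - t], by simp [dBary]; ring⟩
  · exact ⟨!₂[s, t], by simp [dBary]⟩

lemma castSucc_ne_three (k : Fin 3) : k.castSucc ≠ 3 := (Fin.castSucc_lt_last k).ne

lemma divInt_innerData (j : Fin 3) (u : Fin 4 → E) (c : Fin 3 → ℝ) {p q r s : ℝ}
    (hp : p = affVal c (ctVert (j + 1).castSucc)) (hq : q = affVal c (ctVert (j + 2).castSucc))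
    (hr : r = affVal c (ctVert 3)) (hs : s = p + q + r) :
    divInt j (innerData u) c = (3 * dBary j (u 3) * r
      + 3 * dBary j (u (j + 1).castSucc) * (p + s)
      + (dBary (j + 1) (u (j + 1).castSucc) - dBary j (u (j + 1).castSucc)) * (r + s)
      + 3 * dBary j (u (j + 2).castSucc) * (q + s)
      + (dBary (j + 2) (u (j + 2).castSucc) - dBary j (u (j + 2).castSucc)) * (r + s)) / 18 := by
  rw [divInt_eq j (isInteriorData_innerData u).1 c rfl rfl hp hq hr hs]
  simp only [innerData, if_true, if_neg (castSucc_ne_three _), map_zero, dHat_three_apply,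
    dHat_castSucc_apply]
  ring

lemma fin_three_add : ∀ m : Fin 3, m + 1 + 1 = m + 2 ∧ m + 1 + 2 = m ∧ m + 2 + 1 = m ∧
    m + 2 + 2 = m + 1 := by decide

/-- A pressure on the reference triangle that is orthogonal to the divergences of all interior
fields is constant. -/
lemma const_of_divInt_eq_zero {c : Fin 3 → Fin 3 → ℝ}
    (h : ∀ η, IsInteriorData η → ∑ j, divInt j η (c j) = 0) :
    ∃ r, ∀ j, c j = ![r, 0, 0] := by
  -- An affine piece is determined by its values at the two outer vertices and at the barycenter of
  -- its triangle.
  let P : Fin 3 → ℝ := fun j => affVal (c j) (ctVert (j + 1).castSucc)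
  let Q : Fin 3 → ℝ := fun j => affVal (c j) (ctVert (j + 2).castSucc)
  let R : Fin 3 → ℝ := fun j => affVal (c j) (ctVert 3)
  have hdiv : ∀ j u, divInt j (innerData u) (c j) = _ := fun j u =>
    divInt_innerData j u (c j) (p := P j) (q := Q j) (r := R j) (s := P j + Q j + R j)
      rfl rfl rfl rfl
  -- A field concentrated at the barycenter sees only the three values `R`. The direction `e` is
  -- chosen so that it measures the jump between triangles `m` and `m + 1`.
  have hR : ∀ m, R (m + 1) = R m := by
    intro m
    obtain ⟨e, he1, he2⟩ := exists_dBary_eq m 1 0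
    have h0 := sum_dBary m e
    have h1 := h _ (isInteriorData_innerData fun k => if k = 3 then e else 0)
    simp only [hdiv, if_true, if_neg (castSucc_ne_three _), map_zero] at h1
    rw [sum_fin_three m, he1, he2, show dBary m e = -1 by linarith] at h1
    linarith
  have hR' : ∀ j, R j = R 0 := by
    have h1 := hR 0
    have h2 := hR 1
    exact forall_fin_three 0 rfl h1 (h2.trans h1)
  -- The test field is concentrated at the midpoint between vertex `m` and the barycenter, which
  -- belongs to the two triangles `m + 1` and `m + 2` only.
  have hm : ∀ m (e : E),
      3 * dBary (m + 1) e * (Q (m + 1) + (P (m + 1) + Q (m + 1) + R 0))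
        + (dBary m e - dBary (m + 1) e) * (R 0 + (P (m + 1) + Q (m + 1) + R 0))
        + (3 * dBary (m + 2) e * (P (m + 2) + (P (m + 2) + Q (m + 2) + R 0))
        + (dBary m e - dBary (m + 2) e) * (R 0 + (P (m + 2) + Q (m + 2) + R 0))) = 0 := by
    intro m e
    obtain ⟨a1, a2, a3, a4⟩ := fin_three_add m
    have n1 := (fin_three_ne_one m).symm
    have n2 := (fin_three_ne_two m).symm
    have h1 := h _ (isInteriorData_innerData fun k => if k = m.castSucc then e else 0)
    simp only [hdiv, Fin.castSucc_inj, if_neg (castSucc_ne_three m).symm, sum_fin_three m, a1, a2,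
      a3, a4, if_true, if_neg n1, if_neg n2, map_zero, hR'] at h1
    linarith
  -- Two directions at each of three midpoints give six equations for the six deviations of `P` and
  -- `Q` from `R 0`. For the sums `s` of the deviations on each triangle they imply `5 * s j = s (j
  -- + 1) + s (j + 2)`, which forces `s = 0`, and then every deviation vanishes.
  have key : ∀ m, P m = R 0 ∧ Q m = R 0 := by
    have hm1 : ∀ m, 3 * (Q (m + 1) + (P (m + 1) + Q (m + 1) + R 0))
        - 2 * (R 0 + (P (m + 1) + Q (m + 1) + R 0))
        - (R 0 + (P (m + 2) + Q (m + 2) + R 0)) = 0 := by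
      intro m
      obtain ⟨e, he1, he2⟩ := exists_dBary_eq m 1 0
      have h0 := sum_dBary m e
      have h1 := hm m e
      rw [he1, he2, show dBary m e = -1 by linarith] at h1
      linarith
    have hm2 : ∀ m, 3 * (P (m + 2) + (P (m + 2) + Q (m + 2) + R 0))
        - 2 * (R 0 + (P (m + 2) + Q (m + 2) + R 0))
        - (R 0 + (P (m + 1) + Q (m + 1) + R 0)) = 0 := by
      intro m
      obtain ⟨e, he1, he2⟩ := exists_dBary_eq m 0 1
      have h0 := sum_dBary m e
      have h1 := hm m e
      rw [he1, he2, show dBary m e = -1 by linarith] at h1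
      linarith
    intro m
    obtain ⟨a1, a2, a3, a4⟩ := fin_three_add m
    have p0 := hm1 m
    have p1 := hm1 (m + 1)
    have p2 := hm1 (m + 2)
    have q0 := hm2 m
    have q1 := hm2 (m + 1)
    have q2 := hm2 (m + 2)
    rw [a1, a2] at p1 q1
    rw [a3, a4] at p2 q2
    constructor <;> linarith
  refine ⟨R 0, fun j => ?_⟩
  have h1 : P j = R 0 := (key j).1
  have h2 : Q j = R 0 := (key j).2
  have h3 : R j = R 0 := hR' j
  simp only [P, Q, show R j = affVal (c j) (ctVert 3) from rfl] at h1 h2 h3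
  generalize R 0 = r at h1 h2 h3
  have : c j 0 = r ∧ c j 1 = 0 ∧ c j 2 = 0 := by
    fin_cases j <;> simp [affVal, ctVert] at h1 h2 h3 ⊢ <;> refine ⟨?_, ?_, ?_⟩ <;> linarith
  funext k
  fin_cases k
  · exact this.1
  · exact this.2.1
  · exact this.2.2

lemma divInt_zero_left (j : Fin 3) (c : Fin 3 → ℝ) : divInt j 0 c = 0 := by
  simpa using divInt_smul_left j 0 0 c

/-! ### Edge fluxes and the comparison of pressures in adjacent elements -/

/-- The tangent of the edge opposite to the `k`-th vertex. -/
def edgeVec (k : Fin 3) : E := ctVert (k + 2).castSucc - ctVert (k + 1).castSucc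

/-- The normal component of the pulled-back vector is the determinant of the mapped edge tangent and
`e`. So the flux depends on the element map only through its derivative along the edge. -/
lemma dBary_adj (k : Fin 3) (B : E →L[ℝ] E) (e : E) :
    dBary k (adj B e) = B (edgeVec k) 0 * e 1 - B (edgeVec k) 1 * e 0 := by
  have h1 : adj B e = (B (eb 0) 0 + B (eb 1) 1) • e - (e 0 • B (eb 0) + e 1 • B (eb 1)) := by
    rw [adj_apply, clm_apply_eq B e]
  rw [h1, clm_apply_eq B (edgeVec k)]
  fin_cases k <;> simp [dBary, edgeVec, ctVert] <;> ring

/-- The flux of an edge bubble. -/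
lemma divInt_edgeData (k j : Fin 3) (e : E) (r : ℝ) :
    divInt j (edgeData k e) ![r, 0, 0] = if j = k then -(2 / 3) * r * dBary k e else 0 := by
  have hc : ∀ x, affVal ![r, 0, 0] x = r := fun x => by simp [affVal]
  rw [divInt_eq j (edgeData_symm k e) ![r, 0, 0] rfl rfl (hc _).symm (hc _).symm (hc _).symm rfl]
  have n3 : ∀ m : Fin 3, (3 : Fin 4) ≠ m.castSucc := fun m => (castSucc_ne_three m).symm
  have n1 := fin_three_one_ne_two
  simp only [edgeData, Fin.castSucc_inj, n3, and_false, or_false, if_false, map_zero]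
  by_cases hj : j = k
  · subst hj
    have h0 := sum_dBary j e
    simp only [(n1 j), (n1 j).symm, and_false, false_and, and_self, or_false,
      if_true, if_false, map_zero, dHat_castSucc_apply]
    linear_combination (2 / 9 * r) * h0
  · have e1 : ¬ (j + 1 = k + 1 ∧ j + 2 = k + 2 ∨ j + 1 = k + 2 ∧ j + 2 = k + 1) := by
      revert j k; decide
    have e2 : ∀ m : Fin 3, ¬ (m = k + 1 ∧ m = k + 2 ∨ m = k + 2 ∧ m = k + 1) := by
      rintro m (⟨h1, h2⟩ | ⟨h1, h2⟩)
      · exact n1 k (h1.symm.trans h2)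
      · exact n1 k (h2.symm.trans h1)
    simp only [e1, e2, if_false, hj, map_zero]
    ring

namespace IsoMesh

variable {ι : Type*} (M : IsoMesh ι)

lemma divForm_single [Fintype ι] [DecidableEq ι] (i : ι) (ξ : Fin 4 → Fin 4 → E)
    (y : ι → Fin 3 → Fin 3 → ℝ) :
    M.divForm (Pi.single i ξ) y = ∑ j, divInt j (M.pullData i ξ) (y i j) := by
  rw [divForm_apply, Finset.sum_eq_single i]
  · rw [Pi.single_eq_same]
  · intro i' _ hi'
    refine Finset.sum_eq_zero fun j _ => ?_
    have h : M.pullData i' 0 = 0 := by funext k l; simp [pullData]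
    rw [Pi.single_eq_of_ne hi', h, divInt_zero_left]
  · exact fun h => absurd (Finset.mem_univ i) h

/-- Multiplying by the Piola matrix at the nodes turns every interior reference field `η` into an
admissible velocity on the single element `i`, whose divergence form is that of `η`. -/
lemma exists_const_of_divForm_eq_zero [Fintype ι] {y : ι → Fin 3 → Fin 3 → ℝ}
    (h : ∀ x ∈ M.toAffineMesh.velData, M.divForm x y = 0) (i : ι) :
    ∃ r, ∀ j, y i j = ![r, 0, 0] := by
  classical
  refine const_of_divInt_eq_zero fun η hη => ?_
  let ξ : Fin 4 → Fin 4 → E := fun k l => M.piola i (node k l) (η k l)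
  have hξ : M.pullData i ξ = η := by
    funext k l
    exact M.adj_piola i (node_mem_refTri k l) _
  have hξi : IsInteriorData ξ :=
    ⟨fun k l => by simp only [ξ]; rw [node_comm, hη.1], fun k l hk hl => by
      simp only [ξ]; rw [hη.2 k l hk hl, map_zero]⟩
  rw [← h _ (M.toAffineMesh.single_mem_velData i hξi), divForm_single, hξ]

lemma pullData_edgeData (i : ι) (k : Fin 3) (e : E) : M.pullData i (edgeData k e)
    = edgeData k (adj (fderiv ℝ (M.F i) (node (k + 1).castSucc (k + 2).castSucc)) e) := by
  funext a b
  unfold pullData edgeData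
  split_ifs with h
  · rcases h with ⟨rfl, rfl⟩ | ⟨rfl, rfl⟩
    · rfl
    · rw [node_comm]
  · exact map_zero _

/-- The tangential derivative of the element map at the midpoint of an edge. -/
lemma fderiv_F_edgeVec (i : ι) (k : Fin 3) :
    fderiv ℝ (M.F i) (node (k + 1).castSucc (k + 2).castSucc) (edgeVec k)
      = M.vert i (k + 2) - M.vert i (k + 1) := by
  set a := node (k + 1).castSucc (k + 2).castSucc
  have n0 := fin_three_ne_one k
  have n1 := fin_three_one_ne_two k
  have n2 := fin_three_ne_two k
  have hb : ∀ (m : Fin 3) (t : ℝ), bary m (a + t • edgeVec k)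
      = if m = k then 0 else if m = k + 1 then 1 / 2 - t else 1 / 2 + t := by
    intro m t
    have : a + t • edgeVec k = (1 / 2 - t) • ctVert (k + 1).castSucc
        + (1 / 2 + t) • ctVert (k + 2).castSucc := by
      simp only [a, node_eq_combo, edgeVec]; module
    rw [this, bary_combo _ _ _ (by ring), bary_ctVert, bary_ctVert]
    revert m
    refine forall_fin_three k ?_ ?_ ?_
    · simp [n0, n2]
    · simp [n0.symm, n1]
    · simp [n2.symm, n1.symm]
  -- In the edge parameter the midpoint value of `G` is multiplied by `1 - 4 * t ^ 2`, whose
  -- derivative at `t = 0` is zero. Only the chord between the vertices survives.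
  have hF : ∀ t : ℝ, M.F i (a + t • edgeVec k) = ((1 / 2 - t) * (2 * (1 / 2 - t) - 1)) •
      M.vert i (k + 1) + ((1 / 2 + t) * (2 * (1 / 2 + t) - 1)) • M.vert i (k + 2)
      + (4 * (1 / 2 - t) * (1 / 2 + t)) • M.G (M.edgeMid i k) := by
    intro t
    obtain ⟨a1, a2, a3, a4⟩ := fin_three_add k
    rw [F, AffineMesh.quadMap, sum_fin_three k, sum_fin_three k]
    simp only [hb, M.G_vert, a1, a2, a3, a4, if_true, n0.symm, n1.symm, n2.symm, if_false]
    module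
  have h1 : HasDerivAt (fun t : ℝ => M.F i (a + t • edgeVec k))
      (fderiv ℝ (M.F i) a (edgeVec k)) 0 := by
    have h2 : HasDerivAt (fun t : ℝ => a + t • edgeVec k) (edgeVec k) 0 := by
      simpa using ((hasDerivAt_id (0 : ℝ)).smul_const (edgeVec k)).const_add a
    have h3 : HasFDerivAt (M.F i) (fderiv ℝ (M.F i) a) (a + (0 : ℝ) • edgeVec k) := by
      rw [zero_smul, add_zero]
      exact ((M.contDiff_F i (n := 1)).differentiable (by simp) a).hasFDerivAt
    exact h3.comp_hasDerivAt 0 h2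
  rw [funext hF] at h1
  have hs := (hasDerivAt_id (0 : ℝ)).const_sub (1 / 2)
  have ha := (hasDerivAt_id (0 : ℝ)).const_add (1 / 2)
  have h4 := (((hs.mul ((hs.const_mul 2).sub_const 1)).smul_const (M.vert i (k + 1))).add
    ((ha.mul ((ha.const_mul 2).sub_const 1)).smul_const (M.vert i (k + 2)))).add
    (((hs.const_mul 4).mul ha).smul_const (M.G (M.edgeMid i k)))
  rw [h1.unique h4]
  simp only [id]
  module

/-- The edge bubble has opposite fluxes out of the two elements, because their common edge is
traversed in opposite directions. Orthogonality then says that `r i - r j` times the determinant of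
the edge and an arbitrary `e` vanishes. -/
lemma const_eq_of_sharesEdge [Fintype ι] {y : ι → Fin 3 → Fin 3 → ℝ} {r : ι → ℝ}
    (hr : ∀ i j, y i j = ![r i, 0, 0])
    (h : ∀ x ∈ M.toAffineMesh.velData, M.divForm x y = 0) {i j : ι} {k l : Fin 3}
    (hij : M.toAffineMesh.SharesEdge i j k l) : r i = r j := by
  classical
  have h1 : ∀ e : E, (r i - r j) * ((M.vert i (k + 2) - M.vert i (k + 1)) 0 * e 1
      - (M.vert i (k + 2) - M.vert i (k + 1)) 1 * e 0) = 0 := by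
    intro e
    have h2 := h _ (hij.mem_velData e)
    rw [map_add, LinearMap.add_apply, divForm_single, divForm_single] at h2
    simp only [pullData_edgeData, hr, divInt_edgeData, Finset.sum_ite_eq', Finset.mem_univ, if_true,
      dBary_adj, fderiv_F_edgeVec] at h2
    rw [← hij.2.1, ← hij.2.2] at h2
    simp only [PiLp.sub_apply] at h2 ⊢
    linarith
  by_contra hne
  have hne' : r i - r j ≠ 0 := sub_ne_zero.2 hne
  have e0 := (mul_eq_zero.1 (h1 (eb 1))).resolve_left hne'
  have e1 := (mul_eq_zero.1 (h1 (eb 0))).resolve_left hne'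
  simp [eb_apply] at e0 e1
  have hv : M.vert i (k + 2) = M.vert i (k + 1) := by
    ext m
    fin_cases m
    · change M.vert i (k + 2) 0 = M.vert i (k + 1) 0; linarith
    · change M.vert i (k + 2) 1 = M.vert i (k + 1) 1; linarith
  exact fin_three_one_ne_two k (M.toAffineMesh.vert_injective i hv).symm

/-- The discrete divergence is onto: no pressure is orthogonal to all divergences. -/
lemma eq_zero_of_divForm_eq_zero [Fintype ι] {y : ι → Fin 3 → Fin 3 → ℝ}
    (hy : y ∈ M.toAffineMesh.presData)
    (h : ∀ x ∈ M.toAffineMesh.velData, M.divForm x y = 0) : y = 0 := by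
  choose r hr using M.exists_const_of_divForm_eq_zero h
  have hc := M.toAffineMesh.eq_of_sharesEdge r fun i j k l hij => M.const_eq_of_sharesEdge hr h hij
  obtain ⟨w, hw⟩ := M.toAffineMesh.domain_nonempty
  obtain ⟨i₀, -⟩ := M.toAffineMesh.exists_affMap_eq hw
  obtain ⟨q, hq, hqy⟩ := hy
  have hae : ∀ᵐ z ∂(volume.restrict M.domain), q z = r i₀ := by
    have hnull : volume (⋃ i, M.affMap i '' (refTri \ ⋃ j, ctPiece j)) = 0 := by
      refine measure_iUnion_null fun i => ?_
      refine addHaar_image_eq_zero_of_differentiableOn_of_addHaar_eq_zero volume ?_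
        volume_refTri_diff
      have : ContDiff ℝ 1 (M.affMap i) := by unfold AffineMesh.affMap; fun_prop
      exact (this.differentiable (by simp)).differentiableOn
    filter_upwards [ae_restrict_mem M.toAffineMesh.domain_isOpen.measurableSet,
      ae_restrict_of_ae (measure_eq_zero_iff_ae_notMem.1 hnull)] with z hz hz'
    obtain ⟨i, x, hx, rfl⟩ := M.toAffineMesh.exists_affMap_eq hz
    by_cases hxj : x ∈ ⋃ j, ctPiece j
    · obtain ⟨j, hj⟩ := mem_iUnion.1 hxj
      rw [hqy i j x hj, hr i j, hc i i₀]
      simp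
    · refine absurd ?_ hz'
      exact mem_iUnion.2 ⟨i, x, ⟨hx, hxj⟩, rfl⟩
  -- The mean value refers to the affine domain, so the constant is integrated there and not over
  -- `Ω_h`.
  have hint := hq.1.2
  rw [integral_congr_ae hae, setIntegral_const, smul_eq_mul] at hint
  have hpos : 0 < volume.real M.domain :=
    ENNReal.toReal_pos (M.toAffineMesh.domain_isOpen.measure_pos volume
      M.toAffineMesh.domain_nonempty).ne' M.toAffineMesh.domain_bounded.measure_lt_top.ne
  have h0 := (mul_eq_zero.1 hint).resolve_left hpos.ne'
  funext i j k
  rw [hr i j, hc i i₀, h0]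
  fin_cases k <;> rfl

end IsoMesh

/-! ### The saddle point problem and the conclusion -/

/-- Finite-dimensional saddle point problems are uniquely solvable. -/
lemma existsUnique_saddle {X Y : Type*} [AddCommGroup X] [Module ℝ X] [FiniteDimensional ℝ X]
    [AddCommGroup Y] [Module ℝ Y] [FiniteDimensional ℝ Y] (a : X →ₗ[ℝ] X →ₗ[ℝ] ℝ)
    (b : X →ₗ[ℝ] Y →ₗ[ℝ] ℝ) (ha : ∀ x, a x x = 0 → x = 0) (hb : ∀ y, (∀ x, b x y = 0) → y = 0)
    (ℓ : X →ₗ[ℝ] ℝ) :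
    ∃! p : X × Y, (∀ v, a p.1 v - b v p.2 = ℓ v) ∧ ∀ q, b p.1 q = 0 := by
  let L : X × Y →ₗ[ℝ] Module.Dual ℝ X × Module.Dual ℝ Y :=
    (a.coprod (-b.flip)).prod (b.comp (LinearMap.fst ℝ X Y))
  have hL : ∀ p, L p = (ℓ, 0) ↔ (∀ v, a p.1 v - b v p.2 = ℓ v) ∧ ∀ q, b p.1 q = 0 := by
    intro p
    rw [Prod.ext_iff]
    refine and_congr ?_ ?_
    · rw [LinearMap.ext_iff]
      simp [L, sub_eq_add_neg]
    · rw [LinearMap.ext_iff]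
      simp [L]
  -- Testing the homogeneous problem with the solution itself gives `a x x = 0`, hence `x = 0`; then
  -- `y` is annihilated by all `b v`. Injectivity suffices because there are as many equations as
  -- unknowns.
  have hinj : Function.Injective L := by
    rw [injective_iff_map_eq_zero]
    rintro ⟨x, y⟩ h
    have h1 : ∀ v, a x v - b v y = 0 := fun v => by
      simpa [L, sub_eq_add_neg] using LinearMap.congr_fun (congrArg Prod.fst h) v
    have h2 : ∀ q, b x q = 0 := fun q => by
      simpa [L] using LinearMap.congr_fun (congrArg Prod.snd h) q
    obtain rfl : x = 0 := ha x (by have := h1 x; rwa [h2, sub_zero] at this)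
    obtain rfl : y = 0 := hb y fun v => by simpa using h1 v
    rfl
  have hfin : Module.finrank ℝ (X × Y) = Module.finrank ℝ (Module.Dual ℝ X × Module.Dual ℝ Y) := by
    rw [Module.finrank_prod, Module.finrank_prod, Subspace.dual_finrank_eq,
      Subspace.dual_finrank_eq]
  obtain ⟨p, hp⟩ := (LinearMap.injective_iff_surjective_of_finrank_eq_finrank hfin).1 hinj (ℓ, 0)
  exact ⟨p, (hL p).1 hp, fun p' hp' => hinj (((hL p').2 hp').trans hp.symm)⟩

namespace IsoMesh

variable {ι : Type*} (M : IsoMesh ι)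

/-- The discrete Stokes problem in terms of nodal values and pressure coefficients. -/
lemma isDiscreteStokesSolution_iff [Fintype ι] {ν : ℝ} {f : E → E}
    (hf : MemLp f 2 (volume.restrict M.Omega)) {u : E → E} {p : E → ℝ} (hu : u ∈ M.vel)
    (hp : p ∈ M.pres) {x : ι → Fin 4 → Fin 4 → E} {y : ι → Fin 3 → Fin 3 → ℝ}
    (hx : M.HasVelData u x) (hy : M.HasPresData p y) :
    IsDiscreteStokesSolution M ν f u p ↔
      (∀ z ∈ M.toAffineMesh.velData, ν * M.gradForm x z - M.divForm z y = M.load hf z) ∧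
        ∀ w ∈ M.toAffineMesh.presData, M.divForm x w = 0 := by
  constructor
  · rintro ⟨-, -, h1, h2⟩
    refine ⟨fun z hz => ?_, fun w hw => ?_⟩
    · obtain ⟨v, hv, hvz⟩ := M.exists_vel hz
      rw [← M.integral_gradDot hx hvz, ← M.integral_divergence hvz hy, h1 v hv,
        M.integral_load hf hvz]
    · obtain ⟨q, hq, hqw⟩ := M.exists_pres hw
      rw [← M.integral_divergence hx hqw, h2 q hq]
  · rintro ⟨h1, h2⟩
    refine ⟨hu, hp, fun v hv => ?_, fun q hq => ?_⟩
    · obtain ⟨z, hz, hvz⟩ := M.exists_velData hv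
      rw [M.integral_gradDot hx hvz, M.integral_divergence hvz hy, h1 z hz,
        M.integral_load hf hvz]
    · obtain ⟨w, hw, hqw⟩ := M.exists_presData hq
      rw [M.integral_divergence hx hqw, h2 w hw]

end IsoMesh

end IsoStokes

end

theorem mainTheorem6 {ι : Type*} [Finite ι] (M : IsoStokes.IsoMesh ι) (ν : ℝ) (hν : 0 < ν)
    (f : IsoStokes.E → IsoStokes.E) (hf : MemLp f 2 (volume.restrict M.Omega)) :
    ∃ (u : IsoStokes.E → IsoStokes.E) (p : IsoStokes.E → ℝ),
      IsoStokes.IsDiscreteStokesSolution M ν f u p ∧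
      ∀ (u' : IsoStokes.E → IsoStokes.E) (p' : IsoStokes.E → ℝ),
        IsoStokes.IsDiscreteStokesSolution M ν f u' p' →
          u' =ᵐ[volume.restrict M.Omega] u ∧ p' =ᵐ[volume.restrict M.Omega] p := by
  have := Fintype.ofFinite ι
  let X := M.toAffineMesh.velData
  let Y := M.toAffineMesh.presData
  obtain ⟨⟨x, y⟩, ⟨h1, h2⟩, huniq⟩ := IsoStokes.existsUnique_saddle
    (ν • M.gradForm.domRestrict₁₂ X X) (M.divForm.domRestrict₁₂ X Y)
    (fun x h => Subtype.ext (M.eq_zero_of_gradForm_self x.2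
      ((mul_eq_zero.1 h).resolve_left hν.ne')))
    (fun y h => Subtype.ext (M.eq_zero_of_divForm_eq_zero y.2 fun x hx => h ⟨x, hx⟩))
    ((M.load hf).domRestrict X)
  obtain ⟨u, hu, hux⟩ := M.exists_vel x.2
  obtain ⟨p, hp, hpy⟩ := M.exists_pres y.2
  refine ⟨u, p, (M.isDiscreteStokesSolution_iff hf hu hp hux hpy).2
    ⟨fun z hz => h1 ⟨z, hz⟩, fun w hw => h2 ⟨w, hw⟩⟩, fun u' p' h => ?_⟩
  -- Any other solution has data solving the same finite-dimensional problem, hence the same data.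
  -- Equal data means equal values on all open curved triangles of the split, that is, almost
  -- everywhere.
  obtain ⟨x', hx', hux'⟩ := M.exists_velData h.1
  obtain ⟨y', hy', hpy'⟩ := M.exists_presData h.2.1
  obtain ⟨h1', h2'⟩ := (M.isDiscreteStokesSolution_iff hf h.1 h.2.1 hux' hpy').1 h
  have heq := huniq (⟨x', hx'⟩, ⟨y', hy'⟩) ⟨fun z => h1' z z.2, fun w => h2' w w.2⟩
  obtain rfl : x' = x := congrArg (fun p : X × Y => (p.1 : ι → Fin 4 → Fin 4 → IsoStokes.E)) heq
  obtain rfl : y' = y := congrArg (fun p : X × Y => (p.2 : ι → Fin 3 → Fin 3 → ℝ)) heq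
  exact ⟨M.ae_Omega fun i j z hz => (hux' i j z hz).trans (hux i j z hz).symm,
    M.ae_Omega fun i j z hz => (hpy' i j z hz).trans (hpy i j z hz).symm⟩
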